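/- **Conventions.** A partition $\lambda$ (possibly empty) is identified with its diagram $\{(i,j):1\le j\le\ell(\lambda),\ 1\le i\le\lambda_j\}$ (column $i$, row $j$; row $1$ is the bottom row). For a box $\square=(i,j)\in\lambda$ put $a_\lambda(\square)=\lambda_j-i$ and $\ell_\lambda(\square)=\lambda^t_i-j$. For partitions $\lambda^1,\dots,\lambda^r$ and $B\subset[r]$ let $\lambda^B=\bigoplus_{b\in B}\lambda^b$ be the partition obtained by adding parts coordinatewise. *Fillings.* Let $\mathcal A=\{1,\bar1,2,\bar2,\dots\}$ with the total order $1<2<\cdots<\bar2<\bar1$, where the letters $i$ are positive and the letters $\bar i$ negative, and $|i|=|\bar i|=i$. Write $x\le_{+}y$ (resp. $x\le_-y$) if $x<y$ or $x=y$ is positive (resp. negative). A super filling of $\mu$ is a map $\sigma:\mu\to\mathcal A$; an ordinary filling is a map $\sigma:\mu\to\mathbb N_+$ (all entries positive). $\mathrm{Des}(\sigma)$ is the set of boxes $\square$ lying directly above a box $\square'$ with $\sigma(\square')\le_-\sigma(\square)$, and $\mathrm{maj}(\sigma)=\sum_{\square\in\mathrm{Des}(\sigma)}(\ell_\mu(\square)+1)$.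 Two boxes attack each other if they are in the same row, or in consecutive rows with the upper one strictly to the right of the lower one. $\mathrm{Inv}(\sigma)$ is the set of pairs $(\square,\square')$ of attacking boxes such that $\square$ strictly precedes $\square'$ in the reading order (rows from top to bottom, left to right in each row) and $\sigma(\square')\le_-\sigma(\square)$; $\mathrm{inv}(\sigma)=\#\mathrm{Inv}(\sigma)-\sum_{\square\in\mathrm{Des}(\sigma)}a_\mu(\square)$. An inversion pair is a pair $(\square_1,\square_2)$ of boxes in the same row, $\square_1$ to the left of $\square_2$, such that, with $\square_3$ the box directly below $\square_1$, one has $\sigma(\square_1)\le_+\sigma(\square_3)\le_-\sigma(\square_2)$ or $\sigma(\square_3)\le_-\sigma(\square_2)\le_-\sigma(\square_1)$ or $\sigma(\square_2)\le_-\sigma(\square_1)\le_+\sigma(\square_3)$; in the first row $\sigma(\square_3)$ is taken smaller than all entries. *Macdonald cumulants.* Let $\tilde H_\mu(\boldsymbol x;q,t)=\sum_{\sigma:\mu\to\mathbb N_+}q^{\mathrm{inv}(\sigma)}t^{\mathrm{maj}(\sigma)}\prod_{\square\in\mu}x_{\sigma(\square)}$ be the (transformed) Macdonald polynomial and $$\kappa(\lambda^1,\dots,\lambda^r)(\boldsymbol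 x;q,t)=(q-1)^{1-r}\sum_{\pi}(-1)^{\#\pi-1}(\#\pi-1)!\prod_{B\in\pi}\tilde H_{\lambda^B}(\boldsymbol x;q,t),$$ the sum being over all set partitions $\pi$ of $[r]$. For a symmetric function $f=\sum_\lambda c_\lambda p_\lambda$ over $\mathbb Q(q,t)$, written uniquely in power sums, $f[A]=\sum_\lambda c_\lambda\prod_ip_{\lambda_i}[A]$, where $p_k[A]$ is obtained from $A$ by replacing each indeterminate by its $k$-th power; $\boldsymbol X=x_1+x_2+\cdots$. *Inversion polynomial.* For a multigraph $G$ on $[r]$ (loops allowed), with $e_{i,j}(G)$ edges joining $i$ and $j$, and with root $1$, let $$\mathcal I_G(q)=q^{\#\text{loops of }G}\sum_{T}q^{\kappa(T)}\prod_{\{i,j\}\in T}[e_{i,j}(G)]_q,\qquad [n]_q=1+q+\cdots+q^{n-1},$$ over all spanning trees $T$ of the simple graph underlying $G$ (so $\mathcal I_G=0$ if $G$ is disconnected, and for $r=1$ the only tree is the single vertex). Here $\kappa(T)=\sum e_{\mathrm{parent}(i),j}(G)$ over all pairs $(i,j)$ of non-root vertices such that $i$ is an ancestor of $j$ in $T$,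 $i>j$, and $j$ is adjacent in $G$ to the parent of $i$ in $T$. *The multigraph $G^\sigma_{\lambda^1,\dots,\lambda^r}$.* The columns of $\lambda^{[r]}$ are obtained by sorting the columns of $\lambda^1,\dots,\lambda^r$ by decreasing length, columns of equal length being ordered by the index of the partition they come from; a box of $\lambda^{[r]}$ is coloured by $b$ if its column comes from $\lambda^b$. For a super filling $\sigma$ of $\lambda^{[r]}$, $G^\sigma_{\lambda^1,\dots,\lambda^r}$ is the multigraph on $[r]$ in which $e_{i,j}$ is the number of inversion pairs of $\sigma$ whose two boxes have set of colours $\{i,j\}$ (loops for $i=j$). **Lemma.** Let $r$ be a positive integer and $\lambda^1,\dots,\lambda^r$ partitions. Then $\kappa(\lambda^1,\dots,\lambda^r)$ has a unique expansion in power sums (so that the plethystic substitution is defined), and $$\kappa(\lambda^1,\dots,\lambda^r)[\boldsymbol X(t-1);q,t]=\sum_{\sigma}\mathcal I_{G^\sigma_{\lambda^1,\dots,\lambda^r}}(q)\,(-1)^{m(\sigma)}\,t^{p(\sigma)+\mathrm{maj}(\sigma)}\,\boldsymbol x^{|\sigma|},$$ where the sum is over all super fillings $\sigma:\lambda^{[r]}\to\mathcal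 A$ that are compatible with $\lambda^{[r]}$, i.e. $|\sigma(x,y)|\ge y$ for every box $(x,y)\in\lambda^{[r]}$; $m(\sigma)$ and $p(\sigma)$ are the numbers of negative and of positive entries of $\sigma$, and $\boldsymbol x^{|\sigma|}=\prod_{\square\in\lambda^{[r]}}x_{|\sigma(\square)|}$. -/

import Mathlib

noncomputable section

namespace MacCumu

open scoped Classical

/-! ### The coefficient field, power sums and plethysm -/

/-- Polynomials in the two indeterminates `q` (index `0`) and `t` (index `1`). -/
abbrev PolyQT := MvPolynomial (Fin 2) ℚ

/-- The field `ℚ(q, t)`. -/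
abbrev FieldQT := FractionRing PolyQT

/-- The element `q` of `ℚ(q, t)`. -/
def qq : FieldQT := algebraMap PolyQT FieldQT (MvPolynomial.X 0)

/-- The element `t` of `ℚ(q, t)`. -/
def tt : FieldQT := algebraMap PolyQT FieldQT (MvPolynomial.X 1)

/-- The power sum `p_k(x) = ∑_{i ≥ 1} x_i ^ k`, for `k ≥ 1`, as a formal power series in
`x_1, x_2, …`. -/
def powerSum (R : Type*) [CommRing R] (k : ℕ) : MvPowerSeries ℕ+ R :=
  fun m => if ∃ i : ℕ+, m = Finsupp.single i k then 1 else 0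

/-- `p_k[A]`: replace every indeterminate `a` among `q, t, x_1, x_2, …` by `a ^ k`. -/
def powerSumAt (k : ℕ+) (A : MvPowerSeries ℕ+ PolyQT) : MvPowerSeries ℕ+ FieldQT :=
  MvPowerSeries.map (algebraMap PolyQT FieldQT)
    (MvPowerSeries.expand (k : ℕ) k.ne_zero
      (MvPowerSeries.map (MvPolynomial.expand (k : ℕ)).toRingHom A))

/-- `P`, a polynomial in symbols `p_1, p_2, …` over `ℚ(q, t)`, is a power-sum expansion of `f`. -/
def IsPowerSumExpansion (f : MvPowerSeries ℕ+ FieldQT) (P : MvPolynomial ℕ+ FieldQT) : Prop :=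
  MvPolynomial.aeval (fun k : ℕ+ => powerSum FieldQT (k : ℕ)) P = f

/-- The plethystic substitution `f[A]`: expand `f` in power sums, `f = ∑ c_λ p_λ`, and replace each
`p_λ` by `∏ p_{λ_i}[A]`, the coefficients `c_λ` being left untouched.  It is meant for series `f`
with a unique power-sum expansion, i.e. symmetric functions, and is `0` if there is none. -/
def plethysm (f : MvPowerSeries ℕ+ FieldQT) (A : MvPowerSeries ℕ+ PolyQT) :
    MvPowerSeries ℕ+ FieldQT :=
  if h : ∃ P, IsPowerSumExpansion f P then
    MvPolynomial.aeval (fun k : ℕ+ => powerSumAt k A) h.choose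
  else 0

/-- The series `X(t - 1) = (x_1 + x_2 + ⋯)(t - 1)`. -/
def alphabetXtSubOne : MvPowerSeries ℕ+ PolyQT :=
  powerSum PolyQT 1 * MvPowerSeries.C (MvPolynomial.X 1 - 1)

/-! ### Diagrams

Boxes are pairs `(row, column)` counted from `0`, and rows are drawn bottom to top, so that
row `0` is the bottom row and `(j + 1, i)` is the box directly above `(j, i)`. -/

/-- `λ^B = ⨁_{b ∈ B} λ^b`, the entrywise sum of partitions. -/
def sumDiagram {ι : Type*} (L : ι → YoungDiagram) (B : Finset ι) : YoungDiagram where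
  cells := (Finset.range (∑ b ∈ B, (L b).colLen 0) ×ˢ
      Finset.range (∑ b ∈ B, (L b).rowLen 0)).filter
        fun c => c.2 < ∑ b ∈ B, (L b).rowLen c.1
  isLowerSet := by
    rintro ⟨j, i⟩ ⟨j', i'⟩ ⟨hj, hi⟩ h
    simp only [Finset.coe_filter, Finset.mem_product, Finset.mem_range, Set.mem_ofPred_eq] at h ⊢
    simp only at hj hi
    have h1 : ∑ b ∈ B, (L b).rowLen j ≤ ∑ b ∈ B, (L b).rowLen j' :=
      Finset.sum_le_sum fun b _ => (L b).rowLen_anti _ _ hj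
    omega

theorem mem_sumDiagram {ι : Type*} (L : ι → YoungDiagram) (B : Finset ι) (j i : ℕ) :
    (j, i) ∈ sumDiagram L B ↔ i < ∑ b ∈ B, (L b).rowLen j := by
  rw [← YoungDiagram.mem_cells]
  simp only [sumDiagram, Finset.mem_filter, Finset.mem_product, Finset.mem_range]
  refine ⟨fun h => h.2, fun h => ⟨⟨?_, ?_⟩, h⟩⟩
  · have h0 : ∑ b ∈ B, (L b).rowLen j ≠ 0 := by omega
    obtain ⟨b, hb, hb0⟩ := Finset.exists_ne_zero_of_sum_ne_zero h0
    have h2 : j < (L b).colLen 0 := by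
      rw [← YoungDiagram.mem_iff_lt_colLen, YoungDiagram.mem_iff_lt_rowLen]
      omega
    exact h2.trans_le (Finset.single_le_sum (f := fun b => (L b).colLen 0)
      (fun _ _ => Nat.zero_le _) hb)
  · exact h.trans_le (Finset.sum_le_sum fun b _ => (L b).rowLen_anti _ _ (Nat.zero_le _))

/-- A box of the diagram `μ`. -/
abbrev Box (μ : YoungDiagram) := {c : ℕ × ℕ // c ∈ μ.cells}

namespace Box

variable {μ : YoungDiagram}

/-- The row of a box, counted from `0` at the bottom. -/
def row (c : Box μ) : ℕ := c.1.1

/-- The column of a box, counted from `0` at the left. -/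
def col (c : Box μ) : ℕ := c.1.2

/-- The arm-length of a box (no truncation occurs, since `c` is a box of `μ`). -/
def arm (c : Box μ) : ℕ := μ.rowLen c.row - (c.col + 1)

/-- The leg-length of a box (no truncation occurs, since `c` is a box of `μ`). -/
def leg (c : Box μ) : ℕ := μ.colLen c.col - (c.row + 1)

/-- `c` lies directly above `d`. -/
def DirectlyAbove (c d : Box μ) : Prop := c.row = d.row + 1 ∧ c.col = d.col

/-- `c` and `d` attack each other. -/
def Attack (c d : Box μ) : Prop :=
  c.row = d.row ∨ (c.row = d.row + 1 ∧ d.col < c.col) ∨ (d.row = c.row + 1 ∧ c.col < d.col)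

/-- `c` strictly precedes `d` in the reading order: row by row from top to bottom, and from left to
right in each row. -/
def Precedes (c d : Box μ) : Prop := d.row < c.row ∨ (c.row = d.row ∧ c.col < d.col)

end Box

/-! ### Fillings and their statistics

An alphabet is a totally ordered set `S` with a predicate `neg` that singles out its negative
letters.  Ordinary fillings have entries in `ℕ+`, without negative letters: then `≤₊` is `≤` and
`≤₋` is `<`. -/

/-- A filling of the diagram `μ` with entries in `S`. -/
abbrev Filling (μ : YoungDiagram) (S : Type*) := Box μ → S

section Statistics

variable {S : Type*} [LinearOrder S]

/-- `x ≤₊ y`: `x < y`, or `x = y` is a positive letter. -/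
def LePos (neg : S → Prop) (x y : S) : Prop := x < y ∨ (x = y ∧ ¬ neg x)

/-- `x ≤₋ y`: `x < y`, or `x = y` is a negative letter. -/
def LeNeg (neg : S → Prop) (x y : S) : Prop := x < y ∨ (x = y ∧ neg x)

variable {μ : YoungDiagram}

/-- The descent set: the upper boxes `c` of the descents `σ(d) ≤₋ σ(c)`, with `c` directly above
`d`. -/
def desSet (neg : S → Prop) (σ : Filling μ S) : Finset (Box μ) :=
  Finset.univ.filter fun c => ∃ d : Box μ, c.DirectlyAbove d ∧ LeNeg neg (σ d) (σ c)

/-- The major index. -/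
def maj (neg : S → Prop) (σ : Filling μ S) : ℕ := ∑ c ∈ desSet neg σ, (c.leg + 1)

/-- The set of inversions. -/
def invSet (neg : S → Prop) (σ : Filling μ S) : Finset (Box μ × Box μ) :=
  Finset.univ.filter fun p =>
    p.1.Attack p.2 ∧ p.1.Precedes p.2 ∧ LeNeg neg (σ p.2) (σ p.1)

/-- The statistic `inv(σ) = #Inv(σ) - ∑_{c ∈ Des(σ)} a(c)`. -/
def inv (neg : S → Prop) (σ : Filling μ S) : ℤ :=
  ((invSet neg σ).card : ℤ) - ∑ c ∈ desSet neg σ, (c.arm : ℤ)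

/-- The letters `x₁, x₂, x₃` are counterclockwise increasing. -/
def CCIncreasing (neg : S → Prop) (x₁ x₂ x₃ : S) : Prop :=
  (LePos neg x₁ x₃ ∧ LeNeg neg x₃ x₂) ∨
  (LeNeg neg x₃ x₂ ∧ LeNeg neg x₂ x₁) ∨
  (LeNeg neg x₂ x₁ ∧ LePos neg x₁ x₃)

/-- The set of inversion pairs `(c₁, c₂)`: `c₁` lies in the row of `c₂`, to its left, and the entries
of `c₁, c₂, c₃` are counterclockwise increasing, where `c₃` is the box directly below `c₁`.  For
boxes in the bottom row the missing entry of `c₃` is taken smaller than all the other entries, so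
that the condition becomes `σ(c₂) ≤₋ σ(c₁)`. -/
def invPairs (neg : S → Prop) (σ : Filling μ S) : Finset (Box μ × Box μ) :=
  Finset.univ.filter fun p =>
    p.1.row = p.2.row ∧ p.1.col < p.2.col ∧
      ((p.1.row = 0 ∧ LeNeg neg (σ p.2) (σ p.1)) ∨
        ∃ c₃ : Box μ, p.1.DirectlyAbove c₃ ∧ CCIncreasing neg (σ p.1) (σ p.2) (σ c₃))

end Statistics

/-- The exponent of the monomial `∏_c x_{|σ(c)|}`, where `abs` assigns to a letter its index. -/
def weight {S : Type*} {μ : YoungDiagram} (abs : S → ℕ+) (σ : Filling μ S) : ℕ+ →₀ ℕ :=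
  ∑ c, Finsupp.single (abs (σ c)) 1

/-- If every index belongs to finitely many letters, finitely many fillings have a given weight. -/
theorem finite_weight_eq {S : Type*} {μ : YoungDiagram} (abs : S → ℕ+)
    (habs : ∀ n, {a | abs a = n}.Finite) (m : ℕ+ →₀ ℕ) :
    {σ : Filling μ S | weight abs σ = m}.Finite := by
  have hT : (⋃ n ∈ m.support, {a | abs a = n}).Finite :=
    m.support.finite_toSet.biUnion fun n _ => habs n
  refine (Set.Finite.pi' (fun _ : Box μ => hT)).subset ?_
  rintro σ rfl c
  simp only [Set.mem_iUnion, Set.mem_ofPred_eq, exists_prop, exists_eq_right']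
  rw [Finsupp.mem_support_iff, weight, Finsupp.finsetSum_apply]
  intro h0
  have h1 := (Finset.sum_eq_zero_iff.mp h0) c (Finset.mem_univ c)
  simp at h1

/-- The formal power series `∑_{σ ∈ F} w(σ) ∏_c x_{|σ(c)|}`, for a set `F` of fillings.  Each of its
coefficients is a finite sum as soon as every index belongs to finitely many letters. -/
def fillingSeries {S : Type*} {μ : YoungDiagram} (abs : S → ℕ+) (F : Set (Filling μ S))
    (w : Filling μ S → FieldQT) : MvPowerSeries ℕ+ FieldQT :=
  fun m => ∑ᶠ σ ∈ {σ | σ ∈ F ∧ weight abs σ = m}, w σ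

/-! ### Macdonald polynomials and their cumulants -/

/-- The (transformed) Macdonald polynomial, defined by Haglund's formula
`H̃_μ = ∑_{σ : μ → ℕ+} q ^ inv(σ) t ^ maj(σ) x ^ σ`. -/
def macdonaldH (μ : YoungDiagram) : MvPowerSeries ℕ+ FieldQT :=
  fillingSeries (S := ℕ+) (μ := μ) id Set.univ fun σ =>
    qq ^ (inv (fun _ => False) σ) * tt ^ (maj (fun _ => False) σ)

/-- The joint cumulant `∑_π (-1)^(#π - 1) (#π - 1)! ∏_{B ∈ π} u_B`, over all set partitions `π` of
the index set. -/
def cumulant {J A : Type*} [Fintype J] [CommRing A] (u : Finset J → A) : A :=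
  ∑ π : Finpartition (Finset.univ : Finset J),
    (-1) ^ (π.parts.card - 1) * (Nat.factorial (π.parts.card - 1) : A) * ∏ B ∈ π.parts, u B

/-- The Macdonald cumulant `κ(λ^1, …, λ^r)`. -/
def macdonaldCumulant {r : ℕ} (L : Fin r → YoungDiagram) : MvPowerSeries ℕ+ FieldQT :=
  MvPowerSeries.C (((qq - 1) ^ (r - 1))⁻¹) * cumulant fun B => macdonaldH (sumDiagram L B)

/-! ### Super fillings -/

/-- The super alphabet `{1, 2, …} ∪ {1̄, 2̄, …}` with the order `1 < 2 < ⋯ < 2̄ < 1̄`. -/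
abbrev SuperLetter := Lex (ℕ+ ⊕ ℕ+ᵒᵈ)

/-- The positive letter `i`. -/
def SuperLetter.pos (i : ℕ+) : SuperLetter := toLex (Sum.inl i)

/-- The negative letter `ī`. -/
def SuperLetter.bar (i : ℕ+) : SuperLetter := toLex (Sum.inr (OrderDual.toDual i))

/-- The absolute value `|i| = |ī| = i`. -/
def SuperLetter.abs (a : SuperLetter) : ℕ+ := Sum.elim id OrderDual.ofDual (ofLex a)

/-- A letter is negative if it is of the form `ī`. -/
def SuperLetter.IsNeg (a : SuperLetter) : Prop := ∃ i, a = SuperLetter.bar i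

theorem SuperLetter.finite_abs_eq (n : ℕ+) : {a : SuperLetter | a.abs = n}.Finite := by
  refine (Set.toFinite {SuperLetter.pos n, SuperLetter.bar n}).subset ?_
  rintro (a | a) rfl
  · exact Or.inl rfl
  · exact Or.inr rfl

/-- A super filling is compatible with its shape if the absolute value of each entry is at least the
number (from `1`) of its row. -/
def IsCompatible {μ : YoungDiagram} (σ : Filling μ SuperLetter) : Prop :=
  ∀ c : Box μ, c.row + 1 ≤ ((σ c).abs : ℕ)

/-- The number of negative entries. -/
def numNeg {μ : YoungDiagram} (σ : Filling μ SuperLetter) : ℕ :=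
  (Finset.univ.filter fun c => (σ c).IsNeg).card

/-- The number of positive entries. -/
def numPos {μ : YoungDiagram} (σ : Filling μ SuperLetter) : ℕ :=
  (Finset.univ.filter fun c => ¬ (σ c).IsNeg).card

/-! ### The colouring of the sum of diagrams, and the multigraph of a filling -/

/-- The columns of the diagrams `λ^1, …, λ^r`.  The `k`-th column of `λ^b` is recorded as
`(length, b, k)`; the order is by decreasing length, then by `b`, then by `k`. -/
def columns {r : ℕ} (L : Fin r → YoungDiagram) : Finset (ℕᵒᵈ ×ₗ (Fin r ×ₗ ℕ)) :=
  (Finset.univ.sigma fun b => Finset.range ((L b).rowLen 0)).image fun x =>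
    toLex (OrderDual.toDual ((L x.1).colLen x.2), toLex (x.1, x.2))

theorem card_columns {r : ℕ} (L : Fin r → YoungDiagram) :
    (columns L).card = ∑ b, (L b).rowLen 0 := by
  rw [columns, Finset.card_image_of_injective]
  · simp
  · rintro ⟨b, k⟩ ⟨b', k'⟩ h
    simp only [EmbeddingLike.apply_eq_iff_eq, Prod.mk.injEq] at h
    obtain ⟨-, rfl, rfl⟩ := h
    rfl

theorem col_lt_card_columns {r : ℕ} (L : Fin r → YoungDiagram)
    (c : Box (sumDiagram L Finset.univ)) : c.col < (columns L).card := by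
  have h := (mem_sumDiagram L Finset.univ c.row c.col).mp c.2
  rw [card_columns]
  exact h.trans_le (Finset.sum_le_sum fun b _ => (L b).rowLen_anti _ _ (Nat.zero_le _))

/-- The colour of a box of `λ^{[r]}`: the index `b` of the diagram from which its column comes, when
the columns of `λ^{[r]}` are obtained by sorting those of `λ^1, …, λ^r`. -/
def color {r : ℕ} (L : Fin r → YoungDiagram) (c : Box (sumDiagram L Finset.univ)) : Fin r :=
  (ofLex (ofLex ((columns L).orderEmbOfFin rfl ⟨c.col, col_lt_card_columns L c⟩)).2).1

/-- A multigraph on the vertex set `V`, loops allowed, given by its edge multiplicities: `G s(i, j)` is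
the number `e_{i,j}(G)` of edges joining `i` and `j`, and `G s(i, i)` is the number of loops at
`i`. -/
abbrev Multigraph (V : Type*) := Sym2 V → ℕ

/-- The multigraph `G^σ` of a super filling `σ` of `λ^{[r]}`: its vertices are the colours, and the
number of edges between `i` and `j` is the number of inversion pairs coloured by `{i, j}`. -/
def fillingGraph {r : ℕ} (L : Fin r → YoungDiagram)
    (σ : Filling (sumDiagram L Finset.univ) SuperLetter) : Multigraph (Fin r) :=
  fun e => ((invPairs SuperLetter.IsNeg σ).filter fun p => s(color L p.1, color L p.2) = e).card

/-! ### The inversion polynomial of a multigraph -/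

namespace Multigraph

variable {V : Type*}

/-- The simple graph obtained by replacing multiple edges by single ones (loops, which no tree
contains, are dropped). -/
def simple (G : Multigraph V) : SimpleGraph V where
  Adj i j := i ≠ j ∧ 0 < G s(i, j)
  symm := ⟨fun i j h => ⟨h.1.symm, by rw [Sym2.eq_swap]; exact h.2⟩⟩
  loopless := ⟨fun i h => h.1 rfl⟩

/-- In a tree `T` with root `v`, the vertex `i` is an ancestor of `j`: it differs from `j` and lies
on the path from `j` to `v`. -/
def IsAncestor (T : SimpleGraph V) (v i j : V) : Prop :=
  i ≠ j ∧ ∃ p : T.Walk j v, p.IsPath ∧ i ∈ p.support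

/-- In a tree `T` with root `v`, the vertex `i` is the parent of `j`. -/
def IsParent (T : SimpleGraph V) (v i j : V) : Prop :=
  IsAncestor T v i j ∧ T.Adj i j

variable [Fintype V] [LinearOrder V]

/-- The triples `(p, i, j)` such that `(i, j)` is a `κ`-inversion of the spanning tree `T` with root
`v`, and `p` is the parent of `i`. -/
def kappaInversions (G : Multigraph V) (T : SimpleGraph V) (v : V) : Finset (V × V × V) :=
  Finset.univ.filter fun x =>
    x.2.1 ≠ v ∧ x.2.2 ≠ v ∧ IsAncestor T v x.2.1 x.2.2 ∧ x.2.2 < x.2.1 ∧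
      IsParent T v x.1 x.2.1 ∧ G.simple.Adj x.1 x.2.2

/-- `κ(T)`, the sum of `e_{parent(i), j}(G)` over all `κ`-inversions `(i, j)` of `T`. -/
def kappa (G : Multigraph V) (T : SimpleGraph V) (v : V) : ℕ :=
  ∑ x ∈ kappaInversions G T v, G s(x.1, x.2.2)

/-- The `G`-inversion polynomial evaluated at `q`, for the root `v`:
`q ^ #loops * ∑_T q ^ κ(T) ∏_{{i, j} ∈ T} [e_{i,j}(G)]_q`, over the spanning trees `T`. -/
def inversionPoly {R : Type*} [CommRing R] (G : Multigraph V) (v : V) (q : R) : R :=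
  q ^ (∑ i, G s(i, i)) *
    ∑ T ∈ Finset.univ.filter (fun T : SimpleGraph V => T ≤ G.simple ∧ T.IsTree),
      q ^ kappa G T v * ∏ e ∈ T.edgeFinset, ∑ k ∈ Finset.range (G e), q ^ k

end Multigraph

end MacCumu

end

/-! Haglund's statistics are local. The weight `q^inv t^maj` of a filling `σ` is a product, over the
ordered pairs of boxes `(u, v)` with `σ(v) ≤₋ σ(u)`, of a factor depending on the two boxes only:
`q` if `v` follows `u` in the reading order inside a window, `q^(-arm) t^(leg+1)` if `v` sits
exactly at the end of the window, that is directly below `u`, and `1` otherwise (`haglundWeight`).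
Four facts are drawn from this.

Symmetry. For such window weights the generating function over two letters is symmetric
(`twoLetterSum_windowWeight_comm`). Hence Macdonald polynomials are symmetric and have power-sum
expansions (`hasPowerSumExpansion_macdonaldH`); these are unique because power sums are
algebraically independent.

Superization. If the letter `i` has weight `x_i` and `j̄` has weight `-y_j`, the same product summed
over super fillings evaluates `f[X - Y]` (`exists_letterSum_eq_aeval`): as polynomials in the `y_j`
with `j` largest, both sides simplify in the same way whenever `y_j` equals some `x_i`, and there
are enough such values. Then `x_i` becomes `t x_i` and `y_i` becomes `x_i`.

Cancellation. Reversing the sign of one well-chosen entry pairs off the super fillings that are not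
compatible (`killCompl_aeval_macdonaldH`).

Cumulants. `inv` equals the number of inversion pairs (`inv_eq_card_invPairs`), and unlike arms
these survive restriction to a set of columns. So `λ^B` contributes, for each super filling `σ` of
`λ^{[r]}`, the number `q` to the power of the number of edges of `G^σ` inside `B`, times factors
attached to single boxes. Products over the blocks of a set partition reassemble into sums over `σ`,
and the cumulant of `q^(edges in B)` is `(q - 1)^(r - 1)` times the inversion polynomial
(`cumulant_pow_edgesIn`), since both obey the recursion that removes the root of a tree and singles
out one component. -/

noncomputable section
namespace MacCumu
open scoped Classical

/-! ### Symmetry of two-letter sums with window weights -/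

section TwoLetters

variable {ι R : Type*} [CommRing R]

/-- The weight of a pair `(u, v)`: `q` if `v` comes after `u` at distance less than `n`, `d u` if it
comes at distance exactly `n`, and `1` otherwise. -/
def windowWeight (pos : ι → ℤ) (n : ℤ) (q : R) (d : ι → R) (u v : ι) : R :=
  if 0 < pos v - pos u ∧ pos v - pos u < n then q else if pos v - pos u = n then d u else 1

/-- The weighted sum of the maps from `A` to a two-letter alphabet, `S` being the set on which the
larger letter is taken. -/
def twoLetterSum (c : ι → ι → R) (A : Finset ι) (a b : R) : R :=
  ∑ S ∈ A.powerset, (∏ u ∈ S, ∏ v ∈ A \ S, c u v) * a ^ (A \ S).card * b ^ S.card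

theorem twoLetterSum_congr {c c' : ι → ι → R} {A : Finset ι}
    (h : ∀ u ∈ A, ∀ v ∈ A, u ≠ v → c u v = c' u v) (a b : R) :
    twoLetterSum c A a b = twoLetterSum c' A a b := by
  refine Finset.sum_congr rfl fun S hS => ?_
  rw [Finset.mem_powerset] at hS
  congr 2
  refine Finset.prod_congr rfl fun u hu => Finset.prod_congr rfl fun v hv => ?_
  rw [Finset.mem_sdiff] at hv
  exact h u (hS hu) v hv.1 (by rintro rfl; exact hv.2 hu)

theorem twoLetterSum_one_comm (A : Finset ι) (a b : R) :
    twoLetterSum (fun _ _ => 1) A a b = twoLetterSum (fun _ _ => 1) A b a := by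
  have h : ∀ a b : R, twoLetterSum (fun _ _ => 1) A a b = (b + a) ^ A.card := by
    intro a b
    rw [twoLetterSum, ← Finset.prod_const, Finset.prod_add]
    refine Finset.sum_congr rfl fun S _ => ?_
    simp [mul_comm]
  rw [h, h, add_comm]

/-- Only the subsets with `u` inside and `v` outside feel the change of weight. For these a third
element `w` contributes `c u w` if it lies outside and `c w v` if it lies inside; as the two agree,
the pair factors out and leaves the two-letter sum of `A`. The difference is therefore symmetric in
`a` and `b` once the sum over the smaller set is. -/
theorem twoLetterSum_insert_insert_sub {c c' : ι → ι → R} {A : Finset ι} {u v : ι} (huv : u ≠ v)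
    (hu : u ∉ A) (hv : v ∉ A) (hcc : ∀ x y, ¬ (x = u ∧ y = v) → c x y = c' x y)
    (hc : ∀ w ∈ A, c u w = c w v) (a b : R) :
    twoLetterSum c (insert u (insert v A)) a b - twoLetterSum c' (insert u (insert v A)) a b =
      (c u v - c' u v) * (∏ w ∈ A, c u w) * (a * b * twoLetterSum c A a b) := by
  have hu' : u ∉ insert v A := by simp [huv, hu]
  have key : ∀ S ∈ (insert u (insert v A)).powerset, ¬ (u ∈ S ∧ v ∉ S) →
      ∏ x ∈ S, ∏ y ∈ insert u (insert v A) \ S, c x y =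
        ∏ x ∈ S, ∏ y ∈ insert u (insert v A) \ S, c' x y := by
    intro S _ h
    refine Finset.prod_congr rfl fun x hx => Finset.prod_congr rfl fun y hy => hcc x y ?_
    rintro ⟨rfl, rfl⟩
    exact h ⟨hx, (Finset.mem_sdiff.mp hy).2⟩
  unfold twoLetterSum
  rw [← Finset.sum_sub_distrib, Finset.sum_powerset_insert hu', Finset.sum_powerset_insert hv,
    Finset.sum_powerset_insert hv, Finset.mul_sum, Finset.mul_sum]
  have h0 : ∀ S ∈ A.powerset, u ∉ S ∧ v ∉ S := fun S hS =>
    ⟨fun h => hu (Finset.mem_powerset.mp hS h), fun h => hv (Finset.mem_powerset.mp hS h)⟩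
  have hz : ∀ S : Finset ι, S ⊆ insert u (insert v A) → ¬ (u ∈ S ∧ v ∉ S) →
      (∏ x ∈ S, ∏ y ∈ insert u (insert v A) \ S, c x y) * a ^ (insert u (insert v A) \ S).card *
          b ^ S.card -
        (∏ x ∈ S, ∏ y ∈ insert u (insert v A) \ S, c' x y) *
          a ^ (insert u (insert v A) \ S).card * b ^ S.card = 0 := by
    intro S hS h
    rw [key S (Finset.mem_powerset.mpr hS) h, sub_self]
  -- Of the four sums according to which of `u`, `v` lie in the subset, only the one with `u` inside
  -- and `v` outside survives.
  rw [Finset.sum_eq_zero, Finset.sum_eq_zero, zero_add, zero_add, add_comm, Finset.sum_eq_zero,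
    zero_add]
  · refine Finset.sum_congr rfl fun S hS => ?_
    obtain ⟨huS, hvS⟩ := h0 S hS
    have hSA := Finset.mem_powerset.mp hS
    have e1 : insert u (insert v A) \ insert u S = insert v (A \ S) := by
      ext x; simp only [Finset.mem_sdiff, Finset.mem_insert]; grind
    have hv' : v ∉ A \ S := fun h => hv (Finset.mem_sdiff.mp h).1
    have hu'' : u ∉ A \ S := fun h => hu (Finset.mem_sdiff.mp h).1
    have exp : ∀ k : ι → ι → R, ∏ x ∈ insert u S, ∏ y ∈ insert v (A \ S), k x y =
        k u v * ((∏ y ∈ A \ S, k u y) * (∏ x ∈ S, k x v)) * ∏ x ∈ S, ∏ y ∈ A \ S, k x y := by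
      intro k
      rw [Finset.prod_insert huS, Finset.prod_insert hv']
      simp only [Finset.prod_insert hv', Finset.prod_mul_distrib]
      ring
    have e2 : (∏ y ∈ A \ S, c u y) * (∏ x ∈ S, c x v) = ∏ w ∈ A, c u w := by
      rw [← Finset.prod_sdiff hSA]
      congr 1
      exact Finset.prod_congr rfl fun x hx => (hc x (hSA hx)).symm
    have e3 : (∏ y ∈ A \ S, c' u y) * (∏ x ∈ S, c' x v) = ∏ w ∈ A, c u w := by
      rw [← e2]
      congr 1
      · refine Finset.prod_congr rfl fun x hx => (hcc _ _ ?_).symm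
        rintro ⟨-, rfl⟩; exact hv' hx
      · refine Finset.prod_congr rfl fun x hx => (hcc _ _ ?_).symm
        rintro ⟨rfl, -⟩; exact huS hx
    have e4 : ∏ x ∈ S, ∏ y ∈ A \ S, c' x y = ∏ x ∈ S, ∏ y ∈ A \ S, c x y := by
      refine Finset.prod_congr rfl fun x hx => Finset.prod_congr rfl fun y _ => (hcc _ _ ?_).symm
      rintro ⟨rfl, -⟩; exact huS hx
    rw [e1, exp, exp, e2, e3, e4, Finset.card_insert_of_notMem huS, Finset.card_insert_of_notMem hv']
    ring
  · intro S hS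
    apply hz
    · exact Finset.insert_subset_insert _ (Finset.insert_subset_insert _ (Finset.mem_powerset.mp hS))
    · simp
  · intro S hS
    apply hz
    · exact (Finset.insert_subset_insert _ (Finset.mem_powerset.mp hS)).trans
        (Finset.subset_insert _ _)
    · rintro ⟨h, -⟩
      rcases Finset.mem_insert.mp h with h | h
      exacts [huv h, (h0 S hS).1 h]
  · intro S hS
    apply hz
    · exact (Finset.mem_powerset.mp hS).trans
        ((Finset.subset_insert _ _).trans (Finset.subset_insert _ _))
    · exact fun h => (h0 S hS).1 h.1

/-- If the weights at distance `n` are all `1`, symmetry passes to arbitrary weights there. -/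
theorem twoLetterSum_windowWeight_comm_aux {pos : ι → ℤ} (hpos : Function.Injective pos) {n : ℤ}
    (q : R) (h1 : ∀ (A : Finset ι) (a b : R), twoLetterSum (windowWeight pos n q fun _ => 1) A a b =
      twoLetterSum (windowWeight pos n q fun _ => 1) A b a) (hn : 0 < n) :
    ∀ (N : ℕ) (A : Finset ι), A.card = N → ∀ (d : ι → R) (a b : R),
      twoLetterSum (windowWeight pos n q d) A a b = twoLetterSum (windowWeight pos n q d) A b a := by
  intro N
  induction N using Nat.strong_induction_on with
  | _ N ih =>
  rintro A rfl
  -- `E` contains the elements whose weight at distance `n` is allowed to differ from `1`; they are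
  -- released one at a time.
  suffices H : ∀ (E : Finset ι) (d : ι → R), (∀ u ∈ A, u ∉ E → d u = 1) → ∀ a b : R,
      twoLetterSum (windowWeight pos n q d) A a b = twoLetterSum (windowWeight pos n q d) A b a from
    fun d => H A d fun u hu hu' => absurd hu hu'
  intro E
  induction E using Finset.induction_on with
  | empty =>
    intro d hd a b
    have : ∀ a b : R, twoLetterSum (windowWeight pos n q d) A a b =
        twoLetterSum (windowWeight pos n q fun _ => 1) A a b := fun a b =>
      twoLetterSum_congr (fun u hu v _ _ => by
        rw [windowWeight, windowWeight, hd u hu (Finset.notMem_empty _)]) a b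
    rw [this, this, h1]
  | insert u E hu ihE =>
    intro d hd a b
    have h2 := ihE (Function.update d u 1) fun w hw hwE => by
      by_cases hwu : w = u
      · subst hwu; simp
      · rw [Function.update_of_ne hwu]; exact hd w hw (by simp [hwu, hwE])
    by_cases hv : u ∈ A ∧ ∃ v ∈ A, pos v - pos u = n
    · obtain ⟨huA, v, hvA, hv⟩ := hv
      have huv : u ≠ v := by rintro rfl; omega
      set A' := (A.erase u).erase v
      have hA : A = insert u (insert v A') := by
        rw [Finset.insert_erase, Finset.insert_erase huA]
        exact Finset.mem_erase.mpr ⟨huv.symm, hvA⟩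
      have key := fun a b : R => twoLetterSum_insert_insert_sub (c := windowWeight pos n q d)
        (c' := windowWeight pos n q (Function.update d u 1)) (A := A') huv (by simp [A'])
        (by simp [A']) (by
          intro x y hxy
          unfold windowWeight
          split_ifs with h3 h4
          · rfl
          · rw [Function.update_of_ne]
            rintro rfl
            exact hxy ⟨rfl, hpos (by omega)⟩
          · rfl) (by
          intro w hw
          -- Since `pos v = pos u + n`, the element `w` lies in the window after `u` exactly when
          -- `v` lies in the window after `w`.
          have hwu : w ≠ u := by rintro rfl; simp [A'] at hw
          have hwv : w ≠ v := by rintro rfl; simp [A'] at hw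
          have e1 : pos w ≠ pos u := fun h => hwu (hpos h)
          have e2 : pos w ≠ pos v := fun h => hwv (hpos h)
          unfold windowWeight
          rw [if_neg (c := pos w - pos u = n) (by omega), if_neg (c := pos v - pos w = n) (by omega)]
          refine if_congr ?_ rfl rfl
          omega) a b
      rw [← hA] at key
      have hlt : A'.card < A.card :=
        (Finset.card_le_card (Finset.erase_subset _ _)).trans_lt (Finset.card_erase_lt_of_mem huA)
      have k1 := key a b
      have k2 := key b a
      rw [ih _ hlt A' rfl d a b, h2 a b, mul_comm a b] at k1
      rw [← k2] at k1
      exact sub_left_inj.mp k1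
    · have : ∀ a b : R, twoLetterSum (windowWeight pos n q d) A a b =
          twoLetterSum (windowWeight pos n q (Function.update d u 1)) A a b := fun a b =>
        twoLetterSum_congr (fun x hx y hy _ => by
          unfold windowWeight
          split_ifs with h3 h4
          · rfl
          · rw [Function.update_of_ne]
            rintro rfl
            exact hv ⟨hx, y, hy, h4⟩
          · rfl) a b
      rw [this, this, h2]

/-- Weight `1` at the end of a window of width `n + 2` amounts to weight `q` at the end of a window
of width `n + 1`, so the auxiliary lemma climbs from one width to the next. At width `1` with
trivial end weight all weights are `1` and the sum is a power of `a + b`. -/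
theorem twoLetterSum_windowWeight_comm {pos : ι → ℤ} (hpos : Function.Injective pos) (q : R)
    (n : ℕ) : ∀ (d : ι → R) (A : Finset ι) (a b : R),
      twoLetterSum (windowWeight pos (n + 1) q d) A a b =
        twoLetterSum (windowWeight pos (n + 1) q d) A b a := by
  induction n with
  | zero =>
    intro d A
    refine twoLetterSum_windowWeight_comm_aux hpos q ?_ (by norm_num) _ A rfl d
    intro A a b
    have : windowWeight pos ((0 : ℕ) + 1) q (fun _ => 1) = fun _ _ => 1 := by
      funext u v
      unfold windowWeight
      rw [if_neg (by omega), ite_self]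
    rw [this, twoLetterSum_one_comm]
  | succ n ih =>
    intro d A
    refine twoLetterSum_windowWeight_comm_aux hpos q ?_ (by omega) _ A rfl d
    have : windowWeight pos ((n + 1 : ℕ) + 1) q (fun _ => 1) =
        windowWeight pos (n + 1) q fun _ => q := by
      funext u v
      unfold windowWeight
      push_cast
      split_ifs <;> first | rfl | omega
    rw [this]
    exact ih _

end TwoLetters

/-! ### Generating functions of maps into an ordered alphabet -/

section LetterSum

variable {ι S R : Type*} [Fintype ι] [LinearOrder S] [CommRing R]

/-- The product of the weights `c u v` of the pairs with `σ v ≤₋ σ u`. -/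
def inversionWeight (neg : S → Prop) (c : ι → ι → R) (σ : ι → S) : R :=
  ∏ u, ∏ v, if LeNeg neg (σ v) (σ u) then c u v else 1

/-- The generating function of the maps with values in `T`, where the letter `s` has weight `z s`. -/
def letterSum (neg : S → Prop) (c : ι → ι → R) (T : Finset S) (z : S → R) : R :=
  ∑ σ ∈ Fintype.piFinset fun _ : ι => T, inversionWeight neg c σ * ∏ u, z (σ u)

/-- The part of `letterSum` in which the letters `a` and `b` are distributed over `A`. -/
def pairSum (neg : S → Prop) (c : ι → ι → R) (a b : S) (A : Finset ι) (x y : R) : R :=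
  ∑ B ∈ A.powerset, (∏ u ∈ A, ∏ v ∈ A,
    if LeNeg neg (if v ∈ B then b else a) (if u ∈ B then b else a) then c u v else 1) *
      x ^ (A \ B).card * y ^ B.card

/-- The maps are grouped by the map `τ` obtained on replacing `b` by `a`. No other letter of `T`
lies between `a` and `b`, so both compare in the same way with all the others; how they are
distributed matters only for pairs of positions that both carry `a` or `b`. -/
theorem letterSum_eq_sum_pairSum {neg : S → Prop} {c : ι → ι → R} {T : Finset S} {a b : S}
    (ha : a ∈ T) (hb : b ∈ T) (hab : a ≠ b)
    (hadj : ∀ s ∈ T, s ≠ a → s ≠ b → (s < a ∧ s < b) ∨ (a < s ∧ b < s)) (z : S → R) :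
    letterSum neg c T z = ∑ τ ∈ Fintype.piFinset fun _ : ι => T.erase b,
      (∏ u, ∏ v, if ¬ (τ u = a ∧ τ v = a) ∧ LeNeg neg (τ v) (τ u) then c u v else 1) *
        (∏ u ∈ Finset.univ.filter fun u => τ u ≠ a, z (τ u)) *
        pairSum neg c a b (Finset.univ.filter fun u => τ u = a) (z a) (z b) := by
  have hmaps : ∀ σ ∈ Fintype.piFinset fun _ : ι => T,
      (fun u => if σ u = b then a else σ u) ∈ Fintype.piFinset fun _ : ι => T.erase b := by
    intro σ hσ
    rw [Fintype.mem_piFinset] at hσ ⊢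
    intro u
    by_cases h : σ u = b
    · simp [h, hab, ha]
    · simp [h, hσ u]
  rw [letterSum, ← Finset.sum_fiberwise_of_maps_to hmaps]
  refine Finset.sum_congr rfl fun τ hτ => ?_
  rw [Fintype.mem_piFinset] at hτ
  have hτb : ∀ u, τ u ≠ b := fun u => (Finset.mem_erase.mp (hτ u)).1
  set A := Finset.univ.filter fun u => τ u = a with hA
  have memA : ∀ u, u ∈ A ↔ τ u = a := fun u => by simp [hA]
  rw [pairSum, Finset.mul_sum]
  refine Finset.sum_bij' (fun σ _ => Finset.univ.filter fun u => σ u = b)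
    (fun B _ => fun u => if u ∈ B then b else τ u) ?_ ?_ ?_ ?_ ?_
  · intro σ hσ
    rw [Finset.mem_filter] at hσ
    rw [Finset.mem_powerset]
    intro u hu
    rw [memA, ← hσ.2]
    simp [(Finset.mem_filter.mp hu).2]
  · intro B hB
    rw [Finset.mem_powerset] at hB
    rw [Finset.mem_filter, Fintype.mem_piFinset]
    refine ⟨fun u => ?_, ?_⟩
    · by_cases h : u ∈ B
      · simp [h, hb]
      · simpa [h] using (Finset.mem_erase.mp (hτ u)).2
    · funext u
      by_cases h : u ∈ B
      · simp [h, (memA u).mp (hB h)]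
      · simp [h, hτb u]
  · intro σ hσ
    rw [Finset.mem_filter] at hσ
    funext u
    rw [← hσ.2]
    by_cases h : σ u = b <;> simp [h]
  · intro B hB
    ext u
    by_cases h : u ∈ B <;> simp [h, hτb u]
  · intro σ hσ
    rw [Finset.mem_filter, Fintype.mem_piFinset] at hσ
    obtain ⟨hσT, hστ⟩ := hσ
    set B := Finset.univ.filter fun u => σ u = b with hB
    have hσB : ∀ u, σ u = if u ∈ B then b else τ u := by
      intro u
      rw [← hστ]
      by_cases h : σ u = b <;> simp [hB, h]
    have hBA : B ⊆ A := by
      intro u hu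
      rw [memA, ← hστ]
      simp [(Finset.mem_filter.mp hu).2]
    have e1 : ∏ u, z (σ u) =
        (∏ u ∈ Finset.univ.filter fun u => τ u ≠ a, z (τ u)) *
          (z a ^ (A \ B).card * z b ^ B.card) := by
      rw [← Finset.prod_filter_mul_prod_filter_not Finset.univ fun u => τ u = a, mul_comm]
      congr 1
      · refine Finset.prod_congr rfl fun u hu => ?_
        rw [hσB, if_neg]
        intro h
        exact (Finset.mem_filter.mp hu).2 ((memA u).mp (hBA h))
      · rw [← Finset.prod_sdiff hBA]
        congr 1
        · rw [← Finset.prod_const]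
          refine Finset.prod_congr rfl fun u hu => ?_
          rw [Finset.mem_sdiff, memA] at hu
          rw [hσB, if_neg hu.2, hu.1]
        · rw [← Finset.prod_const]
          refine Finset.prod_congr rfl fun u hu => ?_
          rw [hσB, if_pos hu]
    have e2 : inversionWeight neg c σ =
        (∏ u, ∏ v, if ¬ (τ u = a ∧ τ v = a) ∧ LeNeg neg (τ v) (τ u) then c u v else 1) *
        ∏ u ∈ A, ∏ v ∈ A,
          if LeNeg neg (if v ∈ B then b else a) (if u ∈ B then b else a) then c u v else 1 := by
      have e3 : (∏ u ∈ A, ∏ v ∈ A,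
          if LeNeg neg (if v ∈ B then b else a) (if u ∈ B then b else a) then c u v else 1) =
          ∏ u, ∏ v, if (τ u = a ∧ τ v = a) ∧ LeNeg neg (σ v) (σ u) then c u v else 1 := by
        rw [hA, Finset.prod_filter]
        refine Finset.prod_congr rfl fun u _ => ?_
        by_cases hu : τ u = a
        · rw [if_pos hu, Finset.prod_filter]
          refine Finset.prod_congr rfl fun v _ => ?_
          by_cases hv : τ v = a
          · rw [if_pos hv, hσB u, hσB v, hu, hv]
            simp
          · simp [hv]
        · simp [hu]
      rw [e3, inversionWeight, ← Finset.prod_mul_distrib]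
      refine Finset.prod_congr rfl fun u _ => ?_
      rw [← Finset.prod_mul_distrib]
      refine Finset.prod_congr rfl fun v _ => ?_
      by_cases h : τ u = a ∧ τ v = a
      · simp [h]
      · have : LeNeg neg (σ v) (σ u) ↔ LeNeg neg (τ v) (τ u) := by
          rw [hσB u, hσB v]
          by_cases hu : τ u = a
          · have hv : τ v ≠ a := fun hv => h ⟨hu, hv⟩
            rw [if_neg (c := v ∈ B) (fun h => hv ((memA v).mp (hBA h))), hu]
            by_cases hu2 : u ∈ B
            · rw [if_pos hu2]
              have := hadj (τ v) (Finset.mem_of_mem_erase (hτ v)) hv (hτb v)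
              have h3 := hτb v
              unfold LeNeg
              rcases this with ⟨h1, h2⟩ | ⟨h1, h2⟩
              · simp [h1, h2]
              · simp [h1.not_gt, h2.not_gt, hv, h3]
            · rw [if_neg hu2]
          · rw [if_neg (c := u ∈ B) (fun h => hu ((memA u).mp (hBA h)))]
            by_cases hv : v ∈ B
            · rw [if_pos hv, (memA v).mp (hBA hv)]
              have := hadj (τ u) (Finset.mem_of_mem_erase (hτ u)) hu (hτb u)
              have h3 := hτb u
              unfold LeNeg
              rcases this with ⟨h1, h2⟩ | ⟨h1, h2⟩
              · simp [h1.not_gt, h2.not_gt, Ne.symm hu, Ne.symm h3]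
              · simp [h1, h2]
            · rw [if_neg hv]
        simp [h, this]
    rw [e1, e2]
    ring

theorem letterSum_congr_pair {neg : S → Prop} {c : ι → ι → R} {T : Finset S} {a b : S}
    (ha : a ∈ T) (hb : b ∈ T) (hab : a ≠ b)
    (hadj : ∀ s ∈ T, s ≠ a → s ≠ b → (s < a ∧ s < b) ∨ (a < s ∧ b < s)) {z z' : S → R}
    (hz : ∀ s ∈ T, s ≠ a → s ≠ b → z s = z' s)
    (h : ∀ A : Finset ι, pairSum neg c a b A (z a) (z b) = pairSum neg c a b A (z' a) (z' b)) :
    letterSum neg c T z = letterSum neg c T z' := by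
  rw [letterSum_eq_sum_pairSum ha hb hab hadj, letterSum_eq_sum_pairSum ha hb hab hadj]
  refine Finset.sum_congr rfl fun τ hτ => ?_
  rw [Fintype.mem_piFinset] at hτ
  rw [h]
  congr 2
  refine Finset.prod_congr rfl fun u hu => ?_
  exact hz _ (Finset.mem_of_mem_erase (hτ u)) (Finset.mem_filter.mp hu).2
    (Finset.mem_erase.mp (hτ u)).1

theorem pairSum_of_pos {neg : S → Prop} {c : ι → ι → R} {a b : S} (hab : a < b) (ha : ¬ neg a)
    (hb : ¬ neg b) (A : Finset ι) (x y : R) :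
    pairSum neg c a b A x y = twoLetterSum c A x y := by
  refine Finset.sum_congr rfl fun B hB => ?_
  rw [Finset.mem_powerset] at hB
  congr 2
  rw [← Finset.prod_sdiff hB]
  rw [Finset.prod_eq_one, one_mul]
  · refine Finset.prod_congr rfl fun u hu => ?_
    rw [← Finset.prod_sdiff hB, mul_comm, Finset.prod_eq_one, one_mul]
    · refine Finset.prod_congr rfl fun v hv => ?_
      simp [hu, (Finset.mem_sdiff.mp hv).2, LeNeg, hab]
    · intro v hv
      simp [hu, hv, LeNeg, hb]
  · intro u hu
    refine Finset.prod_eq_one fun v hv => ?_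
    by_cases h : v ∈ B <;> simp [(Finset.mem_sdiff.mp hu).2, h, LeNeg, hab.not_gt, ha, hab.ne']

/-- A position that carries the negative letter `b` is inverted with every position of `A`, whether
that one carries `a` or `b`; a position that carries `a` is inverted with none. The choices at the
positions are thus independent and the sum factors. -/
theorem pairSum_pos_neg {neg : S → Prop} {c : ι → ι → R} {a b : S} (hab : a < b) (ha : ¬ neg a)
    (hb : neg b) (A : Finset ι) (x y : R) :
    pairSum neg c a b A x y = ∏ u ∈ A, ((∏ v ∈ A, c u v) * y + x) := by
  rw [Finset.prod_add]
  refine Finset.sum_congr rfl fun B hB => ?_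
  rw [Finset.mem_powerset] at hB
  rw [Finset.prod_mul_distrib, Finset.prod_const, Finset.prod_const,
    mul_right_comm _ (x ^ _)]
  congr 2
  rw [← Finset.prod_sdiff hB, Finset.prod_eq_one, one_mul]
  · refine Finset.prod_congr rfl fun u hu => Finset.prod_congr rfl fun v _ => ?_
    by_cases h : v ∈ B <;> simp [hu, h, LeNeg, hab, hb]
  · intro u hu
    refine Finset.prod_eq_one fun v _ => ?_
    by_cases h : v ∈ B <;> simp [(Finset.mem_sdiff.mp hu).2, h, LeNeg, hab.not_gt, ha, hab.ne']

theorem letterSum_congr {neg : S → Prop} {c : ι → ι → R} {T : Finset S} {z z' : S → R}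
    (h : ∀ s ∈ T, z s = z' s) : letterSum neg c T z = letterSum neg c T z' := by
  refine Finset.sum_congr rfl fun σ hσ => ?_
  rw [Fintype.mem_piFinset] at hσ
  rw [Finset.prod_congr rfl fun u _ => h _ (hσ u)]

/-- Letters of weight `0` may be dropped. -/
theorem letterSum_eq_of_subset {neg : S → Prop} {c : ι → ι → R} {T' T : Finset S} (hT : T' ⊆ T)
    {z : S → R} (h : ∀ s ∈ T, s ∉ T' → z s = 0) :
    letterSum neg c T z = letterSum neg c T' z := by
  symm
  refine Finset.sum_subset (Fintype.piFinset_subset _ _ fun _ => hT) fun σ hσ hσ' => ?_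
  rw [Fintype.mem_piFinset] at hσ hσ'
  push Not at hσ'
  obtain ⟨u, hu⟩ := hσ'
  rw [Finset.prod_eq_zero (Finset.mem_univ u) (h _ (hσ u) hu), mul_zero]

/-- Adjacent letters, one positive and one negative, of opposite weights cancel. -/
theorem letterSum_cancel {neg : S → Prop} {c : ι → ι → R} {pos : ι → ℤ}
    (hc : ∀ u v, pos v ≤ pos u → c u v = 1) {T : Finset S}
    {a b : S} (ha : a ∈ T) (hb : b ∈ T) (hab : a < b) (hna : ¬ neg a) (hnb : neg b)
    (hadj : ∀ s ∈ T, s ≠ a → s ≠ b → (s < a ∧ s < b) ∨ (a < s ∧ b < s)) {z : S → R}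
    (hz : z b = - z a) :
    letterSum neg c T z = letterSum neg c ((T.erase a).erase b) z := by
  have h1 : letterSum neg c T z = letterSum neg c T (fun s => if s = a ∨ s = b then 0 else z s) := by
    refine letterSum_congr_pair ha hb hab.ne hadj (fun s _ h1 h2 => by simp [h1, h2]) fun A => ?_
    rw [pairSum_pos_neg hab hna hnb, pairSum_pos_neg hab hna hnb]
    rcases A.eq_empty_or_nonempty with rfl | hA
    · simp
    -- At the last position of `A` all weights `c u v` are `1`, so its factor is `z b + z a = 0`.
    · obtain ⟨u, hu, hmax⟩ := A.exists_max_image pos hA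
      rw [Finset.prod_eq_zero hu, Finset.prod_eq_zero hu]
      · simp
      · rw [Finset.prod_eq_one fun v hv => hc u v (hmax v hv), hz]
        ring
  rw [h1, letterSum_eq_of_subset (T' := (T.erase a).erase b)]
  · refine letterSum_congr fun s hs => ?_
    simp only [Finset.mem_erase] at hs
    simp [hs.1, hs.2.1]
  · exact (Finset.erase_subset _ _).trans (Finset.erase_subset _ _)
  · intro s hs hs'
    simp only [Finset.mem_erase, not_and] at hs'
    by_cases h1 : s = b
    · simp [h1]
    · by_cases h2 : s = a
      · simp [h2]
      · exact absurd hs (hs' h1 h2)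

/-- Symmetry in the weights of the positive letters. -/
theorem letterSum_swap {neg : S → Prop} {c : ι → ι → R}
    (hc : ∀ (A : Finset ι) (a b : R), twoLetterSum c A a b = twoLetterSum c A b a) {T : Finset S} :
    ∀ (N : ℕ) (a b : S), a < b → (T.filter fun s => a < s ∧ s < b).card = N → a ∈ T → b ∈ T →
      (∀ s ∈ T, a ≤ s → s ≤ b → ¬ neg s) → ∀ z : S → R,
      letterSum neg c T (z ∘ Equiv.swap a b) = letterSum neg c T z := by
  intro N
  induction N using Nat.strong_induction_on with
  | _ N ih =>
  intro a b hab hN ha hb hneg z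
  by_cases h : ∃ s ∈ T, a < s ∧ s < b
  · obtain ⟨s, hs, has, hsb⟩ := h
    have e1 : (T.filter fun x => a < x ∧ x < s).card < N := by
      rw [← hN]
      refine Finset.card_lt_card (Finset.ssubset_iff_of_subset ?_ |>.mpr ⟨s, ?_, ?_⟩)
      · intro x hx
        rw [Finset.mem_filter] at hx ⊢
        exact ⟨hx.1, hx.2.1, hx.2.2.trans hsb⟩
      · simp [hs, has, hsb]
      · simp
    have e2 : (T.filter fun x => s < x ∧ x < b).card < N := by
      rw [← hN]
      refine Finset.card_lt_card (Finset.ssubset_iff_of_subset ?_ |>.mpr ⟨s, ?_, ?_⟩)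
      · intro x hx
        rw [Finset.mem_filter] at hx ⊢
        exact ⟨hx.1, has.trans hx.2.1, hx.2.2⟩
      · simp [hs, has, hsb]
      · simp
    have h1 := ih _ e1 a s has rfl ha hs fun x hx h1 h2 => hneg x hx h1 (h2.trans hsb.le)
    have h2 := ih _ e2 s b hsb rfl hs hb fun x hx h1 h2 => hneg x hx (has.le.trans h1) h2
    -- The transposition of `a` and `b` is that of `s` and `b` conjugated by that of `a` and `s`,
    -- and both of these have fewer letters in between.
    have e3 : z ∘ Equiv.swap a b = ((z ∘ Equiv.swap a s) ∘ Equiv.swap s b) ∘ Equiv.swap a s := by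
      have := Equiv.swap_mul_swap_mul_swap (x := b) (y := s) (z := a) hsb.ne' hab.ne'
      rw [Equiv.swap_comm b s, Equiv.swap_comm s a] at this
      rw [← this]
      rfl
    rw [e3, h1, h2, h1]
  · push Not at h
    have hadj : ∀ s ∈ T, s ≠ a → s ≠ b → (s < a ∧ s < b) ∨ (a < s ∧ b < s) := by
      intro s hs hsa hsb
      rcases lt_or_gt_of_ne hsa with h1 | h1
      · exact Or.inl ⟨h1, h1.trans hab⟩
      · exact Or.inr ⟨h1, lt_of_le_of_ne (h s hs h1) hsb.symm⟩
    refine letterSum_congr_pair ha hb hab.ne hadj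
      (fun s _ h1 h2 => by simp [Equiv.swap_apply_of_ne_of_ne h1 h2]) fun A => ?_
    rw [pairSum_of_pos hab (hneg a ha le_rfl hab.le) (hneg b hb hab.le le_rfl),
      pairSum_of_pos hab (hneg a ha le_rfl hab.le) (hneg b hb hab.le le_rfl)]
    simp [hc A (z b)]

theorem letterSum_map {R' : Type*} [CommRing R'] (f : R →+* R') (neg : S → Prop) (c : ι → ι → R)
    (T : Finset S) (z : S → R) :
    f (letterSum neg c T z) = letterSum neg (fun u v => f (c u v)) T (fun s => f (z s)) := by
  simp only [letterSum, inversionWeight, map_sum, map_mul, map_prod]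
  refine Finset.sum_congr rfl fun σ _ => ?_
  congr 1
  refine Finset.prod_congr rfl fun u _ => Finset.prod_congr rfl fun v _ => ?_
  split_ifs <;> simp

end LetterSum

/-! ### Joint cumulants and their recursions -/

section Cumulants

variable {V A : Type*} [CommRing A]

/-- The joint cumulant of the elements of `S`. -/
def cumulantOn (u : Finset V → A) (S : Finset V) : A :=
  ∑ π : Finpartition S,
    (-1) ^ (π.parts.card - 1) * (Nat.factorial (π.parts.card - 1) : A) * ∏ B ∈ π.parts, u B

/-- `P` is the set of blocks of a set partition of `S`. -/
def IsPartition (P : Finset (Finset V)) (S : Finset V) : Prop :=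
  (∀ B ∈ P, B.Nonempty) ∧ (∀ B ∈ P, ∀ C ∈ P, B ≠ C → Disjoint B C) ∧ P.biUnion id = S

theorem Finpartition.isPartition {S : Finset V} (π : Finpartition S) : IsPartition π.parts S := by
  refine ⟨fun B hB => π.nonempty_of_mem_parts hB, fun B hB C hC h => π.disjoint hB hC h,
    π.biUnion_parts⟩

theorem IsPartition.exists_finpartition {P : Finset (Finset V)} {S : Finset V}
    (h : IsPartition P S) : ∃ π : Finpartition S, π.parts = P := by
  refine ⟨⟨P, ?_, ?_, ?_⟩, rfl⟩
  · rw [Finset.supIndep_iff_pairwiseDisjoint]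
    intro B hB C hC hBC
    exact h.2.1 B hB C hC hBC
  · rw [Finset.sup_eq_biUnion]; exact h.2.2
  · intro h0
    exact Finset.not_nonempty_empty (h.1 _ h0)

/-- The set partitions of `S`, as sets of blocks. -/
def partitions (S : Finset V) : Finset (Finset (Finset V)) :=
  S.powerset.powerset.filter fun P => IsPartition P S

theorem mem_partitions {S : Finset V} {P : Finset (Finset V)} :
    P ∈ partitions S ↔ IsPartition P S := by
  rw [partitions, Finset.mem_filter, and_iff_right_iff_imp]
  intro h
  rw [Finset.mem_powerset]
  intro B hB
  rw [Finset.mem_powerset, ← h.2.2]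
  exact Finset.subset_biUnion_of_mem id hB

theorem sum_finpartition {S : Finset V} (f : Finset (Finset V) → A) :
    ∑ π : Finpartition S, f π.parts = ∑ P ∈ partitions S, f P := by
  refine Finset.sum_bij (fun π _ => π.parts) (fun π _ => mem_partitions.mpr (Finpartition.isPartition π))
    (fun π _ π' _ h => Finpartition.ext h) (fun P hP => ?_) fun _ _ => rfl
  obtain ⟨π, hπ⟩ := (mem_partitions.mp hP).exists_finpartition
  exact ⟨π, Finset.mem_univ _, hπ⟩

theorem IsPartition.insert {P : Finset (Finset V)} {B C : Finset V} (h : IsPartition P B)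
    (hC : C.Nonempty) (hBC : Disjoint B C) : C ∉ P ∧ IsPartition (insert C P) (B ∪ C) := by
  have hsub : ∀ D ∈ P, Disjoint D C := fun D hD =>
    hBC.mono_left (by rw [← h.2.2]; exact Finset.subset_biUnion_of_mem id hD)
  refine ⟨fun hCP => hC.ne_empty (disjoint_self.mp (hsub C hCP)), ?_, ?_, ?_⟩
  · intro D hD
    rcases Finset.mem_insert.mp hD with rfl | hD
    exacts [hC, h.1 D hD]
  · intro D hD E hE hDE
    rcases Finset.mem_insert.mp hD with hD' | hD' <;> rcases Finset.mem_insert.mp hE with hE' | hE'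
    · exact absurd (hD'.trans hE'.symm) hDE
    · rw [hD']; exact (hsub E hE').symm
    · rw [hE']; exact hsub D hD'
    · exact h.2.1 D hD' E hE' hDE
  · rw [Finset.biUnion_insert, h.2.2, Finset.union_comm]; rfl

theorem IsPartition.erase {P : Finset (Finset V)} {S C : Finset V} (h : IsPartition P S)
    (hC : C ∈ P) : C.Nonempty ∧ C ⊆ S ∧ IsPartition (P.erase C) (S \ C) := by
  refine ⟨h.1 C hC, by rw [← h.2.2]; exact Finset.subset_biUnion_of_mem id hC,
    fun B hB => h.1 B (Finset.mem_of_mem_erase hB), fun B hB D hD => h.2.1 B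
      (Finset.mem_of_mem_erase hB) D (Finset.mem_of_mem_erase hD), ?_⟩
  ext x
  rw [← h.2.2]
  simp only [Finset.mem_biUnion, Finset.mem_erase, Finset.mem_sdiff, id]
  constructor
  · rintro ⟨B, ⟨hBC, hB⟩, hx⟩
    exact ⟨⟨B, hB, hx⟩, fun hxC => Finset.disjoint_left.mp (h.2.1 B hB C hC hBC) hx hxC⟩
  · rintro ⟨⟨B, hB, hx⟩, hxC⟩
    exact ⟨B, ⟨by rintro rfl; exact hxC hx, hB⟩, hx⟩

theorem IsPartition.card_filter_notMem {P : Finset (Finset V)} {S : Finset V}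
    (h : IsPartition P S) {x : V} (hx : x ∈ S) : (P.filter fun C => x ∉ C).card = P.card - 1 := by
  rw [← h.2.2, Finset.mem_biUnion] at hx
  obtain ⟨B, hB, hxB⟩ := hx
  rw [← Finset.card_erase_of_mem hB]
  congr 1
  ext C
  rw [Finset.mem_filter, Finset.mem_erase]
  constructor
  · rintro ⟨hC, hxC⟩
    exact ⟨by rintro rfl; exact hxC hxB, hC⟩
  · rintro ⟨hCB, hC⟩
    exact ⟨hC, fun hxC => Finset.disjoint_left.mp (h.2.1 C hC B hB hCB) hxC hxB⟩

/-- The moment–cumulant recursion. -/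
theorem sum_cumulantOn_mul {u : Finset V → A} (hu : u ∅ = 1) {S : Finset V} {x : V} (hx : x ∈ S) :
    ∑ B ∈ S.powerset.filter (fun B => x ∈ B), cumulantOn u B * u (S \ B) = u S := by
  set μ : ℕ → A := fun k => (-1) ^ (k - 1) * (Nat.factorial (k - 1) : A) with hμ
  have hcum : ∀ B, cumulantOn u B = ∑ P ∈ partitions B, μ P.card * ∏ C ∈ P, u C := fun B =>
    sum_finpartition (fun P => μ P.card * ∏ C ∈ P, u C)
  have hmem : S ∈ S.powerset.filter fun B => x ∈ B := by simp [hx]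
  rw [← Finset.add_sum_erase _ _ hmem, Finset.sdiff_self, hu, mul_one]
  -- A proper subset `B` containing `x` with a partition of `B` is the same as a partition of `S`
  -- with a marked block `S \ B` avoiding `x`.
  have h1 : ∑ B ∈ (S.powerset.filter fun B => x ∈ B).erase S, cumulantOn u B * u (S \ B) =
      ∑ P ∈ partitions S, ∑ C ∈ P.filter fun C => x ∉ C, μ (P.card - 1) * ∏ C ∈ P, u C := by
    simp_rw [hcum, Finset.sum_mul]
    rw [Finset.sum_sigma', Finset.sum_sigma']
    refine Finset.sum_bij' (fun p _ => ⟨insert (S \ p.1) p.2, S \ p.1⟩)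
      (fun p _ => ⟨S \ p.2, p.1.erase p.2⟩) ?_ ?_ ?_ ?_ ?_
    · rintro ⟨B, P⟩ h
      simp only [Finset.mem_sigma, Finset.mem_erase, Finset.mem_filter, Finset.mem_powerset,
        mem_partitions] at h ⊢
      obtain ⟨⟨hBS, hB, hxB⟩, hP⟩ := h
      have hne : (S \ B).Nonempty := Finset.sdiff_nonempty.mpr fun h => hBS (hB.antisymm h)
      have := (hP.insert hne Finset.disjoint_sdiff).2
      rw [Finset.union_sdiff_of_subset hB] at this
      exact ⟨this, Finset.mem_insert_self _ _, by simp [hxB]⟩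
    · rintro ⟨P, C⟩ h
      simp only [Finset.mem_sigma, Finset.mem_erase, Finset.mem_filter, Finset.mem_powerset,
        mem_partitions] at h ⊢
      obtain ⟨hP, hC, hxC⟩ := h
      obtain ⟨hne, hCS, hP'⟩ := hP.erase hC
      refine ⟨⟨fun h => ?_, Finset.sdiff_subset, by simp [hx, hxC]⟩, hP'⟩
      obtain ⟨y, hy⟩ := hne
      have := hCS hy
      rw [← h] at this
      exact (Finset.mem_sdiff.mp this).2 hy
    · rintro ⟨B, P⟩ h
      simp only [Finset.mem_sigma, Finset.mem_erase, Finset.mem_filter, Finset.mem_powerset,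
        mem_partitions] at h
      obtain ⟨⟨hBS, hB, hxB⟩, hP⟩ := h
      have hne : (S \ B).Nonempty := Finset.sdiff_nonempty.mpr fun h => hBS (hB.antisymm h)
      have := (hP.insert hne Finset.disjoint_sdiff).1
      simp only [Finset.erase_insert this, Finset.sdiff_sdiff_eq_self hB]
    · rintro ⟨P, C⟩ h
      simp only [Finset.mem_sigma, Finset.mem_filter, mem_partitions] at h
      obtain ⟨hP, hC, hxC⟩ := h
      simp only [Finset.sdiff_sdiff_eq_self (hP.erase hC).2.1, Finset.insert_erase hC]
    · rintro ⟨B, P⟩ h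
      simp only [Finset.mem_sigma, Finset.mem_erase, Finset.mem_filter, Finset.mem_powerset,
        mem_partitions] at h
      obtain ⟨⟨hBS, hB, hxB⟩, hP⟩ := h
      have hne : (S \ B).Nonempty := Finset.sdiff_nonempty.mpr fun h => hBS (hB.antisymm h)
      have := (hP.insert hne Finset.disjoint_sdiff).1
      simp only [Finset.card_insert_of_notMem this, Finset.prod_insert this]
      simp only [Nat.add_sub_cancel]
      ring
  rw [h1, hcum, ← Finset.sum_add_distrib]
  -- A partition with `k + 2` blocks has `k + 1` blocks avoiding `x`, and `(-1)^(k+1) (k+1)! + (k+1)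
  -- (-1)^k k! = 0`; only the partition with a single block survives.
  have h2 : ∀ P ∈ partitions S, μ P.card * ∏ C ∈ P, u C +
      ∑ C ∈ P.filter (fun C => x ∉ C), μ (P.card - 1) * ∏ C ∈ P, u C =
      if P = {S} then u S else 0 := by
    intro P hP
    rw [mem_partitions] at hP
    rw [Finset.sum_const, hP.card_filter_notMem hx]
    split_ifs with h
    · subst h
      simp [hμ]
    · have hx' := hx
      rw [← hP.2.2, Finset.mem_biUnion] at hx'
      obtain ⟨B, hB, hxB⟩ := hx'
      have hcard : 2 ≤ P.card := by
        by_contra hlt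
        have h1 : P.card = 1 := by
          have := Finset.card_pos.mpr ⟨B, hB⟩
          omega
        obtain ⟨C, rfl⟩ := Finset.card_eq_one.mp h1
        apply h
        have := hP.2.2
        rw [Finset.singleton_biUnion] at this
        rw [← this]; rfl
      obtain ⟨k, hk⟩ := Nat.exists_eq_add_of_le' hcard
      rw [hk]
      simp only [hμ, nsmul_eq_mul]
      rw [show k + 2 - 1 - 1 = k from rfl, show k + 2 - 1 = k + 1 from rfl, Nat.factorial_succ]
      push_cast
      ring
  rw [Finset.sum_congr rfl h2, Finset.sum_ite_eq', if_pos]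
  rw [mem_partitions]
  refine ⟨?_, ?_, ?_⟩
  · intro B hB
    rw [Finset.mem_singleton.mp hB]; exact ⟨x, hx⟩
  · intro B hB C hC h
    rw [Finset.mem_singleton] at hB hC
    exact absurd (hB.trans hC.symm) h
  · rw [Finset.singleton_biUnion]; rfl

/-- The recursion of cumulants for moments that are products over the pairs of elements: remove `v`
and single out the part that contains `m`. -/
theorem cumulantOn_eq_sum {u : Finset V → A} (hu : u ∅ = 1) {g : V → A} {h : V → Finset V → A}
    (hh : ∀ v B C, Disjoint B C → h v (B ∪ C) = h v B * h v C)
    (huv : ∀ v S, v ∉ S → u (insert v S) = g v * h v S * u S) :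
    ∀ (N : ℕ) (S : Finset V), S.card = N → ∀ v ∈ S, ∀ m ∈ S, m ≠ v →
      cumulantOn u S = ∑ B ∈ S.powerset.filter (fun B => m ∈ B ∧ v ∉ B),
        (h v B - 1) * cumulantOn u B * cumulantOn u (S \ B) := by
  intro N
  induction N using Nat.strong_induction_on with
  | _ N ih =>
  rintro S rfl v hv m hm hmv
  set X : Finset V → A := fun C => ∑ B ∈ C.powerset.filter (fun B => m ∈ B ∧ v ∉ B),
        (h v B - 1) * cumulantOn u B * cumulantOn u (C \ B) with hX
  have hXeq : ∀ C ∈ S.powerset.filter (fun C => m ∈ C ∧ v ∈ C), C ≠ S → cumulantOn u C = X C := by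
    intro C hC hCS
    simp only [Finset.mem_filter, Finset.mem_powerset] at hC
    exact ih _ (Finset.card_lt_card (hC.1.ssubset_of_ne hCS)) C rfl v hC.2.2 m hC.2.1 hmv
  -- By induction `X C` is the cumulant of `C` for every proper subset `C` containing `m` and `v`.
  -- It therefore suffices to compare the two sums weighted by `u (S \ C)`, whose terms for `C ≠ S`
  -- agree.
  have key : ∑ C ∈ S.powerset.filter (fun C => m ∈ C ∧ v ∈ C), X C * u (S \ C) =
      ∑ C ∈ S.powerset.filter (fun C => m ∈ C ∧ v ∈ C), cumulantOn u C * u (S \ C) := by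
    have e1 : ∑ C ∈ S.powerset.filter (fun C => m ∈ C ∧ v ∈ C), X C * u (S \ C) =
        ∑ B ∈ S.powerset.filter (fun B => m ∈ B ∧ v ∉ B), (h v B - 1) * cumulantOn u B *
          ∑ D ∈ (S \ B).powerset.filter (fun D => v ∈ D), cumulantOn u D * u ((S \ B) \ D) := by
      simp_rw [hX, Finset.sum_mul, Finset.mul_sum]
      rw [Finset.sum_sigma', Finset.sum_sigma']
      refine Finset.sum_bij' (fun p _ => ⟨p.2, p.1 \ p.2⟩) (fun p _ => ⟨p.1 ∪ p.2, p.1⟩)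
        ?_ ?_ ?_ ?_ ?_
      · rintro ⟨C, B⟩ h
        simp only [Finset.mem_sigma, Finset.mem_filter, Finset.mem_powerset] at h ⊢
        obtain ⟨⟨hCS, hmC, hvC⟩, hBC, hmB, hvB⟩ := h
        exact ⟨⟨hBC.trans hCS, hmB, hvB⟩, Finset.sdiff_subset_sdiff hCS le_rfl, by simp [hvC, hvB]⟩
      · rintro ⟨B, D⟩ h
        simp only [Finset.mem_sigma, Finset.mem_filter, Finset.mem_powerset] at h ⊢
        obtain ⟨⟨hBS, hmB, hvB⟩, hD, hvD⟩ := h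
        exact ⟨⟨Finset.union_subset hBS (hD.trans Finset.sdiff_subset), by simp [hmB], by simp [hvD]⟩,
          Finset.subset_union_left, hmB, hvB⟩
      · rintro ⟨C, B⟩ h
        simp only [Finset.mem_sigma, Finset.mem_filter, Finset.mem_powerset] at h
        simp only [Finset.union_sdiff_of_subset h.2.1]
      · rintro ⟨B, D⟩ h
        simp only [Finset.mem_sigma, Finset.mem_filter, Finset.mem_powerset] at h
        have hd : Disjoint B D := (Finset.subset_sdiff.mp h.2.1).2.symm
        simp only [Finset.union_sdiff_cancel_left hd]
      · rintro ⟨C, B⟩ h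
        simp only [Finset.mem_sigma, Finset.mem_filter, Finset.mem_powerset] at h
        have : (S \ B) \ (C \ B) = S \ C := by
          have := h.2.1
          ext x
          simp only [Finset.mem_sdiff]
          have := @this x
          tauto
        simp only [this]
        ring
    -- The moment–cumulant recursion at `v` turns the inner sum into `u (S \ B)`; taking `v` out of
    -- `S \ B` produces `h v` of what remains, which completes `h v B` to `h v (S.erase v)`.
    have e2 : ∀ B ∈ S.powerset.filter (fun B => m ∈ B ∧ v ∉ B), (h v B - 1) * cumulantOn u B *
          ∑ D ∈ (S \ B).powerset.filter (fun D => v ∈ D), cumulantOn u D * u ((S \ B) \ D) =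
        g v * h v (S.erase v) * (cumulantOn u B * u (S.erase v \ B)) - cumulantOn u B * u (S \ B) := by
      intro B hB
      simp only [Finset.mem_filter, Finset.mem_powerset] at hB
      rw [sum_cumulantOn_mul hu (by simp [hv, hB.2.2])]
      have hBv : B ⊆ S.erase v := fun x hx => Finset.mem_erase.mpr
        ⟨by rintro rfl; exact hB.2.2 hx, hB.1 hx⟩
      have e3 : S \ B = insert v (S.erase v \ B) := by
        ext x
        simp only [Finset.mem_sdiff, Finset.mem_insert, Finset.mem_erase]
        by_cases hxv : x = v
        · subst hxv; simp [hv, hB.2.2]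
        · simp [hxv]
      have e4 : u (S \ B) = g v * h v (S.erase v \ B) * u (S.erase v \ B) := by
        rw [e3, huv _ _ (by simp)]
      have e5 : h v (S.erase v) = h v B * h v (S.erase v \ B) := by
        rw [← hh _ _ _ Finset.disjoint_sdiff, Finset.union_sdiff_of_subset hBv]
      rw [sub_mul, one_mul, sub_mul, e5, e4]
      ring
    have e6 : S.powerset.filter (fun B => m ∈ B ∧ v ∉ B) =
        (S.erase v).powerset.filter (fun B => m ∈ B) := by
      ext B
      simp only [Finset.mem_filter, Finset.mem_powerset, Finset.subset_erase]
      tauto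
    -- The first terms add up to `u S`, by the recursion for `S.erase v`. By the recursion for `S`,
    -- this is the sum over all subsets containing `m`; subtracting those without `v` leaves those
    -- with both.
    rw [e1, Finset.sum_congr rfl e2, Finset.sum_sub_distrib]
    conv_lhs => enter [1]; rw [e6]
    rw [← Finset.mul_sum, sum_cumulantOn_mul hu (by simp [hm, hmv]),
      ← huv _ _ (Finset.notMem_erase _ _), Finset.insert_erase hv, ← sum_cumulantOn_mul hu hm,
      sub_eq_iff_eq_add, ← Finset.sum_filter_add_sum_filter_not _ (fun B => v ∈ B),
      Finset.filter_filter, Finset.filter_filter]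
  have hmem : S ∈ S.powerset.filter (fun C => m ∈ C ∧ v ∈ C) := by simp [hm, hv]
  rw [← Finset.add_sum_erase _ _ hmem, ← Finset.add_sum_erase _ _ hmem, Finset.sdiff_self, hu,
    mul_one, mul_one] at key
  have : ∑ C ∈ (S.powerset.filter (fun C => m ∈ C ∧ v ∈ C)).erase S, X C * u (S \ C) =
      ∑ C ∈ (S.powerset.filter (fun C => m ∈ C ∧ v ∈ C)).erase S, cumulantOn u C * u (S \ C) :=
    Finset.sum_congr rfl fun C hC => by
      rw [hXeq C (Finset.mem_of_mem_erase hC) (Finset.ne_of_mem_erase hC)]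
  rw [this] at key
  exact (add_right_cancel key).symm

theorem cumulantOn_singleton (u : Finset V → A) (hu : u ∅ = 1) (v : V) :
    cumulantOn u {v} = u {v} := by
  rw [← sum_cumulantOn_mul hu (Finset.mem_singleton_self v)]
  have : ({v} : Finset V).powerset.filter (fun B => v ∈ B) = {{v}} := by
    ext B
    simp only [Finset.mem_filter, Finset.mem_powerset, Finset.mem_singleton,
      Finset.subset_singleton_iff]
    constructor
    · rintro ⟨rfl | rfl, h⟩
      · simp at h
      · rfl
    · rintro rfl; simp
  rw [this, Finset.sum_singleton, Finset.sdiff_self, hu, mul_one]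

end Cumulants

/-! ### Rooted trees and removal of the root -/

section Trees

variable {V : Type*}

/-- A walk cannot leave a set that is closed under adjacency. This is what moves walks and cycles
from a union of graphs to one of its sides. -/
theorem edges_subset_and_support_subset {H T : SimpleGraph V} {B : Set V}
    (h : ∀ a ∈ B, ∀ b, H.Adj a b → T.Adj a b ∧ b ∈ B) {u x : V} (p : H.Walk u x) (hu : u ∈ B) :
    (∀ e ∈ p.edges, e ∈ T.edgeSet) ∧ ∀ y ∈ p.support, y ∈ B := by
  induction p with
  | nil => simpa using hu
  | cons hadj p ih =>
    obtain ⟨h1, h2⟩ := h _ hu _ hadj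
    obtain ⟨h3, h4⟩ := ih h2
    simp only [SimpleGraph.Walk.edges_cons, List.mem_cons, SimpleGraph.Walk.support_cons]
    constructor
    · rintro e (rfl | he)
      exacts [h1, h3 e he]
    · rintro y (rfl | hy)
      exacts [hu, h4 y hy]

/-- `T` is a tree with vertex set `S`, the vertices outside `S` being isolated. -/
def TreeOn (T : SimpleGraph V) (S : Finset V) : Prop :=
  (∀ a b, T.Adj a b → a ∈ S) ∧ (∀ a ∈ S, ∀ b ∈ S, T.Reachable a b) ∧ T.IsAcyclic

theorem TreeOn.support_subset {T : SimpleGraph V} {S : Finset V} (h : TreeOn T S) {u x : V}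
    (p : T.Walk u x) (hu : u ∈ S) : ∀ y ∈ p.support, y ∈ S :=
  (edges_subset_and_support_subset (T := T) (B := (S : Set V))
    (fun a _ b hab => ⟨hab, h.1 b a hab.symm⟩) p hu).2

theorem TreeOn.exists_isPath {T : SimpleGraph V} {S : Finset V} (h : TreeOn T S) {a b : V}
    (ha : a ∈ S) (hb : b ∈ S) : ∃ p : T.Walk a b, p.IsPath :=
  (h.2.1 a ha b hb).exists_isPath

/-- Paths in a forest are unique, so any one path to the root decides ancestry. -/
theorem TreeOn.isAncestor_iff {T : SimpleGraph V} {S : Finset V} (h : TreeOn T S) {v j : V}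
    {p : T.Walk j v} (hp : p.IsPath) (i : V) :
    Multigraph.IsAncestor T v i j ↔ i ≠ j ∧ i ∈ p.support := by
  refine and_congr_right fun _ => ⟨?_, fun hi => ⟨p, hp, hi⟩⟩
  rintro ⟨p', hp', hi⟩
  have := (h.2.2.subsingleton_path j v).elim ⟨p, hp⟩ ⟨p', hp'⟩
  rw [Subtype.mk.injEq] at this
  rwa [this]

theorem TreeOn.mem_of_isAncestor {T : SimpleGraph V} {S : Finset V} (h : TreeOn T S) {v i j : V}
    (hv : v ∈ S) (hij : Multigraph.IsAncestor T v i j) : i ∈ S ∧ j ∈ S := by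
  obtain ⟨-, p, -, hi⟩ := hij
  have := h.support_subset p.reverse hv
  simp only [SimpleGraph.Walk.support_reverse, List.mem_reverse] at this
  exact ⟨this i hi, this j p.start_mem_support⟩

theorem not_isAncestor_root {T : SimpleGraph V} {v i : V} : ¬ Multigraph.IsAncestor T v i v := by
  rintro ⟨hi, p, hp, hip⟩
  rw [SimpleGraph.Walk.isPath_iff_nil] at hp
  obtain rfl := hp.eq_nil
  simp at hip
  exact hi hip

theorem treeOn_univ [Fintype V] [Nonempty V] {T : SimpleGraph V} :
    TreeOn T Finset.univ ↔ T.IsTree := by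
  constructor
  · rintro ⟨-, h1, h2⟩
    exact ⟨⟨fun a b => h1 a (Finset.mem_univ _) b (Finset.mem_univ _)⟩, h2⟩
  · rintro ⟨h1, h2⟩
    exact ⟨fun _ _ _ => Finset.mem_univ _, fun a _ b _ => h1.preconnected a b, h2⟩

/-- Two graphs joined by an edge between `v` and `w`. -/
def joinGraph (T₁ T₂ : SimpleGraph V) (v w : V) : SimpleGraph V := T₁ ⊔ T₂ ⊔ SimpleGraph.edge v w

theorem joinGraph_adj {T₁ T₂ : SimpleGraph V} {v w a b : V} (hvw : v ≠ w) :
    (joinGraph T₁ T₂ v w).Adj a b ↔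
      T₁.Adj a b ∨ T₂.Adj a b ∨ (a = v ∧ b = w) ∨ (a = w ∧ b = v) := by
  rw [joinGraph, SimpleGraph.sup_adj, SimpleGraph.sup_adj, SimpleGraph.edge_adj, or_assoc]
  refine or_congr_right (or_congr_right ?_)
  grind

section Join

variable [DecidableEq V] {S B : Finset V} {v w : V} {T₁ T₂ : SimpleGraph V}

theorem joinGraph_ne (hw : w ∈ B) (hvB : v ∉ B) : v ≠ w := by rintro rfl; exact hvB hw

theorem joinGraph_left_le : T₁ ≤ joinGraph T₁ T₂ v w := le_sup_left.trans le_sup_left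

theorem joinGraph_right_le : T₂ ≤ joinGraph T₁ T₂ v w := le_sup_right.trans le_sup_left

theorem joinGraph_adj_of_mem (hw : w ∈ B) (hvB : v ∉ B) (h2 : TreeOn T₂ (S \ B)) {a b : V}
    (ha : a ∈ B) (hb : b ∈ B) : (joinGraph T₁ T₂ v w).Adj a b ↔ T₁.Adj a b := by
  rw [joinGraph_adj (joinGraph_ne hw hvB)]
  constructor
  · rintro (h | h | ⟨rfl, rfl⟩ | ⟨rfl, rfl⟩)
    · exact h
    · exact absurd ha (Finset.mem_sdiff.mp (h2.1 a b h)).2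
    · exact absurd ha hvB
    · exact absurd hb hvB
  · exact Or.inl

theorem joinGraph_adj_of_notMem (hw : w ∈ B) (hvB : v ∉ B) (h1 : TreeOn T₁ B) {a b : V}
    (ha : a ∉ B) (hb : b ∉ B) : (joinGraph T₁ T₂ v w).Adj a b ↔ T₂.Adj a b := by
  rw [joinGraph_adj (joinGraph_ne hw hvB)]
  constructor
  · rintro (h | h | ⟨rfl, rfl⟩ | ⟨rfl, rfl⟩)
    · exact absurd (h1.1 a b h) ha
    · exact h
    · exact absurd hw hb
    · exact absurd hw ha
  · exact fun h => Or.inr (Or.inl h)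

theorem joinGraph_adj_mem_notMem (hw : w ∈ B) (hvB : v ∉ B) (h1 : TreeOn T₁ B)
    (h2 : TreeOn T₂ (S \ B)) {a b : V} (ha : a ∉ B) (hb : b ∈ B) :
    (joinGraph T₁ T₂ v w).Adj a b ↔ a = v ∧ b = w := by
  rw [joinGraph_adj (joinGraph_ne hw hvB)]
  constructor
  · rintro (h | h | h | ⟨rfl, rfl⟩)
    · exact absurd (h1.1 a b h) ha
    · exact absurd hb (Finset.mem_sdiff.mp (h2.1 b a h.symm)).2
    · exact h
    · exact absurd hw ha
  · exact fun h => Or.inr (Or.inr (Or.inl h))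

theorem TreeOn.join (hBS : B ⊆ S) (hw : w ∈ B) (hv : v ∈ S) (hvB : v ∉ B) (h1 : TreeOn T₁ B)
    (h2 : TreeOn T₂ (S \ B)) : TreeOn (joinGraph T₁ T₂ v w) S := by
  have hvw := joinGraph_ne hw hvB
  have adjB : ∀ a ∈ (B : Set V), ∀ b, (T₁ ⊔ T₂).Adj a b → T₁.Adj a b ∧ b ∈ (B : Set V) := by
    rintro a ha b (h | h)
    · exact ⟨h, h1.1 b a h.symm⟩
    · exact absurd ha (Finset.mem_sdiff.mp (h2.1 a b h)).2
  have adjC : ∀ a ∈ (B : Set V)ᶜ, ∀ b, (T₁ ⊔ T₂).Adj a b → T₂.Adj a b ∧ b ∈ (B : Set V)ᶜ := by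
    rintro a ha b (h | h)
    · exact absurd (h1.1 a b h) ha
    · exact ⟨h, (Finset.mem_sdiff.mp (h2.1 b a h.symm)).2⟩
  refine ⟨?_, ?_, ?_⟩
  · intro a b h
    rw [joinGraph_adj hvw] at h
    rcases h with h | h | ⟨rfl, rfl⟩ | ⟨rfl, rfl⟩
    · exact hBS (h1.1 a b h)
    · exact (Finset.mem_sdiff.mp (h2.1 a b h)).1
    · exact hv
    · exact hBS hw
  · have hr : ∀ a ∈ S, (joinGraph T₁ T₂ v w).Reachable a v := by
      intro a ha
      by_cases haB : a ∈ B
      · refine ((h1.2.1 a haB w hw).mono joinGraph_left_le).trans (SimpleGraph.Adj.reachable ?_)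
        rw [joinGraph_adj hvw]; simp
      · exact (h2.2.1 a (by simp [ha, haB]) v (by simp [hv, hvB])).mono joinGraph_right_le
    exact fun a ha b hb => (hr a ha).trans (hr b hb).symm
  · refine SimpleGraph.IsAcyclic.sup_edge_of_not_reachable ?_ ?_
    · rintro ⟨p⟩
      exact (edges_subset_and_support_subset adjC p hvB).2 w p.end_mem_support hw
    · intro u c hc
      by_cases hu : u ∈ B
      · exact h1.2.2 _ (hc.transfer (edges_subset_and_support_subset adjB c hu).1)
      · exact h2.2.2 _ (hc.transfer (edges_subset_and_support_subset adjC c hu).1)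

theorem isAncestor_join_of_mem (hBS : B ⊆ S) (hw : w ∈ B) (hv : v ∈ S) (hvB : v ∉ B)
    (h1 : TreeOn T₁ B) (h2 : TreeOn T₂ (S \ B)) {i j : V} (hj : j ∈ B) :
    Multigraph.IsAncestor (joinGraph T₁ T₂ v w) v i j ↔
      i = v ∨ Multigraph.IsAncestor T₁ w i j := by
  obtain ⟨p, hp⟩ := h1.exists_isPath hj hw
  have hadj : (joinGraph T₁ T₂ v w).Adj w v := by
    rw [joinGraph_adj (joinGraph_ne hw hvB)]; simp
  have hpath : ((p.mapLe (joinGraph_left_le (T₂ := T₂) (v := v) (w := w))).concat hadj).IsPath := by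
    refine SimpleGraph.Walk.IsPath.concat (hp.mapLe _) ?_ hadj
    rw [SimpleGraph.Walk.support_mapLe_eq_support]
    exact fun h => hvB (h1.support_subset p hj v h)
  rw [(h1.join hBS hw hv hvB h2).isAncestor_iff hpath, h1.isAncestor_iff hp,
    SimpleGraph.Walk.support_concat, SimpleGraph.Walk.support_mapLe_eq_support]
  simp only [List.mem_append, List.mem_singleton]
  constructor
  · tauto
  · rintro (rfl | h)
    · exact ⟨by rintro rfl; exact hvB hj, Or.inr rfl⟩
    · tauto

theorem isAncestor_join_of_notMem (hBS : B ⊆ S) (hw : w ∈ B) (hv : v ∈ S) (hvB : v ∉ B)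
    (h1 : TreeOn T₁ B) (h2 : TreeOn T₂ (S \ B)) {i j : V} (hj : j ∉ B) :
    Multigraph.IsAncestor (joinGraph T₁ T₂ v w) v i j ↔ Multigraph.IsAncestor T₂ v i j := by
  have h := h1.join hBS hw hv hvB h2
  by_cases hjS : j ∈ S
  · obtain ⟨p, hp⟩ := h2.exists_isPath (a := j) (b := v) (by simp [hj, hjS]) (by simp [hv, hvB])
    rw [h.isAncestor_iff (hp.mapLe (joinGraph_right_le (T₁ := T₁) (v := v) (w := w))),
      h2.isAncestor_iff hp, SimpleGraph.Walk.support_mapLe_eq_support]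
  · constructor
    · exact fun ha => absurd (h.mem_of_isAncestor hv ha).2 hjS
    · intro ha
      have := (h2.mem_of_isAncestor (by simp [hv, hvB]) ha).2
      exact absurd (Finset.mem_sdiff.mp this).1 hjS

theorem isParent_join_of_mem (hBS : B ⊆ S) (hw : w ∈ B) (hv : v ∈ S) (hvB : v ∉ B)
    (h1 : TreeOn T₁ B) (h2 : TreeOn T₂ (S \ B)) {p i : V} (hi : i ∈ B) (hiw : i ≠ w) :
    Multigraph.IsParent (joinGraph T₁ T₂ v w) v p i ↔ Multigraph.IsParent T₁ w p i := by
  rw [Multigraph.IsParent, Multigraph.IsParent, isAncestor_join_of_mem hBS hw hv hvB h1 h2 hi]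
  constructor
  · rintro ⟨rfl | ha, hadj⟩
    · rw [joinGraph_adj_mem_notMem hw hvB h1 h2 hvB hi] at hadj
      exact absurd hadj.2 hiw
    · have := (h1.mem_of_isAncestor hw ha).1
      exact ⟨ha, (joinGraph_adj_of_mem hw hvB h2 this hi).mp hadj⟩
  · rintro ⟨ha, hadj⟩
    exact ⟨Or.inr ha, joinGraph_left_le hadj⟩

theorem isParent_join_root (hBS : B ⊆ S) (hw : w ∈ B) (hv : v ∈ S) (hvB : v ∉ B)
    (h1 : TreeOn T₁ B) (h2 : TreeOn T₂ (S \ B)) {p : V} :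
    Multigraph.IsParent (joinGraph T₁ T₂ v w) v p w ↔ p = v := by
  rw [Multigraph.IsParent, isAncestor_join_of_mem hBS hw hv hvB h1 h2 hw]
  constructor
  · rintro ⟨h | h, -⟩
    exacts [h, absurd h not_isAncestor_root]
  · rintro rfl
    exact ⟨Or.inl rfl, by rw [joinGraph_adj (joinGraph_ne hw hvB)]; simp⟩

theorem isParent_join_of_notMem (hBS : B ⊆ S) (hw : w ∈ B) (hv : v ∈ S) (hvB : v ∉ B)
    (h1 : TreeOn T₁ B) (h2 : TreeOn T₂ (S \ B)) {p i : V} (hi : i ∉ B) :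
    Multigraph.IsParent (joinGraph T₁ T₂ v w) v p i ↔ Multigraph.IsParent T₂ v p i := by
  rw [Multigraph.IsParent, Multigraph.IsParent, isAncestor_join_of_notMem hBS hw hv hvB h1 h2 hi]
  refine and_congr_right fun ha => ?_
  have := (h2.mem_of_isAncestor (by simp [hv, hvB]) ha).1
  exact joinGraph_adj_of_notMem hw hvB h1 (Finset.mem_sdiff.mp this).2 hi

/-- Let `(i, j)` be a `κ`-inversion of the joined tree. If `j` is outside `B`, it belongs to `T₂`.
If `j` is in `B` and `i ≠ w`, it belongs to `T₁`, rooted at `w`, with the same parent of `i`. If `i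
= w`, the parent is the root `v`, and each `j ∈ B` below `w` contributes its number of edges to `v`.
-/
theorem kappa_join {V : Type*} {S B : Finset V} {v w : V} {T₁ T₂ : SimpleGraph V} [Fintype V]
    [LinearOrder V] (G : Multigraph V) (hBS : B ⊆ S) (hw : w ∈ B) (hv : v ∈ S) (hvB : v ∉ B)
    (h1 : TreeOn T₁ B) (h2 : TreeOn T₂ (S \ B)) :
    G.kappa (joinGraph T₁ T₂ v w) v =
      (∑ j ∈ B.filter (fun j => j < w), G s(v, j)) + G.kappa T₁ w + G.kappa T₂ v := by
  set T := joinGraph T₁ T₂ v w with hT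
  have hv2 : v ∈ S \ B := by simp [hv, hvB]
  have e2 : (G.kappaInversions T v).filter (fun x => ¬ x.2.2 ∈ B) = G.kappaInversions T₂ v := by
    ext ⟨p, i, j⟩
    simp only [Multigraph.kappaInversions, Finset.mem_filter, Finset.mem_univ, true_and]
    constructor
    · rintro ⟨⟨hi, hj, ha, hlt, hp, hadj⟩, hjB⟩
      rw [isAncestor_join_of_notMem hBS hw hv hvB h1 h2 hjB] at ha
      have hiB := (Finset.mem_sdiff.mp (h2.mem_of_isAncestor hv2 ha).1).2
      rw [isParent_join_of_notMem hBS hw hv hvB h1 h2 hiB] at hp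
      exact ⟨hi, hj, ha, hlt, hp, hadj⟩
    · rintro ⟨hi, hj, ha, hlt, hp, hadj⟩
      have hiB := (Finset.mem_sdiff.mp (h2.mem_of_isAncestor hv2 ha).1).2
      have hjB := (Finset.mem_sdiff.mp (h2.mem_of_isAncestor hv2 ha).2).2
      exact ⟨⟨hi, hj, (isAncestor_join_of_notMem hBS hw hv hvB h1 h2 hjB).mpr ha, hlt,
        (isParent_join_of_notMem hBS hw hv hvB h1 h2 hiB).mpr hp, hadj⟩, hjB⟩
  have e1 : ((G.kappaInversions T v).filter (fun x => x.2.2 ∈ B)).filter (fun x => ¬ x.2.1 = w) =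
      G.kappaInversions T₁ w := by
    ext ⟨p, i, j⟩
    simp only [Multigraph.kappaInversions, Finset.mem_filter, Finset.mem_univ, true_and]
    constructor
    · rintro ⟨⟨⟨hi, hj, ha, hlt, hp, hadj⟩, hjB⟩, hiw⟩
      rw [isAncestor_join_of_mem hBS hw hv hvB h1 h2 hjB] at ha
      replace ha := ha.resolve_left hi
      have hiB := (h1.mem_of_isAncestor hw ha).1
      rw [isParent_join_of_mem hBS hw hv hvB h1 h2 hiB hiw] at hp
      refine ⟨hiw, ?_, ha, hlt, hp, hadj⟩
      rintro rfl
      exact not_isAncestor_root ha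
    · rintro ⟨hi, hj, ha, hlt, hp, hadj⟩
      obtain ⟨hiB, hjB⟩ := h1.mem_of_isAncestor hw ha
      exact ⟨⟨⟨by rintro rfl; exact hvB hiB, by rintro rfl; exact hvB hjB,
        (isAncestor_join_of_mem hBS hw hv hvB h1 h2 hjB).mpr (Or.inr ha), hlt,
        (isParent_join_of_mem hBS hw hv hvB h1 h2 hiB hi).mpr hp, hadj⟩, hjB⟩, hi⟩
  have e0 : ((G.kappaInversions T v).filter (fun x => x.2.2 ∈ B)).filter (fun x => x.2.1 = w) =
      ((B.filter (fun j => j < w)).filter fun j => G s(v, j) ≠ 0).image fun j => (v, w, j) := by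
    ext ⟨p, i, j⟩
    simp only [Multigraph.kappaInversions, Finset.mem_filter, Finset.mem_univ, true_and,
      Finset.mem_image, Prod.mk.injEq]
    constructor
    · rintro ⟨⟨⟨hi, hj, ha, hlt, hp, hadj⟩, hjB⟩, rfl⟩
      rw [isParent_join_root hBS hw hv hvB h1 h2] at hp
      subst hp
      exact ⟨j, ⟨⟨hjB, hlt⟩, hadj.2.ne'⟩, rfl, rfl, rfl⟩
    · rintro ⟨j, ⟨⟨hjB, hlt⟩, hG⟩, rfl, rfl, rfl⟩
      have hvj : v ≠ j := by rintro rfl; exact hvB hjB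
      refine ⟨⟨⟨(joinGraph_ne hw hvB).symm, hvj.symm, ?_, hlt,
        (isParent_join_root hBS hw hv hvB h1 h2).mpr rfl, hvj, Nat.pos_of_ne_zero hG⟩, hjB⟩, rfl⟩
      rw [isAncestor_join_of_mem hBS hw hv hvB h1 h2 hjB]
      obtain ⟨p, hp⟩ := h1.exists_isPath hjB hw
      exact Or.inr ⟨hlt.ne', p, hp, p.end_mem_support⟩
  rw [Multigraph.kappa, ← Finset.sum_filter_add_sum_filter_not _ (fun x => x.2.2 ∈ B), e2,
    ← Finset.sum_filter_add_sum_filter_not ((G.kappaInversions T v).filter (fun x => x.2.2 ∈ B))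
      (fun x => x.2.1 = w), e1, e0, Finset.sum_image (by simp), Finset.sum_filter_ne_zero]
  rfl

end Join

/-- The restriction of a graph to the edges inside `B`. -/
def restrictGraph (T : SimpleGraph V) (B : Set V) : SimpleGraph V where
  Adj a b := T.Adj a b ∧ a ∈ B ∧ b ∈ B
  symm := ⟨fun _ _ h => ⟨h.1.symm, h.2.2, h.2.1⟩⟩
  loopless := ⟨fun a h => T.loopless.irrefl a h.1⟩

theorem restrictGraph_le (T : SimpleGraph V) (B : Set V) : restrictGraph T B ≤ T := fun _ _ h => h.1

variable [DecidableEq V]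

/-- Removing the root of a tree and taking the component of another vertex. -/
theorem TreeOn.exists_join {T : SimpleGraph V} {S : Finset V} (h : TreeOn T S) {v m : V}
    (hv : v ∈ S) (hm : m ∈ S) (hmv : m ≠ v) :
    ∃ B ⊆ S, m ∈ B ∧ v ∉ B ∧ ∃ w ∈ B, ∃ T₁ T₂, TreeOn T₁ B ∧ TreeOn T₂ (S \ B) ∧
      joinGraph T₁ T₂ v w = T := by
  set T' := restrictGraph T {v}ᶜ with hT'
  set B := S.filter fun x => T'.Reachable m x with hB
  have hBr : ∀ x, x ∈ B ↔ T'.Reachable m x := by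
    intro x
    rw [hB, Finset.mem_filter, and_iff_right_iff_imp]
    rintro ⟨p⟩
    exact h.support_subset (p.mapLe (restrictGraph_le _ _)) hm x (SimpleGraph.Walk.end_mem_support _)
  have hBS : B ⊆ S := Finset.filter_subset _ _
  have hmB : m ∈ B := (hBr m).mpr SimpleGraph.Reachable.rfl
  have hvB : v ∉ B := by
    rw [hBr]
    rintro ⟨p⟩
    exact (edges_subset_and_support_subset (T := T') (B := {v}ᶜ)
      (fun a _ b hab => ⟨hab, hab.2.2⟩) p hmv).2 v p.end_mem_support rfl
  have closed : ∀ a ∈ B, ∀ b, T.Adj a b → b ≠ v → b ∈ B := by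
    intro a ha b hab hbv
    rw [hBr] at ha ⊢
    have hav : a ≠ v := by rintro rfl; exact hvB ((hBr a).mpr ha)
    exact ha.trans (SimpleGraph.Adj.reachable ⟨hab, hav, hbv⟩)
  have hw : ∃ w ∈ B, T.Adj w v := by
    by_contra hcon
    push Not at hcon
    obtain ⟨p⟩ := h.2.1 m hm v hv
    refine hvB ((edges_subset_and_support_subset (T := T) (B := (B : Set V)) ?_ p hmB).2 v
      p.end_mem_support)
    intro a ha b hab
    refine ⟨hab, closed a ha b hab ?_⟩
    rintro rfl
    exact hcon a ha hab
  obtain ⟨w, hwB, hwv⟩ := hw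
  have hvw : v ≠ w := hwv.ne.symm
  set T₁ := restrictGraph T (B : Set V) with hT₁
  set T₂ := restrictGraph T ((S \ B : Finset V) : Set V) with hT₂
  have r1 : ∀ a ∈ B, ∀ b ∈ B, T₁.Reachable a b := by
    have : ∀ a ∈ B, T₁.Reachable m a := by
      intro a ha
      obtain ⟨p⟩ := (hBr a).mp ha
      have key := edges_subset_and_support_subset (T := T₁) (B := (B : Set V)) (fun a ha b hab => by
        have := closed a ha b hab.1 hab.2.2
        exact ⟨⟨hab.1, ha, this⟩, this⟩) p hmB
      exact ⟨p.transfer _ key.1⟩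
    exact fun a ha b hb => (this a ha).symm.trans (this b hb)
  -- A second neighbour of `v` in `B` would have two paths to `v`: its own edge, and the one through
  -- `w`.
  have huniq : ∀ w' ∈ B, T.Adj w' v → w' = w := by
    intro w' hw' hadj
    obtain ⟨p, hp⟩ := (r1 w' hw' w hwB).exists_isPath
    have hpB : ∀ y ∈ p.support, y ∈ B := (edges_subset_and_support_subset (T := T₁)
      (B := (B : Set V)) (fun a _ b hab => ⟨hab, hab.2.2⟩) p hw').2
    have hpath : ((p.mapLe (restrictGraph_le T _)).concat hwv).IsPath := by
      refine SimpleGraph.Walk.IsPath.concat (hp.mapLe _) ?_ hwv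
      rw [SimpleGraph.Walk.support_mapLe_eq_support]
      exact fun h => hvB (hpB v h)
    have := (h.2.2.subsingleton_path w' v).elim ⟨_, hpath⟩ (SimpleGraph.Path.singleton hadj)
    rw [SimpleGraph.Path.singleton, Subtype.mk.injEq] at this
    have hs := congrArg SimpleGraph.Walk.support this
    rw [SimpleGraph.Walk.support_concat, SimpleGraph.Walk.support_mapLe_eq_support] at hs
    have hmem : w ∈ p.support ++ [v] := by simp
    rw [hs] at hmem
    simp only [SimpleGraph.Walk.support_cons, SimpleGraph.Walk.support_nil, List.mem_cons,
      List.not_mem_nil, or_false] at hmem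
    rcases hmem with hmem | hmem
    · exact hmem.symm
    · exact absurd hmem hvw.symm
  have hjoin : joinGraph T₁ T₂ v w = T := by
    ext a b
    rw [joinGraph_adj hvw]
    constructor
    · rintro (hab | hab | ⟨rfl, rfl⟩ | ⟨rfl, rfl⟩)
      exacts [hab.1, hab.1, hwv.symm, hwv]
    · intro hab
      have haS := h.1 a b hab
      have hbS := h.1 b a hab.symm
      by_cases ha : a ∈ B <;> by_cases hb : b ∈ B
      · exact Or.inl ⟨hab, ha, hb⟩
      · have hbv : b = v := by
          by_contra hbv
          exact hb (closed a ha b hab hbv)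
        subst hbv
        exact Or.inr (Or.inr (Or.inr ⟨huniq a ha hab, rfl⟩))
      · have hav : a = v := by
          by_contra hav
          exact ha (closed b hb a hab.symm hav)
        subst hav
        exact Or.inr (Or.inr (Or.inl ⟨rfl, huniq b hb hab.symm⟩))
      · exact Or.inr (Or.inl ⟨hab, by simp [haS, ha], by simp [hbS, hb]⟩)
  refine ⟨B, hBS, hmB, hvB, w, hwB, T₁, T₂, ⟨fun a b hab => hab.2.1, r1,
    h.2.2.anti (restrictGraph_le _ _)⟩, ⟨fun a b hab => hab.2.1, ?_,
    h.2.2.anti (restrictGraph_le _ _)⟩, hjoin⟩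
  -- A walk to `v` that starts outside `B` is cut at its first arrival at `v`; until then it stays
  -- outside `B`, because only `v` links `B` to the other vertices.
  have key : ∀ {a c : V} (p : T.Walk a c), c = v → a ∈ S → a ∉ B → T₂.Reachable a c := by
    intro a c p
    induction p with
    | nil => exact fun _ _ _ => SimpleGraph.Reachable.rfl
    | @cons a b c hab p ih =>
      intro hc haS haB
      by_cases hac : a = c
      · rw [hac]
      have hav : a ≠ v := hc ▸ hac
      have hb : b ∉ B := fun hb => haB (closed b hb a hab.symm hav)
      have hbS := h.1 b a hab.symm
      refine SimpleGraph.Reachable.trans (SimpleGraph.Adj.reachable ⟨hab, ?_, ?_⟩) (ih hc hbS hb)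
      · simp [haS, haB]
      · simp [hbS, hb]
  have : ∀ a ∈ S \ B, T₂.Reachable a v := by
    intro a ha
    obtain ⟨haS, haB⟩ := Finset.mem_sdiff.mp ha
    obtain ⟨p⟩ := h.2.1 a haS v hv
    exact key p rfl haS haB
  exact fun a ha b hb => (this a ha).trans (this b hb).symm

end Trees

/-! ### The inversion polynomial as a cumulant -/

section InversionPolynomial

variable {V A : Type*} [Fintype V] [LinearOrder V] [CommRing A]

/-- The weighted sum of the trees with vertex set `S` and root `v` contained in `G`. -/
def treeSum (G : Multigraph V) (q : A) (S : Finset V) (v : V) : A :=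
  ∑ T ∈ Finset.univ.filter (fun T : SimpleGraph V => T ≤ G.simple ∧ TreeOn T S),
    q ^ G.kappa T v * ∏ e ∈ T.edgeFinset, ∑ k ∈ Finset.range (G e), q ^ k

theorem inversionPoly_eq_treeSum (G : Multigraph V) (v : V) (q : A) :
    G.inversionPoly v q = q ^ (∑ i, G s(i, i)) * treeSum G q Finset.univ v := by
  have : Nonempty V := ⟨v⟩
  simp only [Multigraph.inversionPoly, treeSum, treeOn_univ]

theorem treeSum_singleton (G : Multigraph V) (q : A) (v : V) : treeSum G q {v} v = 1 := by
  have h0 : ∀ T : SimpleGraph V, TreeOn T {v} → T = ⊥ := by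
    intro T hT
    ext a b
    simp only [SimpleGraph.bot_adj, iff_false]
    intro hab
    have h1 := Finset.mem_singleton.mp (hT.1 a b hab)
    have h2 := Finset.mem_singleton.mp (hT.1 b a hab.symm)
    exact hab.ne (h1.trans h2.symm)
  have h1 : TreeOn (⊥ : SimpleGraph V) {v} := by
    refine ⟨fun a b h => absurd h (by simp), fun a ha b hb => ?_, SimpleGraph.isAcyclic_bot⟩
    rw [Finset.mem_singleton.mp ha, Finset.mem_singleton.mp hb]
  have h2 : Finset.univ.filter (fun T : SimpleGraph V => T ≤ G.simple ∧ TreeOn T {v}) = {⊥} := by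
    ext T
    simp only [Finset.mem_filter, Finset.mem_univ, true_and, Finset.mem_singleton]
    exact ⟨fun h => h0 T h.2, by rintro rfl; exact ⟨bot_le, h1⟩⟩
  have h3 : G.kappaInversions ⊥ v = ∅ := by
    rw [Multigraph.kappaInversions, Finset.filter_eq_empty_iff]
    rintro ⟨p, i, j⟩ - ⟨-, hj, ha, -⟩
    exact hj (Finset.mem_singleton.mp (h1.mem_of_isAncestor (Finset.mem_singleton_self v) ha).2)
  rw [treeSum, h2, Finset.sum_singleton, Multigraph.kappa, h3, Finset.sum_empty, pow_zero, one_mul]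
  refine Finset.prod_eq_one fun e he => ?_
  simp at he

/-- Starting from `m`, an edge of `T₁` that leaves `B'` would have to be the joining edge of the
second decomposition, which ends at `v`; but `v` is not in `B`. -/
theorem subset_of_joinGraph_eq {S B B' : Finset V} {v w w' m : V} {T₁ T₂ T₁' T₂' : SimpleGraph V}
    (hw' : w' ∈ B') (hvB : v ∉ B) (hvB' : v ∉ B') (hm : m ∈ B) (hm' : m ∈ B')
    (h1 : TreeOn T₁ B) (h1' : TreeOn T₁' B') (h2' : TreeOn T₂' (S \ B'))
    (h : joinGraph T₁ T₂ v w = joinGraph T₁' T₂' v w') : B ⊆ B' := by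
  intro x hx
  obtain ⟨p⟩ := h1.2.1 m hm x hx
  refine (edges_subset_and_support_subset (T := T₁) (B := (B' : Set V)) ?_ p hm').2 x p.end_mem_support
  intro a ha b hab
  refine ⟨hab, ?_⟩
  by_contra hb
  have hadj : (joinGraph T₁' T₂' v w').Adj b a := by
    rw [← h]; exact joinGraph_left_le hab.symm
  rw [joinGraph_adj_mem_notMem hw' hvB' h1' h2' hb ha] at hadj
  have := h1.1 b a hab.symm
  rw [hadj.1] at this
  exact hvB this

theorem joinGraph_injective {S B B' : Finset V} {v w w' m : V} {T₁ T₂ T₁' T₂' : SimpleGraph V}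
    (hw : w ∈ B) (hw' : w' ∈ B') (hvB : v ∉ B) (hvB' : v ∉ B') (hm : m ∈ B) (hm' : m ∈ B')
    (h1 : TreeOn T₁ B) (h2 : TreeOn T₂ (S \ B)) (h1' : TreeOn T₁' B') (h2' : TreeOn T₂' (S \ B'))
    (h : joinGraph T₁ T₂ v w = joinGraph T₁' T₂' v w') :
    B = B' ∧ w = w' ∧ T₁ = T₁' ∧ T₂ = T₂' := by
  obtain rfl : B = B' := (subset_of_joinGraph_eq hw' hvB hvB' hm hm' h1 h1' h2' h).antisymm
    (subset_of_joinGraph_eq hw hvB' hvB hm' hm h1' h1 h2 h.symm)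
  refine ⟨rfl, ?_, ?_, ?_⟩
  · have : (joinGraph T₁' T₂' v w').Adj v w := by
      rw [← h, joinGraph_adj (joinGraph_ne hw hvB)]; simp
    exact ((joinGraph_adj_mem_notMem hw' hvB' h1' h2' hvB' hw).mp this).2
  · ext a b
    have key : ∀ T₃ T₄ : SimpleGraph V, TreeOn T₃ B → T₃.Adj a b → a ∈ B ∧ b ∈ B :=
      fun T₃ _ h3 hab => ⟨h3.1 a b hab, h3.1 b a hab.symm⟩
    constructor
    · intro hab
      obtain ⟨ha, hb⟩ := key T₁ T₁ h1 hab
      rw [← joinGraph_adj_of_mem hw' hvB' h2' ha hb, ← h]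
      exact joinGraph_left_le hab
    · intro hab
      obtain ⟨ha, hb⟩ := key T₁' T₁' h1' hab
      rw [← joinGraph_adj_of_mem hw hvB h2 ha hb, h]
      exact joinGraph_left_le hab
  · ext a b
    have key : ∀ T₃ : SimpleGraph V, TreeOn T₃ (S \ B) → T₃.Adj a b → a ∉ B ∧ b ∉ B :=
      fun T₃ h3 hab => ⟨(Finset.mem_sdiff.mp (h3.1 a b hab)).2,
        (Finset.mem_sdiff.mp (h3.1 b a hab.symm)).2⟩
    constructor
    · intro hab
      obtain ⟨ha, hb⟩ := key T₂ h2 hab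
      rw [← joinGraph_adj_of_notMem hw' hvB' h1' ha hb, ← h]
      exact joinGraph_right_le hab
    · intro hab
      obtain ⟨ha, hb⟩ := key T₂' h2' hab
      rw [← joinGraph_adj_of_notMem hw hvB h1 ha hb, h]
      exact joinGraph_right_le hab

theorem prod_edgeFinset_joinGraph {S B : Finset V} {v w : V} {T₁ T₂ : SimpleGraph V}
    (hw : w ∈ B) (hvB : v ∉ B) (h1 : TreeOn T₁ B) (h2 : TreeOn T₂ (S \ B)) (f : Sym2 V → A) :
    ∏ e ∈ (joinGraph T₁ T₂ v w).edgeFinset, f e =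
      f s(v, w) * (∏ e ∈ T₁.edgeFinset, f e) * ∏ e ∈ T₂.edgeFinset, f e := by
  have hvw := joinGraph_ne hw hvB
  have e : (joinGraph T₁ T₂ v w).edgeFinset = insert s(v, w) (T₁.edgeFinset ∪ T₂.edgeFinset) := by
    ext e
    induction e with
    | _ a b =>
      simp only [SimpleGraph.mem_edgeFinset, SimpleGraph.mem_edgeSet, joinGraph_adj hvw,
        Finset.mem_insert, Finset.mem_union, Sym2.eq_iff]
      tauto
  have hd : Disjoint T₁.edgeFinset T₂.edgeFinset := by
    rw [Finset.disjoint_left]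
    intro e
    induction e with
    | _ a b =>
      simp only [SimpleGraph.mem_edgeFinset, SimpleGraph.mem_edgeSet]
      exact fun hab hab' => (Finset.mem_sdiff.mp (h2.1 a b hab')).2 (h1.1 a b hab)
  have hn : s(v, w) ∉ T₁.edgeFinset ∪ T₂.edgeFinset := by
    simp only [Finset.mem_union, SimpleGraph.mem_edgeFinset, SimpleGraph.mem_edgeSet, not_or]
    exact ⟨fun h => hvB (h1.1 v w h), fun h => (Finset.mem_sdiff.mp (h2.1 w v h.symm)).2 hw⟩
  rw [e, Finset.prod_insert hn, Finset.prod_union hd, mul_assoc]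

/-- Removing the root `v` and singling out the component of `m`. -/
theorem treeSum_eq_sum (G : Multigraph V) (q : A) {S : Finset V} {v m : V} (hv : v ∈ S)
    (hm : m ∈ S) (hmv : m ≠ v) :
    treeSum G q S v = ∑ B ∈ S.powerset.filter (fun B => m ∈ B ∧ v ∉ B),
      (∑ w ∈ B, q ^ (∑ j ∈ B.filter (fun j => j < w), G s(v, j)) *
        (∑ k ∈ Finset.range (G s(v, w)), q ^ k) * treeSum G q B w) * treeSum G q (S \ B) v := by
  -- The terms with no edge between `v` and `w` vanish, since their q-integer is `0`. Once they are
  -- dropped, the joining edge is always an edge of `G`.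
  have e1 : ∀ B : Finset V, (∑ w ∈ B, q ^ (∑ j ∈ B.filter (fun j => j < w), G s(v, j)) *
        (∑ k ∈ Finset.range (G s(v, w)), q ^ k) * treeSum G q B w) =
      ∑ w ∈ B.filter (fun w => G s(v, w) ≠ 0),
        q ^ (∑ j ∈ B.filter (fun j => j < w), G s(v, j)) *
        (∑ k ∈ Finset.range (G s(v, w)), q ^ k) * treeSum G q B w := by
    intro B
    symm
    refine Finset.sum_subset (Finset.filter_subset _ _) fun w hw hw' => ?_
    have : G s(v, w) = 0 := by
      by_contra h
      exact hw' (Finset.mem_filter.mpr ⟨hw, h⟩)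
    simp [this]
  simp_rw [e1, treeSum]
  -- The q-integers are made opaque so that distributing products over sums leaves them alone.
  obtain ⟨g, hg⟩ : ∃ g : ℕ → A, ∀ n, ∑ k ∈ Finset.range n, q ^ k = g n := ⟨_, fun _ => rfl⟩
  simp_rw [hg, Finset.sum_mul, Finset.mul_sum, Finset.sum_mul]
  simp_rw [Finset.sum_sigma']
  symm
  refine Finset.sum_bij (fun x _ => joinGraph x.2.2.2 x.2.2.1 v x.2.1) ?_ ?_ ?_ ?_
  · rintro ⟨B, w, T₂, T₁⟩ h
    simp only [Finset.mem_sigma, Finset.mem_filter, Finset.mem_powerset, Finset.mem_univ,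
      true_and] at h ⊢
    obtain ⟨⟨hBS, hmB, hvB⟩, ⟨hw, hG⟩, ⟨hG2, h2⟩, hG1, h1⟩ := h
    refine ⟨?_, h1.join hBS hw hv hvB h2⟩
    refine sup_le (sup_le hG1 hG2) ?_
    rw [SimpleGraph.edge_le_iff]
    exact Or.inr ⟨joinGraph_ne hw hvB, Nat.pos_of_ne_zero hG⟩
  · rintro ⟨B, w, T₂, T₁⟩ h ⟨B', w', T₂', T₁'⟩ h' heq
    simp only [Finset.mem_sigma, Finset.mem_filter, Finset.mem_powerset, Finset.mem_univ,
      true_and] at h h'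
    obtain ⟨rfl, rfl, rfl, rfl⟩ := joinGraph_injective h.2.1.1 h'.2.1.1 h.1.2.2 h'.1.2.2 h.1.2.1
      h'.1.2.1 h.2.2.2.2 h.2.2.1.2 h'.2.2.2.2 h'.2.2.1.2 heq
    rfl
  · intro T hT
    simp only [Finset.mem_filter, Finset.mem_univ, true_and] at hT
    obtain ⟨B, hBS, hmB, hvB, w, hw, T₁, T₂, h1, h2, rfl⟩ := hT.2.exists_join hv hm hmv
    refine ⟨⟨B, w, T₂, T₁⟩, ?_, rfl⟩
    simp only [Finset.mem_sigma, Finset.mem_filter, Finset.mem_powerset, Finset.mem_univ, true_and]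
    refine ⟨⟨hBS, hmB, hvB⟩, ⟨hw, ?_⟩, ⟨joinGraph_right_le.trans hT.1, h2⟩,
      joinGraph_left_le.trans hT.1, h1⟩
    have : (joinGraph T₁ T₂ v w).Adj v w := by rw [joinGraph_adj (joinGraph_ne hw hvB)]; simp
    exact (hT.1 this).2.ne'
  · rintro ⟨B, w, T₂, T₁⟩ h
    simp only [Finset.mem_sigma, Finset.mem_filter, Finset.mem_powerset, Finset.mem_univ,
      true_and] at h
    obtain ⟨⟨hBS, hmB, hvB⟩, ⟨hw, hG⟩, ⟨hG2, h2⟩, hG1, h1⟩ := h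
    rw [kappa_join G hBS hw hv hvB h1 h2, prod_edgeFinset_joinGraph hw hvB h1 h2]
    simp only [pow_add]
    ring

/-- If `s_1, s_2, …` are the partial sums of `f` along the increasing enumeration of `B`, and `s_0 =
0`, the `k`-th term is `q^(s_k) - q^(s_(k-1))`. -/
theorem sum_telescope (q : A) (f : V → ℕ) (B : Finset V) :
    ∑ w ∈ B, q ^ (∑ j ∈ B.filter (fun j => j < w), f j) *
      ((q - 1) * ∑ k ∈ Finset.range (f w), q ^ k) = q ^ (∑ j ∈ B, f j) - 1 := by
  induction B using Finset.induction_on_max with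
  | empty => simp
  | insert a B hB ih =>
    have ha : a ∉ B := fun h => lt_irrefl _ (hB a h)
    rw [Finset.sum_insert ha, Finset.sum_insert ha]
    have e1 : (insert a B).filter (fun j => j < a) = B := by
      ext x
      simp only [Finset.mem_filter, Finset.mem_insert]
      constructor
      · rintro ⟨rfl | h, hx⟩
        exacts [absurd hx (lt_irrefl _), h]
      · exact fun h => ⟨Or.inr h, hB x h⟩
    have e2 : ∀ w ∈ B, (insert a B).filter (fun j => j < w) = B.filter fun j => j < w := by
      intro w hw
      rw [Finset.filter_insert, if_neg (hB w hw).not_gt]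
    have e3 : ∑ w ∈ B, q ^ (∑ j ∈ (insert a B).filter (fun j => j < w), f j) *
        ((q - 1) * ∑ k ∈ Finset.range (f w), q ^ k) = q ^ (∑ j ∈ B, f j) - 1 := by
      rw [← ih]
      exact Finset.sum_congr rfl fun w hw => by rw [e2 w hw]
    rw [e3, e1, mul_geom_sum, pow_add]
    ring

/-- Cumulants and tree sums obey the same recursion, which splits `S` into a part `B` containing `m`
and a part containing the root `v`. On the cumulant side the coupling is `q^(edges from v to B) -
1`; `sum_telescope` spreads it over the possible roots `w` of `B`, each with its own tree sum. The
induction therefore needs the formula for every choice of root. -/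
theorem cumulantOn_eq_treeSum (G : Multigraph V) (q : A) {u : Finset V → A} (hu : u ∅ = 1)
    (huv : ∀ v S, v ∉ S → u (insert v S) = q ^ G s(v, v) * q ^ (∑ j ∈ S, G s(v, j)) * u S) :
    ∀ (N : ℕ) (S : Finset V), S.card = N → ∀ v ∈ S,
      cumulantOn u S = (q - 1) ^ (S.card - 1) * q ^ (∑ i ∈ S, G s(i, i)) * treeSum G q S v := by
  intro N
  induction N using Nat.strong_induction_on with
  | _ N ih =>
  rintro S rfl v hv
  by_cases hS : ∃ m ∈ S, m ≠ v
  · obtain ⟨m, hm, hmv⟩ := hS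
    have hrec : cumulantOn u S = ∑ B ∈ S.powerset.filter (fun B => m ∈ B ∧ v ∉ B),
        (q ^ (∑ j ∈ B, G s(v, j)) - 1) * cumulantOn u B * cumulantOn u (S \ B) := by
      have := cumulantOn_eq_sum hu (g := fun v => q ^ G s(v, v))
        (h := fun v S => q ^ (∑ j ∈ S, G s(v, j)))
        (fun v B C hBC => by rw [← pow_add, ← Finset.sum_union hBC]; congr!) (fun v S hv => by
          rw [← huv v S hv]; congr!) _ S rfl v hv m hm hmv
      rw [this]
      congr!
    rw [hrec, treeSum_eq_sum G q hv hm hmv, Finset.mul_sum]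
    refine Finset.sum_congr rfl fun B hB => ?_
    simp only [Finset.mem_filter, Finset.mem_powerset] at hB
    obtain ⟨hBS, hmB, hvB⟩ := hB
    have hlt : B.card < S.card := Finset.card_lt_card
      ((Finset.ssubset_iff_of_subset hBS).mpr ⟨v, hv, hvB⟩)
    have hlt' : (S \ B).card < S.card := Finset.card_lt_card
      ((Finset.ssubset_iff_of_subset Finset.sdiff_subset).mpr ⟨m, hm, by simp [hmB]⟩)
    have hv' : v ∈ S \ B := by simp [hv, hvB]
    have i2 := ih _ hlt' (S \ B) rfl v hv'
    have hcard : S.card - 1 = (B.card - 1) + 1 + ((S \ B).card - 1) := by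
      have h1 := Finset.card_sdiff_add_card_eq_card hBS
      have h2 := Finset.card_pos.mpr ⟨m, hmB⟩
      have h3 := Finset.card_pos.mpr ⟨v, hv'⟩
      omega
    have hloops : ∑ i ∈ S, G s(i, i) = ∑ i ∈ B, G s(i, i) + ∑ i ∈ S \ B, G s(i, i) := by
      rw [add_comm, Finset.sum_sdiff hBS]
    have key : (q ^ (∑ j ∈ B, G s(v, j)) - 1) * cumulantOn u B =
        (q - 1) ^ (B.card - 1 + 1) * q ^ (∑ i ∈ B, G s(i, i)) *
          ∑ w ∈ B, q ^ (∑ j ∈ B.filter (fun j => j < w), G s(v, j)) *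
            (∑ k ∈ Finset.range (G s(v, w)), q ^ k) * treeSum G q B w := by
      rw [← sum_telescope q (fun j => G s(v, j)) B, Finset.sum_mul, Finset.mul_sum]
      refine Finset.sum_congr rfl fun w hw => ?_
      rw [ih _ hlt B rfl w hw]
      ring
    rw [key, hcard, hloops, i2]
    simp only [pow_add]
    ring
  · push Not at hS
    obtain rfl : S = {v} := Finset.eq_singleton_iff_unique_mem.mpr ⟨hv, hS⟩
    rw [cumulantOn_singleton u hu, treeSum_singleton]
    have := huv v ∅ (Finset.notMem_empty v)
    rw [insert_empty_eq] at this
    simp [this, hu]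

/-- The number of edges of `G` inside `B`. -/
def Multigraph.edgesIn {V : Type*} (G : Multigraph V) (B : Finset V) : ℕ := ∑ e ∈ B.sym2, G e

/-- The inversion polynomial as a cumulant. -/
theorem cumulant_pow_edgesIn (G : Multigraph V) (q : A) (v : V) :
    cumulant (fun B : Finset V => q ^ G.edgesIn B) =
      (q - 1) ^ (Fintype.card V - 1) * G.inversionPoly v q := by
  have := cumulantOn_eq_treeSum G q (u := fun B : Finset V => q ^ G.edgesIn B)
    (by simp [Multigraph.edgesIn]) (fun v S hv => by
      rw [← pow_add, ← pow_add]
      congr 1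
      rw [Multigraph.edgesIn, Multigraph.edgesIn, Finset.sym2_insert, Finset.sum_union,
        Finset.sum_image, Finset.sum_insert hv]
      · intro a ha b hb hab
        exact Sym2.congr_right.mp hab
      · rw [Finset.disjoint_left]
        intro e he he'
        obtain ⟨a, -, rfl⟩ := Finset.mem_image.mp he
        exact hv (Finset.mk_mem_sym2_iff.mp he').1) _ Finset.univ rfl v (Finset.mem_univ v)
  rw [inversionPoly_eq_treeSum, ← mul_assoc, ← Finset.card_univ]
  exact this

end InversionPolynomial

/-! ### Truncation to finitely many variables -/

section Truncation

variable {K : Type*} [CommRing K]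

/-- The terms of a power series that only involve the indeterminates in `A`. -/
def restrictSupport (A : Finset ℕ+) (f : MvPowerSeries ℕ+ K) : MvPowerSeries ℕ+ K :=
  fun m => if m.support ⊆ A then MvPowerSeries.coeff m f else 0

theorem coeff_restrictSupport (A : Finset ℕ+) (f : MvPowerSeries ℕ+ K) (m : ℕ+ →₀ ℕ) :
    MvPowerSeries.coeff m (restrictSupport A f) =
      if m.support ⊆ A then MvPowerSeries.coeff m f else 0 := rfl

/-- Setting the indeterminates outside `A` to `0`. -/
def killCompl (A : Finset ℕ+) : MvPowerSeries ℕ+ K →ₐ[K] MvPowerSeries ℕ+ K :=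
  AlgHom.ofLinearMap
    { toFun := restrictSupport A
      map_add' := fun f g => by
        ext m
        rw [map_add]
        simp only [coeff_restrictSupport]
        split_ifs <;> simp
      map_smul' := fun a f => by
        ext m
        rw [RingHom.id_apply, MvPowerSeries.coeff_smul]
        simp only [coeff_restrictSupport]
        split_ifs <;> simp }
    (by
      ext m
      change MvPowerSeries.coeff m (restrictSupport A 1) = _
      rw [coeff_restrictSupport, MvPowerSeries.coeff_one]
      split_ifs with h1 h2 h2 <;> simp_all)
    (fun f g => by
      ext m
      change MvPowerSeries.coeff m (restrictSupport A (f * g)) =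
        MvPowerSeries.coeff m (restrictSupport A f * restrictSupport A g)
      rw [MvPowerSeries.coeff_mul]
      simp only [coeff_restrictSupport]
      split_ifs with h
      · rw [MvPowerSeries.coeff_mul]
        refine Finset.sum_congr rfl fun p hp => ?_
        rw [Finset.HasAntidiagonal.mem_antidiagonal] at hp
        rw [if_pos, if_pos]
        · refine subset_trans (fun i hi => ?_) h
          rw [← hp, Finsupp.mem_support_iff, Finsupp.add_apply]
          rw [Finsupp.mem_support_iff] at hi
          omega
        · refine subset_trans (fun i hi => ?_) h
          rw [← hp, Finsupp.mem_support_iff, Finsupp.add_apply]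
          rw [Finsupp.mem_support_iff] at hi
          omega
      · symm
        refine Finset.sum_eq_zero fun p hp => ?_
        rw [Finset.HasAntidiagonal.mem_antidiagonal] at hp
        by_cases h1 : p.1.support ⊆ A
        · rw [if_neg (c := p.2.support ⊆ A), mul_zero]
          intro h2
          refine h ?_
          rw [← hp]
          exact Finsupp.support_add.trans (Finset.union_subset h1 h2)
        · rw [if_neg h1, zero_mul])

theorem coeff_killCompl (A : Finset ℕ+) (f : MvPowerSeries ℕ+ K) (m : ℕ+ →₀ ℕ) :
    MvPowerSeries.coeff m (killCompl A f) =
      if m.support ⊆ A then MvPowerSeries.coeff m f else 0 := rfl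

/-- A coefficient is already visible in the variables of its own monomial. Identities of series
thereby reduce to identities of finite sums. -/
theorem ext_killCompl {f g : MvPowerSeries ℕ+ K} (h : ∀ A, killCompl A f = killCompl A g) :
    f = g := by
  ext m
  have := congrArg (MvPowerSeries.coeff m) (h m.support)
  simpa [coeff_killCompl] using this

theorem killCompl_X (A : Finset ℕ+) (i : ℕ+) :
    killCompl A (MvPowerSeries.X i : MvPowerSeries ℕ+ K) =
      if i ∈ A then MvPowerSeries.X i else 0 := by
  ext m
  rw [coeff_killCompl, MvPowerSeries.coeff_X]
  by_cases hm : m = Finsupp.single i 1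
  · subst hm
    rw [Finsupp.support_single _ one_ne_zero]
    by_cases hi : i ∈ A <;> simp [hi]
  · by_cases hi : i ∈ A <;> simp [hm, hi, MvPowerSeries.coeff_X]

theorem coeff_powerSum (k : ℕ) (m : ℕ+ →₀ ℕ) : MvPowerSeries.coeff m (powerSum K k) =
    if ∃ i : ℕ+, m = Finsupp.single i k then 1 else 0 := rfl

theorem killCompl_powerSum (A : Finset ℕ+) (k : ℕ+) :
    killCompl A (powerSum K k) = ∑ i ∈ A, MvPowerSeries.X i ^ (k : ℕ) := by
  ext m
  rw [coeff_killCompl, map_sum, coeff_powerSum]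
  simp only [MvPowerSeries.coeff_X_pow]
  by_cases h : ∃ i : ℕ+, m = Finsupp.single i (k : ℕ)
  · obtain ⟨i, rfl⟩ := h
    rw [Finsupp.support_single _ k.ne_zero]
    simp only [Finset.singleton_subset_iff]
    have : ∀ j : ℕ+, Finsupp.single i (k : ℕ) = Finsupp.single j (k : ℕ) ↔ i = j := fun j =>
      Finsupp.single_left_inj k.ne_zero
    simp [this]
  · rw [if_neg h, ite_self, Finset.sum_eq_zero]
    intro i _
    rw [if_neg fun hi => h ⟨i, hi⟩]

theorem killCompl_fillingSeries {S : Type*} {μ : YoungDiagram} (abs : S → ℕ+)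
    (F : Set (Filling μ S)) (w : Filling μ S → FieldQT) (A : Finset ℕ+) (T : Finset S)
    (hT : ∀ a, a ∈ T ↔ abs a ∈ A) :
    killCompl A (fillingSeries abs F w) =
      ∑ σ ∈ (Fintype.piFinset fun _ : Box μ => T).filter (fun σ => σ ∈ F),
        MvPowerSeries.C (w σ) * ∏ c, MvPowerSeries.X (abs (σ c)) := by
  ext m
  have hmon : ∀ σ : Filling μ S, (∏ c, MvPowerSeries.X (abs (σ c)) : MvPowerSeries ℕ+ FieldQT) =
      MvPowerSeries.monomial (weight abs σ) 1 := by
    intro σ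
    rw [weight]
    simp only [MvPowerSeries.X]
    rw [MvPowerSeries.prod_monomial, Finset.prod_const_one]
  rw [coeff_killCompl, map_sum]
  simp only [hmon, MvPowerSeries.coeff_C_mul, MvPowerSeries.coeff_monomial]
  have hsupp : ∀ σ : Filling μ S, (weight abs σ).support ⊆ A ↔ ∀ c, σ c ∈ T := by
    intro σ
    have : ∀ i, i ∈ (weight abs σ).support ↔ ∃ c, abs (σ c) = i := by
      intro i
      rw [Finsupp.mem_support_iff, weight, Finsupp.finsetSum_apply, Ne, Finset.sum_eq_zero_iff]
      simp [Finsupp.single_apply]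
    constructor
    · intro h c
      rw [hT]
      exact h ((this _).mpr ⟨c, rfl⟩)
    · intro h i hi
      obtain ⟨c, rfl⟩ := (this i).mp hi
      exact (hT _).mp (h c)
  split_ifs with h
  · change ∑ᶠ σ ∈ {σ | σ ∈ F ∧ weight abs σ = m}, w σ = _
    rw [finsum_mem_eq_sum_of_inter_support_eq (t := ((Fintype.piFinset fun _ : Box μ => T).filter
      (fun σ => σ ∈ F)).filter fun σ => weight abs σ = m), Finset.sum_filter]
    · refine Finset.sum_congr rfl fun σ _ => ?_
      simp [eq_comm]
    · congr 1
      ext σ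
      simp only [Set.mem_ofPred_eq, Finset.coe_filter, Finset.mem_filter, Fintype.mem_piFinset]
      constructor
      · rintro ⟨h1, rfl⟩
        exact ⟨⟨(hsupp σ).mp h, h1⟩, rfl⟩
      · rintro ⟨⟨-, h1⟩, h2⟩
        exact ⟨h1, h2⟩
  · symm
    refine Finset.sum_eq_zero fun σ hσ => ?_
    rw [if_neg, mul_zero]
    rintro rfl
    rw [Finset.mem_filter, Fintype.mem_piFinset] at hσ
    exact h ((hsupp σ).mpr hσ.1)

theorem killCompl_aeval_powerSum (A : Finset ℕ+) (P : MvPolynomial ℕ+ K) :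
    killCompl A (MvPolynomial.aeval (fun k : ℕ+ => powerSum K (k : ℕ)) P) =
      ((MvPolynomial.aeval (fun k : ℕ+ => ∑ i ∈ A, (MvPolynomial.X i : MvPolynomial ℕ+ K) ^ (k : ℕ)) P
        : MvPolynomial ℕ+ K) : MvPowerSeries ℕ+ K) := by
  have hcoe : ∀ Q : MvPolynomial ℕ+ K,
      (Q : MvPowerSeries ℕ+ K) = MvPolynomial.coeToMvPowerSeries.algHom K Q := fun Q => by
    simp [MvPolynomial.coeToMvPowerSeries.algHom_apply]
  rw [hcoe]
  simp only [← AlgHom.comp_apply]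
  revert P
  rw [← DFunLike.ext_iff]
  ext1 k
  simp [killCompl_powerSum, MvPolynomial.coeToMvPowerSeries.algHom_apply]

/-- A power-sum expansion holds in every algebra, for finitely many variables. -/
theorem IsPowerSumExpansion.aeval_sum_pow {f : MvPowerSeries ℕ+ FieldQT}
    {P : MvPolynomial ℕ+ FieldQT} (h : IsPowerSumExpansion f P) {A : Finset ℕ+}
    {F : MvPolynomial ℕ+ FieldQT} (hF : killCompl A f = (F : MvPowerSeries ℕ+ FieldQT))
    {R : Type*} [CommRing R] [Algebra FieldQT R] (x : ℕ+ → R) :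
    MvPolynomial.aeval (fun k : ℕ+ => ∑ i ∈ A, x i ^ (k : ℕ)) P = MvPolynomial.aeval x F := by
  rw [← h, killCompl_aeval_powerSum, MvPolynomial.coe_inj] at hF
  rw [← hF, ← AlgHom.comp_apply]
  congr 1
  ext1 k
  simp

end Truncation

/-! ### Algebraic independence of the power sums -/

section Uniqueness

variable {K : Type*} [Field K] [CharZero K]

/-- The exponents start at `1`, so the matrix of the system is a transposed Vandermonde matrix with
nodes `1, …, n` times the diagonal matrix of the nodes. In characteristic zero these are distinct
and nonzero. -/
theorem exists_sum_pow_eq (n : ℕ) (s : ℕ+ → K) :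
    ∃ m : Fin n → K, ∀ k : ℕ+, (k : ℕ) ≤ n → ∑ j : Fin n, ((j : K) + 1) ^ (k : ℕ) * m j = s k := by
  set a : Fin n → K := fun j => (j : K) + 1 with ha
  have ha0 : ∀ j, a j ≠ 0 := fun j => Nat.cast_add_one_ne_zero _
  have hinj : Function.Injective a := by
    intro i j hij
    simp only [ha, add_left_inj, Nat.cast_inj] at hij
    exact Fin.ext hij
  set M : Matrix (Fin n) (Fin n) K := (Matrix.vandermonde a).transpose * Matrix.diagonal a with hM
  have hdet : IsUnit M.det := by
    rw [hM, Matrix.det_mul, Matrix.det_transpose, Matrix.det_diagonal, isUnit_iff_ne_zero]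
    exact mul_ne_zero (Matrix.det_vandermonde_ne_zero_iff.mpr hinj)
      (Finset.prod_ne_zero_iff.mpr fun j _ => ha0 j)
  refine ⟨M⁻¹.mulVec fun i => s i.1.succPNat, fun k hk => ?_⟩
  have h1 : M.mulVec (M⁻¹.mulVec fun i => s i.1.succPNat) = fun i => s i.1.succPNat := by
    rw [Matrix.mulVec_mulVec, Matrix.mul_nonsing_inv _ hdet, Matrix.one_mulVec]
  have hk0 := k.pos
  have h2 := congrFun h1 ⟨(k : ℕ) - 1, by omega⟩
  have h3 : ((k : ℕ) - 1).succPNat = k := by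
    apply PNat.eq
    rw [Nat.succPNat_coe]
    omega
  simp only [h3] at h2
  rw [← h2, Matrix.mulVec, dotProduct]
  refine Finset.sum_congr rfl fun j _ => ?_
  rw [hM, Matrix.mul_diagonal, Matrix.transpose_apply, Matrix.vandermonde_apply, ← pow_succ,
    Nat.sub_add_cancel hk0]

/-- `P` vanishes at the power sums of every finite family. Families with `m_j` copies of the value
`j + 1` give the points `∑_j (j + 1)^k m_j`; the vanishing is polynomial in the `m_j`, so it extends
from natural numbers to all scalars. By `exists_sum_pow_eq` the finitely many variables of `P` then
take arbitrary values. -/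
theorem aeval_powerSum_injective {P : MvPolynomial ℕ+ K}
    (h : MvPolynomial.aeval (fun k : ℕ+ => powerSum K (k : ℕ)) P = 0) : P = 0 := by
  have h1 : ∀ (A : Finset ℕ+) (x : ℕ+ → K),
      MvPolynomial.eval (fun k : ℕ+ => ∑ i ∈ A, x i ^ (k : ℕ)) P = 0 := by
    intro A x
    have h2 := killCompl_aeval_powerSum A P
    rw [h, map_zero, ← MvPolynomial.coe_zero, MvPolynomial.coe_inj] at h2
    have h3 := congrArg (MvPolynomial.aeval x) h2
    rw [map_zero, ← AlgHom.comp_apply] at h3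
    rw [← MvPolynomial.coe_aeval_eq_eval]
    refine Eq.trans ?_ h3.symm
    change MvPolynomial.aeval _ P = _
    congr 1
    ext1 k
    simp
  obtain ⟨n, hn⟩ : ∃ n : ℕ, ∀ k ∈ P.vars, (k : ℕ) ≤ n :=
    ⟨P.vars.sup fun k => (k : ℕ), fun k hk => Finset.le_sup (f := fun k : ℕ+ => (k : ℕ)) hk⟩
  set Q : MvPolynomial (Fin n) K := MvPolynomial.aeval
    (fun k : ℕ+ => ∑ j : Fin n, MvPolynomial.C (((j : K) + 1) ^ (k : ℕ)) * MvPolynomial.X j) P with hQ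
  have hQe : ∀ m : Fin n → K, MvPolynomial.eval m Q =
      MvPolynomial.eval (fun k : ℕ+ => ∑ j : Fin n, ((j : K) + 1) ^ (k : ℕ) * m j) P := by
    intro m
    rw [hQ, ← MvPolynomial.coe_aeval_eq_eval, ← MvPolynomial.coe_aeval_eq_eval]
    change MvPolynomial.aeval m _ = MvPolynomial.aeval _ P
    rw [← AlgHom.comp_apply]
    congr 1
    ext1 k
    simp
  have hQ0 : Q = 0 := by
    refine MvPolynomial.funext_set (fun _ => Set.range ((↑) : ℕ → K))
      (fun _ => Set.infinite_range_of_injective Nat.cast_injective) fun m hm => ?_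
    have hm' : ∀ j, ∃ N : ℕ, (N : K) = m j := fun j => hm j (Set.mem_univ j)
    choose N hN using hm'
    -- Distinct indeterminates are reserved for the `N j` copies of each value `j + 1`.
    obtain ⟨e⟩ : Nonempty ((Σ j : Fin n, Fin (N j)) ↪ ℕ+) :=
      ⟨(Fintype.equivFin _).toEmbedding.trans (Fin.valEmbedding.trans ⟨Nat.succPNat, Nat.succPNat_injective⟩)⟩
    rw [hQe, map_zero, ← h1 (Finset.univ.map e)
      (Function.extend e (fun p => ((p.1 : Fin n) : K) + 1) 0)]
    congr 2
    funext k
    rw [Finset.sum_map, Fintype.sum_sigma]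
    refine Finset.sum_congr rfl fun j _ => ?_
    simp [e.injective.extend_apply, ← hN, mul_comm]
  refine MvPolynomial.funext fun s => ?_
  obtain ⟨m, hm⟩ := exists_sum_pow_eq n s
  rw [map_zero, ← map_zero (MvPolynomial.eval m), ← hQ0, hQe]
  refine MvPolynomial.eval₂Hom_congr' rfl (fun k hk _ => ?_) rfl
  exact (hm k (hn k hk)).symm

theorem IsPowerSumExpansion.unique {f : MvPowerSeries ℕ+ FieldQT} {P Q : MvPolynomial ℕ+ FieldQT}
    (hP : IsPowerSumExpansion f P) (hQ : IsPowerSumExpansion f Q) : P = Q := by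
  rw [← sub_eq_zero]
  refine aeval_powerSum_injective ?_
  rw [map_sub, sub_eq_zero]
  exact hP.trans hQ.symm

theorem IsPowerSumExpansion.plethysm_eq {f : MvPowerSeries ℕ+ FieldQT}
    {P : MvPolynomial ℕ+ FieldQT} (hP : IsPowerSumExpansion f P) (A : MvPowerSeries ℕ+ PolyQT) :
    plethysm f A = MvPolynomial.aeval (fun k : ℕ+ => powerSumAt k A) P := by
  have h : ∃ P, IsPowerSumExpansion f P := ⟨P, hP⟩
  rw [plethysm, dif_pos h, h.choose_spec.unique hP]

end Uniqueness

/-! ### Power-sum expansions of symmetric filling series -/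

section Existence

/-- `f` has an expansion in power sums. -/
def HasPowerSumExpansion (f : MvPowerSeries ℕ+ FieldQT) : Prop := ∃ P, IsPowerSumExpansion f P

theorem HasPowerSumExpansion.C_mul {f : MvPowerSeries ℕ+ FieldQT} (h : HasPowerSumExpansion f)
    (a : FieldQT) : HasPowerSumExpansion (MvPowerSeries.C a * f) := by
  obtain ⟨P, rfl⟩ := h
  refine ⟨MvPolynomial.C a * P, ?_⟩
  rw [IsPowerSumExpansion, map_mul, MvPolynomial.aeval_C, MvPowerSeries.algebraMap_apply]
  rfl

theorem HasPowerSumExpansion.sum {κ : Type*} (s : Finset κ) {f : κ → MvPowerSeries ℕ+ FieldQT}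
    (h : ∀ i ∈ s, HasPowerSumExpansion (f i)) : HasPowerSumExpansion (∑ i ∈ s, f i) := by
  choose! P hP using h
  exact ⟨∑ i ∈ s, P i, by rw [IsPowerSumExpansion, map_sum]; exact Finset.sum_congr rfl hP⟩

theorem HasPowerSumExpansion.prod {κ : Type*} (s : Finset κ) {f : κ → MvPowerSeries ℕ+ FieldQT}
    (h : ∀ i ∈ s, HasPowerSumExpansion (f i)) : HasPowerSumExpansion (∏ i ∈ s, f i) := by
  choose! P hP using h
  exact ⟨∏ i ∈ s, P i, by rw [IsPowerSumExpansion, map_prod]; exact Finset.prod_congr rfl hP⟩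

theorem hasPowerSumExpansion_powerSum (k : ℕ+) :
    HasPowerSumExpansion (powerSum FieldQT (k : ℕ)) := ⟨MvPolynomial.X k, by
  rw [IsPowerSumExpansion, MvPolynomial.aeval_X]⟩

variable {μ : YoungDiagram}

theorem killCompl_fillingSeries_id (w : Filling μ ℕ+ → FieldQT) (A : Finset ℕ+) :
    killCompl A (fillingSeries id Set.univ w) = ∑ σ ∈ Fintype.piFinset fun _ : Box μ => A,
      MvPowerSeries.C (w σ) * ∏ c, MvPowerSeries.X (σ c) := by
  rw [killCompl_fillingSeries id Set.univ w A A fun _ => Iff.rfl]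
  simp

/-- A filling that is constant on the classes of `s` is a free choice of one letter per class, so
the series is the product of the power sums `p_k`, with `k` running over the sizes of the classes.
-/
theorem hasPowerSumExpansion_of_le_ker (s : Setoid (Box μ)) :
    HasPowerSumExpansion (fillingSeries id Set.univ
      fun σ : Filling μ ℕ+ => if s ≤ Setoid.ker σ then 1 else 0) := by
  set k : Quotient s → ℕ+ := fun x => ⟨(Finset.univ.filter fun c => Quotient.mk s c = x).card, by
    obtain ⟨c, hc⟩ := Quotient.exists_rep x
    exact Finset.card_pos.mpr ⟨c, by simp [hc]⟩⟩ with hk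
  have : (fillingSeries id Set.univ
      fun σ : Filling μ ℕ+ => if s ≤ Setoid.ker σ then 1 else 0) =
        ∏ x : Quotient s, powerSum FieldQT (k x : ℕ) := by
    refine ext_killCompl fun A => ?_
    rw [killCompl_fillingSeries_id, map_prod]
    simp only [killCompl_powerSum]
    rw [Finset.prod_univ_sum]
    have e : ∀ σ : Filling μ ℕ+, MvPowerSeries.C (if s ≤ Setoid.ker σ then (1 : FieldQT) else 0) *
        ∏ c, (MvPowerSeries.X (σ c) : MvPowerSeries ℕ+ FieldQT) =
        if s ≤ Setoid.ker σ then ∏ c, MvPowerSeries.X (σ c) else 0 := by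
      intro σ
      split_ifs <;> simp
    simp only [e]
    rw [← Finset.sum_filter]
    symm
    refine Finset.sum_bij (fun g _ => fun c => g (Quotient.mk s c)) ?_ ?_ ?_ ?_
    · intro g hg
      rw [Fintype.mem_piFinset] at hg
      rw [Finset.mem_filter, Fintype.mem_piFinset]
      refine ⟨fun c => hg _, fun {x y} hxy => ?_⟩
      rw [Setoid.ker_def, Quotient.sound hxy]
    · intro g _ g' _ h
      funext x
      obtain ⟨c, rfl⟩ := Quotient.exists_rep x
      exact congrFun h c
    · intro σ hσ
      rw [Finset.mem_filter, Fintype.mem_piFinset] at hσ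
      refine ⟨Quotient.lift σ fun a b hab => hσ.2 hab, ?_, ?_⟩
      · rw [Fintype.mem_piFinset]
        intro x
        obtain ⟨c, rfl⟩ := Quotient.exists_rep x
        exact hσ.1 c
      · rfl
    · intro g _
      rw [← Finset.prod_fiberwise Finset.univ (fun c => Quotient.mk s c)]
      refine Finset.prod_congr rfl fun x _ => ?_
      rw [Finset.prod_congr rfl (g := fun _ => MvPowerSeries.X (g x)) fun c hc => by
        rw [← (Finset.mem_filter.mp hc).2], Finset.prod_const]
      rfl
  rw [this]
  exact HasPowerSumExpansion.prod _ fun x _ => hasPowerSumExpansion_powerSum _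

/-- Möbius inversion on a finite poset, with `c` built by well-founded recursion. It writes a
function of the kernel of a filling in terms of the indicators of `s ≤ Setoid.ker σ`. -/
theorem exists_sum_le_eq {P : Type*} [PartialOrder P] [Fintype P] {A : Type*} [AddCommGroup A]
    (b : P → A) : ∃ c : P → A, ∀ s, b s = ∑ s', if s' ≤ s then c s' else 0 := by
  have hwf : WellFounded ((· < ·) : P → P → Prop) := wellFounded_lt
  set c : P → A := hwf.fix fun s ih => b s - ∑ s' : {s' // s' < s}, ih s'.1 s'.2 with hc
  refine ⟨c, fun s => ?_⟩
  have h1 : c s = b s - ∑ s' : {s' // s' < s}, c s' := by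
    rw [hc, hwf.fix_eq]
  rw [← Finset.sum_filter, ← sub_eq_zero, ← Finset.add_sum_erase _ _ (a := s) (by simp), h1,
    Finset.sum_subtype (p := fun s' => s' < s) ((Finset.univ.filter fun s' => s' ≤ s).erase s)
      (fun x => by simp [lt_iff_le_and_ne, and_comm]) c]
  abel

theorem hasPowerSumExpansion_of_ker (b : Setoid (Box μ) → FieldQT) :
    HasPowerSumExpansion (fillingSeries id Set.univ
      fun σ : Filling μ ℕ+ => b (Setoid.ker σ)) := by
  have : Finite (Setoid (Box μ)) :=
    Finite.of_injective (fun s : Setoid (Box μ) => fun a b => s a b) fun s t h =>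
      Setoid.ext fun a b => (congrFun (congrFun h a) b).to_iff
  have : Fintype (Setoid (Box μ)) := Fintype.ofFinite _
  obtain ⟨c, hc⟩ := exists_sum_le_eq b
  have : (fillingSeries id Set.univ fun σ : Filling μ ℕ+ => b (Setoid.ker σ)) =
      ∑ s, MvPowerSeries.C (c s) * fillingSeries id Set.univ
        fun σ : Filling μ ℕ+ => if s ≤ Setoid.ker σ then 1 else 0 := by
    refine ext_killCompl fun A => ?_
    rw [killCompl_fillingSeries_id, map_sum]
    have hC : ∀ a, killCompl A (MvPowerSeries.C a : MvPowerSeries ℕ+ FieldQT) = MvPowerSeries.C a :=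
      fun a => (killCompl A).commutes a
    simp only [map_mul, hC, killCompl_fillingSeries_id, Finset.mul_sum]
    rw [Finset.sum_comm]
    refine Finset.sum_congr rfl fun σ _ => ?_
    rw [hc, map_sum, Finset.sum_mul]
    refine Finset.sum_congr rfl fun s _ => ?_
    split_ifs <;> simp
  rw [this]
  exact HasPowerSumExpansion.sum _ fun s _ => (hasPowerSumExpansion_of_le_ker s).C_mul _

theorem weight_comp_perm (π : Equiv.Perm ℕ+) (σ : Filling μ ℕ+) :
    weight id (fun c => π (σ c)) = (weight id σ).mapDomain π := by
  rw [weight, weight, Finsupp.mapDomain_finsetSum]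
  refine Finset.sum_congr rfl fun c _ => ?_
  rw [Finsupp.mapDomain_single]; rfl

/-- Fillings with equal kernels differ by an injective relabelling. The transposition of `σ u` and
`τ u` repairs the box `u` without spoiling a box where the fillings already agree, so the number of
disagreements drops. -/
theorem eq_of_ker_eq {A : Type*} {f : (ℕ+ →₀ ℕ) → A}
    (hf : ∀ i j m, f (m.mapDomain (Equiv.swap i j)) = f m) :
    ∀ (N : ℕ) (σ τ : Filling μ ℕ+), (Finset.univ.filter fun c => σ c ≠ τ c).card = N →
      Setoid.ker σ = Setoid.ker τ → f (weight id σ) = f (weight id τ) := by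
  intro N
  induction N using Nat.strong_induction_on with
  | _ N ih =>
  rintro σ τ rfl hker
  have hk : ∀ x y, σ x = σ y ↔ τ x = τ y := fun x y => by
    rw [← Setoid.ker_def, ← Setoid.ker_def, hker]
  by_cases h : ∃ u, σ u ≠ τ u
  · obtain ⟨u, hu⟩ := h
    set ρ : Filling μ ℕ+ := fun c => Equiv.swap (σ u) (τ u) (σ c) with hρ
    have h1 : f (weight id ρ) = f (weight id σ) := by
      rw [hρ, weight_comp_perm, hf]
    rw [← h1]
    refine ih _ (Finset.card_lt_card ?_) ρ τ rfl ?_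
    · refine (Finset.ssubset_iff_of_subset fun v hv => ?_).mpr ⟨u, by simp [hu], by simp [hρ]⟩
      rw [Finset.mem_filter] at hv ⊢
      refine ⟨Finset.mem_univ _, fun hvu => hv.2 ?_⟩
      have e1 : σ v ≠ σ u := by
        intro h
        have := (hk v u).mp h
        exact hu (by rw [← h, hvu, this])
      have e2 : σ v ≠ τ u := by
        intro h
        exact e1 ((hk v u).mpr (hvu.symm.trans h))
      simp only [hρ]
      rw [Equiv.swap_apply_of_ne_of_ne e1 e2, hvu]
    · rw [← hker]
      ext x y
      rw [Setoid.ker_def, Setoid.ker_def]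
      exact (Equiv.swap (σ u) (τ u)).injective.eq_iff
  · push Not at h
    rw [funext h]

/-- A symmetric series of fillings has a power-sum expansion. -/
theorem hasPowerSumExpansion_of_symmetric (w : Filling μ ℕ+ → FieldQT)
    (hsym : ∀ i j m, MvPowerSeries.coeff (m.mapDomain (Equiv.swap i j))
      (fillingSeries id Set.univ w) = MvPowerSeries.coeff m (fillingSeries id Set.univ w)) :
    HasPowerSumExpansion (fillingSeries id Set.univ w) := by
  set f : (ℕ+ →₀ ℕ) → FieldQT := fun m => MvPowerSeries.coeff m (fillingSeries id Set.univ w)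
    with hf
  set N : (ℕ+ →₀ ℕ) → ℕ := fun m => {σ : Filling μ ℕ+ | weight id σ = m}.ncard with hN
  have hNsym : ∀ i j m, N (m.mapDomain (Equiv.swap i j)) = N m := by
    intro i j m
    have : {σ : Filling μ ℕ+ | weight id σ = m.mapDomain (Equiv.swap i j)} =
        (fun σ : Filling μ ℕ+ => fun c => Equiv.swap i j (σ c)) '' {σ | weight id σ = m} := by
      ext σ
      simp only [Set.mem_image, Set.mem_ofPred_eq]
      constructor
      · intro h
        refine ⟨fun c => Equiv.swap i j (σ c), ?_, by simp⟩
        rw [weight_comp_perm, h, ← Finsupp.mapDomain_comp]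
        convert Finsupp.mapDomain_id
        funext x; simp
      · rintro ⟨τ, rfl, rfl⟩
        rw [weight_comp_perm]
    simp only [hN]
    rw [this, Set.ncard_image_of_injective]
    intro σ τ h
    funext c
    exact (Equiv.swap i j).injective (congrFun h c)
  -- The weight `w` need not depend on the kernel alone. Its average over the fillings of a given
  -- monomial does, by symmetry, and averaging does not change the series.
  set b : Setoid (Box μ) → FieldQT := fun s => if h : ∃ σ : Filling μ ℕ+, Setoid.ker σ = s then
    f (weight id h.choose) / N (weight id h.choose) else 0 with hb
  have hbσ : ∀ σ : Filling μ ℕ+, b (Setoid.ker σ) = f (weight id σ) / N (weight id σ) := by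
    intro σ
    have h : ∃ τ : Filling μ ℕ+, Setoid.ker τ = Setoid.ker σ := ⟨σ, rfl⟩
    simp only [hb]
    rw [dif_pos h, eq_of_ker_eq (f := f) hsym _ h.choose σ rfl h.choose_spec,
      eq_of_ker_eq (f := N) hNsym _ h.choose σ rfl h.choose_spec]
  have key : fillingSeries id Set.univ w =
      fillingSeries id Set.univ fun σ : Filling μ ℕ+ => b (Setoid.ker σ) := by
    ext m
    have hfin : {σ : Filling μ ℕ+ | weight id σ = m}.Finite :=
      finite_weight_eq id (fun n => by simp) m
    have hset : {σ : Filling μ ℕ+ | σ ∈ Set.univ ∧ weight id σ = m} = {σ | weight id σ = m} := by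
      simp
    change f m = ∑ᶠ σ ∈ {σ : Filling μ ℕ+ | σ ∈ Set.univ ∧ weight id σ = m}, b (Setoid.ker σ)
    rw [hset, finsum_mem_eq_finite_toFinset_sum _ hfin]
    rw [Finset.sum_congr rfl (g := fun _ => f m / N m) fun σ hσ => by
      rw [hbσ, (hfin.mem_toFinset.mp hσ : weight id σ = m)], Finset.sum_const,
      ← Set.ncard_eq_toFinset_card _ hfin, nsmul_eq_mul]
    by_cases h0 : N m = 0
    · have he : {σ : Filling μ ℕ+ | weight id σ = m} = ∅ := (Set.ncard_eq_zero hfin).mp h0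
      have : f m = 0 := by
        change ∑ᶠ σ ∈ {σ : Filling μ ℕ+ | σ ∈ Set.univ ∧ weight id σ = m}, w σ = 0
        rw [hset, he, finsum_mem_empty]
      rw [this, zero_div, mul_zero]
    · change f m = (N m : FieldQT) * (f m / N m)
      rw [mul_div_cancel₀]
      exact_mod_cast h0
  rw [key]
  exact hasPowerSumExpansion_of_ker b

theorem killCompl_inversionWeight (c : Box μ → Box μ → FieldQT) (A : Finset ℕ+) :
    killCompl A (fillingSeries id Set.univ
      fun σ : Filling μ ℕ+ => inversionWeight (fun _ => False) c σ) =
    ((letterSum (fun _ => False) (fun u v => MvPolynomial.C (c u v)) A MvPolynomial.X :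
      MvPolynomial ℕ+ FieldQT) : MvPowerSeries ℕ+ FieldQT) := by
  rw [killCompl_fillingSeries_id, ← MvPolynomial.coeToMvPowerSeries.ringHom_apply, letterSum_map,
    letterSum]
  refine Finset.sum_congr (by ext; simp only [Fintype.mem_piFinset]) fun σ _ => ?_
  congr 1
  · simp only [inversionWeight, map_prod]
    refine Finset.prod_congr rfl fun u _ => Finset.prod_congr rfl fun v _ => ?_
    split_ifs <;> simp
  · simp

/-- The series of all fillings with a weight given by pairs of boxes has a power-sum expansion if the
two-letter sums are symmetric. -/
theorem hasPowerSumExpansion_inversionWeight {c : Box μ → Box μ → FieldQT}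
    (hc : ∀ (A : Finset (Box μ)) (a b : MvPolynomial ℕ+ FieldQT),
      twoLetterSum (fun u v => MvPolynomial.C (c u v)) A a b =
        twoLetterSum (fun u v => MvPolynomial.C (c u v)) A b a) :
    HasPowerSumExpansion
      (fillingSeries id Set.univ fun σ : Filling μ ℕ+ => inversionWeight (fun _ => False) c σ) := by
  refine hasPowerSumExpansion_of_symmetric _ fun i j m => ?_
  wlog hij : i < j generalizing i j
  · rcases (not_lt.mp hij).eq_or_lt with rfl | h
    · rw [Equiv.swap_self, Equiv.coe_refl, Finsupp.mapDomain_id]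
    · rw [Equiv.swap_comm]
      exact this j i h
  -- Large enough to see both coefficients and to contain the two letters that are exchanged.
  set A : Finset ℕ+ := m.support ∪ (m.mapDomain (Equiv.swap i j)).support ∪ {i, j} with hA
  have hcoeff : ∀ m' : ℕ+ →₀ ℕ, m'.support ⊆ A → MvPowerSeries.coeff m' (fillingSeries id Set.univ
      fun σ : Filling μ ℕ+ => inversionWeight (fun _ => False) c σ) = MvPolynomial.coeff m'
        (letterSum (fun _ => False) (fun u v => MvPolynomial.C (c u v)) A MvPolynomial.X) := by
    intro m' hm'
    rw [← MvPolynomial.coeff_coe, ← killCompl_inversionWeight, coeff_killCompl, if_pos hm']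
  rw [hcoeff, hcoeff]
  · have h1 := letterSum_swap (neg := fun _ => False) hc (T := A) _ i j hij rfl (by simp [hA])
      (by simp [hA]) (fun _ _ _ _ => not_false) MvPolynomial.X
    have h2 := letterSum_map (MvPolynomial.rename (Equiv.swap i j)).toRingHom (fun _ => False)
      (fun u v => MvPolynomial.C (c u v)) A (MvPolynomial.X (R := FieldQT))
    have h3 : letterSum (fun _ => False) (fun u v => (MvPolynomial.rename (Equiv.swap i j)).toRingHom
        (MvPolynomial.C (c u v))) A (fun s => (MvPolynomial.rename (Equiv.swap i j)).toRingHom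
        (MvPolynomial.X s)) = letterSum (fun _ => False) (fun u v => MvPolynomial.C (c u v)) A
          (MvPolynomial.X (R := FieldQT)) := by
      rw [← h1]
      congr 1
      · funext u v
        simp
      · funext s
        simp
    rw [h3] at h2
    conv_lhs => rw [← h2]
    exact MvPolynomial.coeff_rename_mapDomain _ (Equiv.injective _) _ _
  · exact fun x hx => by simp [hA, Finsupp.mem_support_iff.mp hx]
  · exact fun x hx => by
      rw [hA, Finset.mem_union, Finset.mem_union]; exact Or.inl (Or.inr hx)

end Existence

/-! ### Order and signs in the super alphabet -/

namespace SuperLetter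

theorem pos_lt_pos {i j : ℕ+} : pos i < pos j ↔ i < j := Sum.Lex.inl_lt_inl_iff

theorem bar_lt_bar {i j : ℕ+} : bar i < bar j ↔ j < i := Sum.Lex.inr_lt_inr_iff

theorem pos_lt_bar (i j : ℕ+) : pos i < bar j := Sum.Lex.inl_lt_inr _ _

theorem pos_injective : Function.Injective pos := fun i j h => by
  simpa [pos] using h

theorem bar_injective : Function.Injective bar := fun i j h => by
  simpa [bar] using h

theorem pos_ne_bar (i j : ℕ+) : pos i ≠ bar j := (pos_lt_bar i j).ne

theorem eq_pos_or_eq_bar (a : SuperLetter) : (∃ i, a = pos i) ∨ ∃ i, a = bar i := by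
  rcases a with a | a
  exacts [Or.inl ⟨a, rfl⟩, Or.inr ⟨a, rfl⟩]

theorem not_isNeg_pos (i : ℕ+) : ¬ (pos i).IsNeg := fun ⟨_, h⟩ => pos_ne_bar _ _ h

theorem isNeg_bar (i : ℕ+) : (bar i).IsNeg := ⟨i, rfl⟩

theorem abs_pos (i : ℕ+) : (pos i).abs = i := rfl

theorem abs_bar (i : ℕ+) : (bar i).abs = i := rfl

end SuperLetter

open SuperLetter

/-! ### Superization: super fillings evaluate `f[X - Y]` -/

section Superization

/-- The positive letters indexed by `I` and the negative letters indexed by `J`. -/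
def superAlphabet (I J : Finset ℕ+) : Finset SuperLetter := I.image pos ∪ J.image bar

theorem pos_mem_superAlphabet {I J : Finset ℕ+} {i : ℕ+} : pos i ∈ superAlphabet I J ↔ i ∈ I := by
  simp [superAlphabet, pos_injective.eq_iff, (pos_ne_bar _ _).symm]

theorem bar_mem_superAlphabet {I J : Finset ℕ+} {j : ℕ+} : bar j ∈ superAlphabet I J ↔ j ∈ J := by
  simp [superAlphabet, bar_injective.eq_iff, pos_ne_bar]

/-- The weight of the letter `i` is `x i`, and that of `ī` is `- y i`. -/
def superWeight {R : Type*} [Neg R] (x y : ℕ+ → R) (a : SuperLetter) : R :=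
  if a.IsNeg then - y a.abs else x a.abs

theorem superWeight_pos {R : Type*} [Neg R] (x y : ℕ+ → R) (i : ℕ+) :
    superWeight x y (pos i) = x i := if_neg (not_isNeg_pos i)

theorem superWeight_bar {R : Type*} [Neg R] (x y : ℕ+ → R) (i : ℕ+) :
    superWeight x y (bar i) = - y i := if_pos (isNeg_bar i)

theorem map_windowWeight {ι R R' : Type*} [CommRing R] [CommRing R'] (f : R →+* R') (pos : ι → ℤ)
    (n : ℤ) (q : R) (d : ι → R) (u v : ι) :
    f (windowWeight pos n q d u v) = windowWeight pos n (f q) (fun u => f (d u)) u v := by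
  unfold windowWeight
  split_ifs <;> simp

theorem letterSum_superAlphabet_empty {ι R : Type*} [Fintype ι] [CommRing R] (c : ι → ι → R)
    (I : Finset ℕ+) (z : SuperLetter → R) :
    letterSum IsNeg c (superAlphabet I ∅) z = letterSum (fun _ => False) c I (fun i => z (pos i)) := by
  symm
  refine Finset.sum_bij (fun σ _ => fun u => pos (σ u)) ?_ ?_ ?_ ?_
  · intro σ hσ
    rw [Fintype.mem_piFinset] at hσ ⊢
    exact fun u => pos_mem_superAlphabet.mpr (hσ u)
  · intro σ _ τ _ h
    funext u
    exact pos_injective (congrFun h u)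
  · intro σ hσ
    rw [Fintype.mem_piFinset] at hσ
    have : ∀ u, ∃ i ∈ I, pos i = σ u := fun u => by
      have := hσ u
      simpa [superAlphabet] using this
    choose τ hτ hτ' using this
    exact ⟨τ, Fintype.mem_piFinset.mpr hτ, funext hτ'⟩
  · intro σ _
    congr 1
    refine Finset.prod_congr rfl fun u _ => Finset.prod_congr rfl fun v _ => if_congr ?_ rfl rfl
    simp [LeNeg, pos_lt_pos, not_isNeg_pos]

/-- The bound is uniform in the substituted polynomials. It limits the degree in one `y_j`, whatever
the other weights and however many letters there are. -/
theorem exists_natDegree_aeval_le {K R : Type*} [CommRing K] [CommRing R] [Algebra K R]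
    (P : MvPolynomial ℕ+ K) : ∃ D, ∀ g : ℕ+ → Polynomial R, (∀ k, (g k).natDegree ≤ k) →
      (MvPolynomial.aeval g P).natDegree ≤ D := by
  induction P using MvPolynomial.induction_on with
  | C a =>
    refine ⟨0, fun g _ => ?_⟩
    rw [MvPolynomial.aeval_C, Polynomial.algebraMap_apply, Polynomial.natDegree_C]
  | add P Q hP hQ =>
    obtain ⟨D, hD⟩ := hP
    obtain ⟨E, hE⟩ := hQ
    refine ⟨max D E, fun g hg => ?_⟩
    rw [map_add]
    exact (Polynomial.natDegree_add_le _ _).trans (max_le_max (hD g hg) (hE g hg))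
  | mul_X P k hP =>
    obtain ⟨D, hD⟩ := hP
    refine ⟨D + k, fun g hg => ?_⟩
    rw [map_mul, MvPolynomial.aeval_X]
    exact Polynomial.natDegree_mul_le.trans (add_le_add (hD g hg) (hg k))

theorem natDegree_letterSum_le {ι S R : Type*} [Fintype ι] [LinearOrder S] [CommRing R]
    (neg : S → Prop) {c : ι → ι → Polynomial R} (hc : ∀ u v, (c u v).natDegree = 0) (T : Finset S)
    {z : S → Polynomial R} (hz : ∀ s, (z s).natDegree ≤ 1) :
    (letterSum neg c T z).natDegree ≤ Fintype.card ι := by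
  refine Polynomial.natDegree_sum_le_of_forall_le _ _ fun σ _ => ?_
  refine Polynomial.natDegree_mul_le.trans ?_
  have h1 : (inversionWeight neg c σ).natDegree ≤ 0 := by
    refine (Polynomial.natDegree_prod_le _ _).trans (Finset.sum_nonpos fun u _ => ?_)
    refine (Polynomial.natDegree_prod_le _ _).trans (Finset.sum_nonpos fun v _ => ?_)
    split_ifs
    · exact (hc u v).le
    · simp
  have h2 : (∏ u, z (σ u)).natDegree ≤ Fintype.card ι := by
    refine (Polynomial.natDegree_prod_le _ _).trans ?_
    refine (Finset.sum_le_card_nsmul _ _ 1 fun u _ => hz _).trans ?_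
    simp
  omega

variable {μ : YoungDiagram} {p : Box μ → ℤ} {n : ℕ} {q : FieldQT} {d : Box μ → FieldQT}
  {P : MvPolynomial ℕ+ FieldQT}

theorem aeval_eq_letterSum
    (hP : IsPowerSumExpansion (fillingSeries id Set.univ fun σ : Filling μ ℕ+ =>
      inversionWeight (fun _ => False) (windowWeight p (n + 1) q d) σ) P)
    {R : Type*} [CommRing R] [Algebra FieldQT R] (x y : ℕ+ → R) (I : Finset ℕ+) :
    letterSum IsNeg (fun u v => algebraMap FieldQT R (windowWeight p (n + 1) q d u v))
      (superAlphabet I ∅) (superWeight x y) =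
    MvPolynomial.aeval (fun k : ℕ+ => ∑ i ∈ I, x i ^ (k : ℕ)) P := by
  rw [hP.aeval_sum_pow (killCompl_inversionWeight _ I) x, letterSum_superAlphabet_empty]
  have := letterSum_map (MvPolynomial.aeval x).toRingHom (fun _ => False)
    (fun u v => MvPolynomial.C (windowWeight p (n + 1) q d u v)) I (MvPolynomial.X (R := FieldQT))
  refine Eq.trans ?_ this.symm
  congr 1
  · funext u v
    simp
  · funext i
    simp [superWeight_pos]

/-- The super filling series evaluates `f[X - Y]`. -/
theorem exists_letterSum_eq_aeval (hp : Function.Injective p)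
    (hP : IsPowerSumExpansion (fillingSeries id Set.univ fun σ : Filling μ ℕ+ =>
      inversionWeight (fun _ => False) (windowWeight p (n + 1) q d) σ) P)
    (R : Type*) [CommRing R] [IsDomain R] [Algebra FieldQT R] :
    ∃ D : ℕ, ∀ J I : Finset ℕ+, D + J.card < I.card → ∀ x y : ℕ+ → R, Set.InjOn x I →
      letterSum IsNeg (fun u v => algebraMap FieldQT R (windowWeight p (n + 1) q d u v))
        (superAlphabet I J) (superWeight x y) =
      MvPolynomial.aeval (fun k : ℕ+ => ∑ i ∈ I, x i ^ (k : ℕ) - ∑ j ∈ J, y j ^ (k : ℕ)) P := by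
  obtain ⟨D, hD⟩ := exists_natDegree_aeval_le (R := R) P
  refine ⟨max D (Fintype.card (Box μ)), fun J => ?_⟩
  induction J using Finset.induction_on_max with
  | empty =>
    intro I _ x y _
    rw [aeval_eq_letterSum hP]
    simp
  | insert j₀ J hJ ih =>
    intro I hI x y hx
    -- As `j₀` exceeds all of `J`, its barred letter is the least negative letter and comes right
    -- after the largest positive one.
    have hj₀ : j₀ ∉ J := fun h => lt_irrefl _ (hJ j₀ h)
    rw [Finset.card_insert_of_notMem hj₀] at hI
    set c : Box μ → Box μ → R :=
      fun u v => algebraMap FieldQT R (windowWeight p (n + 1) q d u v) with hc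
    have hcw : c = windowWeight p (n + 1) (algebraMap FieldQT R q)
        (fun u => algebraMap FieldQT R (d u)) := by
      funext u v
      exact map_windowWeight _ _ _ _ _ _ _
    set T := superAlphabet I (insert j₀ J) with hT
    -- the identity for `y j₀ = r`, as a polynomial equation in `r`
    set E : Polynomial R := letterSum IsNeg (fun u v => Polynomial.C (c u v)) T
      (superWeight (fun i => Polynomial.C (x i))
        (Function.update (fun j => Polynomial.C (y j)) j₀ Polynomial.X)) -
      MvPolynomial.aeval (fun k : ℕ+ => Polynomial.C (∑ i ∈ I, x i ^ (k : ℕ) -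
        ∑ j ∈ J, y j ^ (k : ℕ)) - Polynomial.X ^ (k : ℕ)) P with hE
    have hEval : ∀ r : R, E.eval r =
        letterSum IsNeg c T (superWeight x (Function.update y j₀ r)) -
        MvPolynomial.aeval (fun k : ℕ+ => ∑ i ∈ I, x i ^ (k : ℕ) -
          ∑ j ∈ J, y j ^ (k : ℕ) - r ^ (k : ℕ)) P := by
      intro r
      rw [hE, Polynomial.eval_sub]
      congr 1
      · rw [← Polynomial.coe_evalRingHom, letterSum_map]
        congr 1
        · funext u v
          simp
        · funext a
          rcases eq_pos_or_eq_bar a with ⟨i, rfl⟩ | ⟨j, rfl⟩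
          · simp [superWeight_pos]
          · rw [superWeight_bar, superWeight_bar]
            by_cases h : j = j₀
            · subst h; simp
            · simp [h]
      · have := congrFun (congrArg DFunLike.coe (MvPolynomial.comp_aeval (R := FieldQT)
          (fun k : ℕ+ => Polynomial.C (∑ i ∈ I, x i ^ (k : ℕ) -
        ∑ j ∈ J, y j ^ (k : ℕ)) - Polynomial.X ^ (k : ℕ))
          ((Polynomial.aeval (R := R) r).restrictScalars FieldQT))) P
        rw [← Polynomial.coe_aeval_eq_eval]
        refine this.trans ?_
        congr 2
        funext k
        simp
    -- The degree of `E` is smaller than the number of elements of `I`, and `E` vanishes at the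
    -- distinct values `x i`.
    have hE0 : E = 0 := by
      refine Polynomial.eq_zero_of_natDegree_lt_card_of_eval_eq_zero' E (I.image x) ?_ ?_
      · intro r hr
        obtain ⟨i, hi, rfl⟩ := Finset.mem_image.mp hr
        rw [hEval, sub_eq_zero]
        have hIne : I.Nonempty := ⟨i, hi⟩
        -- By symmetry in the positive letters the value `x i` may be moved to the largest one,
        -- `i₀`, which is adjacent to the barred `j₀`. The two then have opposite weights and both
        -- disappear.
        set i₀ := I.max' hIne with hi₀
        have hi₀I : i₀ ∈ I := I.max'_mem hIne
        set y' := Function.update y j₀ (x i) with hy'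
        set x' : ℕ+ → R := x ∘ Equiv.swap i i₀ with hx'
        have hswapI : ∀ k ∈ I, Equiv.swap i i₀ k ∈ I := by
          intro k hk
          by_cases h1 : k = i
          · rw [h1, Equiv.swap_apply_left]; exact hi₀I
          · by_cases h2 : k = i₀
            · rw [h2, Equiv.swap_apply_right]; exact hi
            · rwa [Equiv.swap_apply_of_ne_of_ne h1 h2]
        have e1 : letterSum IsNeg c T (superWeight x y') = letterSum IsNeg c T (superWeight x' y') := by
          rcases (I.le_max' i hi).eq_or_lt with h | h
          · have : Equiv.swap i i₀ = 1 := by rw [hi₀, ← h, Equiv.swap_self]; rfl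
            rw [hx', this]; rfl
          · have key := letterSum_swap (neg := IsNeg) (c := c) (T := T)
              (fun A a b => by rw [hcw]; exact twoLetterSum_windowWeight_comm hp _ n _ A a b) _
              (pos i) (pos i₀) (pos_lt_pos.mpr h) rfl (pos_mem_superAlphabet.mpr hi)
              (pos_mem_superAlphabet.mpr hi₀I) (fun s _ _ hs => by
                rintro ⟨j, rfl⟩
                exact absurd hs (pos_lt_bar _ _).not_ge) (superWeight x y')
            rw [← key]
            congr 1
            funext a
            rcases eq_pos_or_eq_bar a with ⟨k, rfl⟩ | ⟨j, rfl⟩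
            · rw [superWeight_pos, hx', Function.comp_apply, Function.comp_apply]
              exact (congrArg (superWeight x y') (pos_injective.map_swap _ _ _).symm).trans
                (superWeight_pos _ _ _)
            · rw [superWeight_bar, Function.comp_apply]
              exact (congrArg (superWeight x y') (Equiv.swap_apply_of_ne_of_ne
                (pos_ne_bar _ _).symm (pos_ne_bar _ _).symm)).trans (superWeight_bar _ _ _)
        have hx'i₀ : x' i₀ = x i := by simp [hx']
        have e2 : letterSum IsNeg c T (superWeight x' y') =
            letterSum IsNeg c (superAlphabet (I.erase i₀) J) (superWeight x' y) := by
          rw [letterSum_cancel (pos := p) (a := pos i₀) (b := bar j₀)]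
          · refine (congrArg (fun T' => letterSum IsNeg c T' (superWeight x' y'))
              (?_ : _ = superAlphabet (I.erase i₀) J)).trans ?_
            · ext a
              rcases eq_pos_or_eq_bar a with ⟨k, rfl⟩ | ⟨j, rfl⟩
              · simp [hT, pos_mem_superAlphabet, pos_ne_bar, pos_injective.eq_iff]
              · simp only [Finset.mem_erase, hT, bar_mem_superAlphabet, Finset.mem_insert, ne_eq,
                  bar_injective.eq_iff, (pos_ne_bar _ _).symm, not_false_eq_true, true_and]
                constructor
                · rintro ⟨h1, h2⟩
                  exact h2.resolve_left h1
                · intro h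
                  exact ⟨by rintro rfl; exact hj₀ h, Or.inr h⟩
            refine letterSum_congr fun a ha => ?_
            rcases eq_pos_or_eq_bar a with ⟨k, rfl⟩ | ⟨j, rfl⟩
            · rw [superWeight_pos, superWeight_pos]
            · rw [bar_mem_superAlphabet] at ha
              have hj : j ≠ j₀ := by rintro rfl; exact hj₀ ha
              rw [superWeight_bar, superWeight_bar, hy', Function.update_of_ne hj]
          · intro u v huv
            rw [hcw]
            unfold windowWeight
            rw [if_neg (by omega), if_neg (by omega)]
          · exact pos_mem_superAlphabet.mpr hi₀I
          · exact bar_mem_superAlphabet.mpr (Finset.mem_insert_self _ _)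
          · exact pos_lt_bar _ _
          · exact not_isNeg_pos _
          · exact isNeg_bar _
          · intro s hs h1 h2
            rcases eq_pos_or_eq_bar s with ⟨k, rfl⟩ | ⟨j, rfl⟩
            · refine Or.inl ⟨pos_lt_pos.mpr (lt_of_le_of_ne (I.le_max' k ?_) ?_), pos_lt_bar _ _⟩
              · exact pos_mem_superAlphabet.mp hs
              · rintro rfl; exact h1 rfl
            · refine Or.inr ⟨pos_lt_bar _ _, bar_lt_bar.mpr (hJ j ?_)⟩
              refine (Finset.mem_insert.mp (bar_mem_superAlphabet.mp hs)).resolve_left ?_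
              rintro rfl; exact h2 rfl
          · rw [superWeight_bar, superWeight_pos, hx'i₀, hy', Function.update_self]
        -- On the power-sum side `x i ^ k` and the subtracted `k`-th power at `j₀` cancel as well.
        -- Both alphabets lose one letter, so the margin between their sizes is kept.
        rw [e1, e2, ih]
        · congr 2
          funext k
          rw [sub_right_comm]
          congr 1
          rw [eq_sub_iff_add_eq, ← hx'i₀, Finset.sum_erase_add _ _ hi₀I]
          refine Finset.sum_nbij' (Equiv.swap i i₀) (Equiv.swap i i₀) hswapI hswapI ?_ ?_ ?_
          · simp
          · simp
          · intro a _; rfl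
        · rw [Finset.card_erase_of_mem hi₀I]
          omega
        · intro a ha b hb hab
          have ha' := hswapI a (Finset.mem_of_mem_erase ha)
          have hb' := hswapI b (Finset.mem_of_mem_erase hb)
          exact (Equiv.swap i i₀).injective (hx ha' hb' hab)
      · rw [Finset.card_image_of_injOn hx]
        refine lt_of_le_of_lt ?_ (lt_of_le_of_lt (Nat.le_add_right _ _) hI)
        rw [max_comm]
        refine (Polynomial.natDegree_sub_le _ _).trans (max_le_max ?_ ?_)
        · refine natDegree_letterSum_le _ (fun u v => Polynomial.natDegree_C _) _ fun a => ?_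
          rcases eq_pos_or_eq_bar a with ⟨k, rfl⟩ | ⟨j, rfl⟩
          · rw [superWeight_pos, Polynomial.natDegree_C]; exact zero_le_one
          · rw [superWeight_bar, Polynomial.natDegree_neg]
            by_cases h : j = j₀
            · subst h
              rw [Function.update_self]
              exact Polynomial.natDegree_X_le
            · rw [Function.update_of_ne h, Polynomial.natDegree_C]; exact zero_le_one
        · refine hD _ fun k => ?_
          refine (Polynomial.natDegree_sub_le _ _).trans (max_le ?_ ?_)
          · rw [Polynomial.natDegree_C]; exact Nat.zero_le _
          · exact Polynomial.natDegree_X_pow_le _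
    have := hEval (y j₀)
    rw [hE0, Polynomial.eval_zero, Function.update_eq_self, eq_comm, sub_eq_zero] at this
    rw [this]
    congr 2
    funext k
    rw [Finset.sum_insert hj₀]
    ring

end Superization

/-! ### The substitution of `X(t - 1)` -/

section PlethysticSeries

theorem map_powerSum {R R' : Type*} [CommRing R] [CommRing R'] (f : R →+* R') (k : ℕ) :
    MvPowerSeries.map f (powerSum R k) = powerSum R' k := by
  ext m
  rw [MvPowerSeries.coeff_map, coeff_powerSum, coeff_powerSum]
  split_ifs <;> simp

theorem expand_powerSum {R : Type*} [CommRing R] (k : ℕ+) :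
    MvPowerSeries.expand (k : ℕ) k.ne_zero (powerSum R 1) = powerSum R k := by
  ext m
  rw [coeff_powerSum]
  by_cases h : ∀ i, (k : ℕ) ∣ m i
  · obtain ⟨m', rfl⟩ : ∃ m' : ℕ+ →₀ ℕ, (k : ℕ) • m' = m := by
      refine ⟨m.mapRange (fun a => a / k) (by simp), ?_⟩
      ext i
      simp [Nat.mul_div_cancel' (h i)]
    rw [MvPowerSeries.coeff_expand_smul, coeff_powerSum]
    refine if_congr ?_ rfl rfl
    refine exists_congr fun i => ?_
    have : Finsupp.single i (k : ℕ) = (k : ℕ) • (Finsupp.single i 1 : ℕ+ →₀ ℕ) := by simp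
    rw [this]
    constructor
    · rintro rfl; rfl
    · intro h
      ext j
      have := DFunLike.congr_fun h j
      rw [Finsupp.smul_apply, Finsupp.smul_apply, smul_eq_mul, smul_eq_mul] at this
      exact Nat.eq_of_mul_eq_mul_left k.pos this
  · push Not at h
    obtain ⟨i, hi⟩ := h
    rw [MvPowerSeries.coeff_expand_of_not_dvd _ _ _ hi, if_neg]
    rintro ⟨j, rfl⟩
    refine hi ?_
    by_cases hij : i = j
    · subst hij; simp
    · rw [Finsupp.single_eq_of_ne hij]; exact dvd_zero _

theorem powerSumAt_alphabetXtSubOne (k : ℕ+) : powerSumAt k alphabetXtSubOne =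
    powerSum FieldQT k * MvPowerSeries.C (tt ^ (k : ℕ) - 1) := by
  rw [powerSumAt, alphabetXtSubOne, map_mul, map_mul, map_mul, map_powerSum, expand_powerSum,
    map_powerSum, MvPowerSeries.map_C, MvPowerSeries.expand_C, MvPowerSeries.map_C]
  congr 2
  simp [tt]

theorem killCompl_powerSumAt (A : Finset ℕ+) (k : ℕ+) :
    killCompl A (powerSumAt k alphabetXtSubOne) =
      ∑ i ∈ A, (MvPowerSeries.C tt * MvPowerSeries.X i) ^ (k : ℕ) -
        ∑ i ∈ A, MvPowerSeries.X i ^ (k : ℕ) := by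
  have hC : killCompl A (MvPowerSeries.C (tt ^ (k : ℕ) - 1) : MvPowerSeries ℕ+ FieldQT) =
    MvPowerSeries.C (tt ^ (k : ℕ) - 1) := (killCompl A).commutes _
  rw [powerSumAt_alphabetXtSubOne, map_mul, hC, killCompl_powerSum, map_sub, map_pow, map_one,
    mul_sub, mul_one, Finset.sum_mul]
  congr 1
  refine Finset.sum_congr rfl fun i _ => ?_
  rw [mul_pow, mul_comm]

variable {μ : YoungDiagram} {p : Box μ → ℤ} {n : ℕ} {q : FieldQT} {d : Box μ → FieldQT}
  {P : MvPolynomial ℕ+ FieldQT}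

theorem prod_superWeight (σ : Filling μ SuperLetter) :
    ∏ c, superWeight (fun i => MvPowerSeries.C tt * MvPowerSeries.X i : ℕ+ → MvPowerSeries ℕ+ FieldQT)
      (fun i => MvPowerSeries.X i) (σ c) =
    MvPowerSeries.C ((-1) ^ numNeg σ * tt ^ numPos σ) * ∏ c, MvPowerSeries.X (σ c).abs := by
  have h : ∀ a : SuperLetter, superWeight (fun i => MvPowerSeries.C tt * MvPowerSeries.X i :
      ℕ+ → MvPowerSeries ℕ+ FieldQT) (fun i => MvPowerSeries.X i) a =
      (if a.IsNeg then -1 else 1) * (if a.IsNeg then 1 else MvPowerSeries.C tt) *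
        MvPowerSeries.X a.abs := by
    intro a
    unfold superWeight
    split_ifs <;> simp
  simp only [h, Finset.prod_mul_distrib, map_mul, map_pow]
  congr 2
  · rw [Finset.prod_ite]
    simp [numNeg]
  · rw [Finset.prod_ite]
    simp [numPos]

/-- The plethystic substitution `X(t - 1)` in the series of all fillings yields the series of all
super fillings. -/
theorem aeval_powerSumAt_eq_fillingSeries (hp : Function.Injective p)
    (hP : IsPowerSumExpansion (fillingSeries id Set.univ fun σ : Filling μ ℕ+ =>
      inversionWeight (fun _ => False) (windowWeight p (n + 1) q d) σ) P) :
    MvPolynomial.aeval (fun k : ℕ+ => powerSumAt k alphabetXtSubOne) P =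
      fillingSeries SuperLetter.abs Set.univ fun σ : Filling μ SuperLetter =>
        inversionWeight IsNeg (windowWeight p (n + 1) q d) σ *
          ((-1) ^ numNeg σ * tt ^ numPos σ) := by
  refine ext_killCompl fun B => ?_
  have : IsDomain (MvPowerSeries ℕ+ FieldQT) := NoZeroDivisors.to_isDomain _
  obtain ⟨D, hD⟩ := exists_letterSum_eq_aeval hp hP (MvPowerSeries ℕ+ FieldQT)
  -- Superization requires many more positive than negative letters; the surplus indeterminates are
  -- set to `0` afterwards.
  obtain ⟨I, hBI, hI⟩ := Infinite.exists_superset_card_eq B (B.card + (D + B.card + 1)) (by omega)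
  have htt : tt ≠ 0 := by
    rw [tt, Ne, IsFractionRing.to_map_eq_zero_iff]
    exact MvPolynomial.X_ne_zero _
  have key := congrArg (killCompl B) (hD B I (by omega)
    (fun i => MvPowerSeries.C tt * MvPowerSeries.X i) (fun i => MvPowerSeries.X i) (by
      intro i _ j _ hij
      have hC : (MvPowerSeries.C tt : MvPowerSeries ℕ+ FieldQT) ≠ 0 := by
        intro h
        have := congrArg (MvPowerSeries.coeff 0) h
        rw [MvPowerSeries.coeff_zero_C, map_zero] at this
        exact htt this
      exact MvPowerSeries.X_inj.mp (mul_left_cancel₀ hC hij)))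
  have hX : ∀ i : ℕ+, killCompl B (MvPowerSeries.X i : MvPowerSeries ℕ+ FieldQT) =
    if i ∈ B then MvPowerSeries.X i else 0 := killCompl_X B
  have hC : ∀ a, killCompl B (MvPowerSeries.C a : MvPowerSeries ℕ+ FieldQT) = MvPowerSeries.C a :=
    fun a => (killCompl B).commutes a
  have e1 : killCompl B (MvPolynomial.aeval (fun k : ℕ+ => powerSumAt k alphabetXtSubOne) P) =
      killCompl B (MvPolynomial.aeval (fun k : ℕ+ =>
        ∑ i ∈ I, (MvPowerSeries.C tt * MvPowerSeries.X i) ^ (k : ℕ) -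
          ∑ i ∈ B, (MvPowerSeries.X i : MvPowerSeries ℕ+ FieldQT) ^ (k : ℕ)) P) := by
    have hcomp : ∀ g : ℕ+ → MvPowerSeries ℕ+ FieldQT, killCompl B (MvPolynomial.aeval g P) =
        MvPolynomial.aeval (fun k => killCompl B (g k)) P := fun g =>
      congrFun (congrArg DFunLike.coe (MvPolynomial.comp_aeval (R := FieldQT) g (killCompl B))) P
    rw [hcomp, hcomp]
    congr 2
    funext k
    rw [killCompl_powerSumAt, map_sub, map_sum, map_sum]
    congr 1
    · rw [← Finset.sum_subset hBI]
      · refine Finset.sum_congr rfl fun i hi => ?_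
        rw [map_pow, map_mul, hX, if_pos hi, hC]
      · intro i _ hi
        rw [map_pow, map_mul, hX, if_neg hi, mul_zero, zero_pow k.ne_zero]
    · refine Finset.sum_congr rfl fun i hi => ?_
      rw [map_pow, hX, if_pos hi]
  rw [e1, ← key]
  have hT : ∀ a, a ∈ superAlphabet B B ↔ a.abs ∈ B := by
    intro a
    rcases eq_pos_or_eq_bar a with ⟨i, rfl⟩ | ⟨i, rfl⟩
    · rw [pos_mem_superAlphabet, SuperLetter.abs_pos]
    · rw [bar_mem_superAlphabet, abs_bar]
  rw [killCompl_fillingSeries _ _ _ _ _ hT]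
  have e2 := letterSum_map (killCompl B).toRingHom IsNeg
    (fun u v => algebraMap FieldQT (MvPowerSeries ℕ+ FieldQT) (windowWeight p (n + 1) q d u v))
    (superAlphabet I B) (superWeight (fun i => MvPowerSeries.C tt * MvPowerSeries.X i)
      (fun i => MvPowerSeries.X i))
  refine Eq.trans e2 ?_
  rw [letterSum_eq_of_subset (T' := superAlphabet B B)]
  · rw [letterSum]
    refine Finset.sum_congr (by
      ext σ
      rw [@Finset.mem_filter _ _ (_) _ _]
      simp only [Fintype.mem_piFinset]
      exact (and_iff_left trivial).symm) fun σ hσ => ?_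
    rw [map_mul, mul_assoc, ← prod_superWeight]
    congr 1
    · simp only [inversionWeight, map_prod]
      refine Finset.prod_congr rfl fun u _ => Finset.prod_congr rfl fun v _ => ?_
      split_ifs
      · exact (killCompl B).commutes _
      · simp
    · refine Finset.prod_congr rfl fun c _ => ?_
      have := ((@Fintype.mem_piFinset _ (_) _ _ _ _).mp ((@Finset.mem_filter _ _ (_) _ _).mp hσ).1) c
      change killCompl B _ = _
      rcases eq_pos_or_eq_bar (σ c) with ⟨i, hi⟩ | ⟨i, hi⟩
      · rw [hi, pos_mem_superAlphabet] at this
        rw [hi, superWeight_pos, map_mul, hC, hX, if_pos this]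
      · rw [hi, bar_mem_superAlphabet] at this
        rw [hi, superWeight_bar, map_neg, hX, if_pos this]
  · intro a
    rcases eq_pos_or_eq_bar a with ⟨i, rfl⟩ | ⟨i, rfl⟩
    · rw [pos_mem_superAlphabet, pos_mem_superAlphabet]; exact fun h => hBI h
    · rw [bar_mem_superAlphabet, bar_mem_superAlphabet]; exact fun h => h
  · intro a ha ha'
    change killCompl B _ = _
    rcases eq_pos_or_eq_bar a with ⟨i, rfl⟩ | ⟨i, rfl⟩
    · rw [pos_mem_superAlphabet] at ha'
      rw [superWeight_pos, map_mul, hX, if_neg ha', mul_zero]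
    · rw [bar_mem_superAlphabet] at ha ha'
      exact absurd ha ha'

end PlethysticSeries

theorem qq_ne_zero : qq ≠ 0 := by
  rw [qq, Ne, IsFractionRing.to_map_eq_zero_iff]
  exact MvPolynomial.X_ne_zero _

theorem qq_ne_one : qq ≠ 1 := by
  intro h
  rw [qq, ← map_one (algebraMap PolyQT FieldQT)] at h
  have h := IsFractionRing.injective PolyQT FieldQT h
  have := congrArg (MvPolynomial.eval 0) h
  simp at this

/-! ### Inversions, arms and inversion pairs -/

section LetterOrder

variable {S : Type*} [LinearOrder S] {neg : S → Prop}

theorem lePos_iff {x y : S} : LePos neg x y ↔ ¬ LeNeg neg y x := by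
  unfold LePos LeNeg
  rcases lt_trichotomy x y with h | h | h
  · simp [h, h.not_gt, h.ne']
  · subst h; simp
  · simp [h, h.not_gt, h.ne']

theorem LeNeg.trans {x y z : S} (h : LeNeg neg x y) (h' : LeNeg neg y z) : LeNeg neg x z := by
  rcases h with h | ⟨rfl, h⟩
  · rcases h' with h' | ⟨rfl, h'⟩
    exacts [Or.inl (h.trans h'), Or.inl h]
  · exact h'

theorem LeNeg.le {x y : S} (h : LeNeg neg x y) : x ≤ y := by
  rcases h with h | ⟨rfl, -⟩
  exacts [h.le, le_rfl]

theorem LeNeg.or {x y z : S} (h : LeNeg neg x z) : LeNeg neg x y ∨ LeNeg neg y z := by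
  rcases lt_trichotomy x y with h1 | rfl | h1
  · exact Or.inl (Or.inl h1)
  · exact Or.inr h
  · exact Or.inr (Or.inl (h1.trans_le h.le))

/-- By `LeNeg.trans` and `LeNeg.or` only six of the eight truth patterns of the three comparisons
can occur, and the formula holds on each of them. -/
theorem cCIncreasing_iff (x₁ x₂ x₃ : S) : (if CCIncreasing neg x₁ x₂ x₃ then (1 : ℤ) else 0) =
    (if LeNeg neg x₂ x₁ then 1 else 0) + (if LeNeg neg x₃ x₂ then 1 else 0) -
      if LeNeg neg x₃ x₁ then 1 else 0 := by
  have h1 : LeNeg neg x₃ x₂ → LeNeg neg x₂ x₁ → LeNeg neg x₃ x₁ := LeNeg.trans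
  have h2 : LeNeg neg x₃ x₁ → LeNeg neg x₃ x₂ ∨ LeNeg neg x₂ x₁ := LeNeg.or
  unfold CCIncreasing
  rw [lePos_iff]
  by_cases a : LeNeg neg x₂ x₁ <;> by_cases b : LeNeg neg x₃ x₂ <;>
    by_cases c : LeNeg neg x₃ x₁ <;> simp [a, b, c] at h1 h2 ⊢

end LetterOrder

variable {μ : YoungDiagram}

namespace Box

theorem ext {c d : Box μ} (h1 : c.row = d.row) (h2 : c.col = d.col) : c = d :=
  Subtype.ext (Prod.ext h1 h2)

theorem mem_iff {j i : ℕ} : (j, i) ∈ μ.cells ↔ i < μ.rowLen j := by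
  rw [YoungDiagram.mem_cells, YoungDiagram.mem_iff_lt_rowLen]

theorem mem_iff' {j i : ℕ} : (j, i) ∈ μ.cells ↔ j < μ.colLen i := by
  rw [YoungDiagram.mem_cells, YoungDiagram.mem_iff_lt_colLen]

theorem col_lt (c : Box μ) : c.col < μ.rowLen c.row := mem_iff.mp c.2

theorem row_lt (c : Box μ) : c.row < μ.colLen c.col := mem_iff'.mp c.2

theorem mk_mem {c : Box μ} {j i : ℕ} (hj : j ≤ c.row) (hi : i ≤ c.col) : (j, i) ∈ μ.cells :=
  μ.isLowerSet (show (j, i) ≤ c.1 from ⟨hj, hi⟩) c.2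

theorem card_row (p : ℕ → Prop) [DecidablePred p] (j : ℕ) :
    (Finset.univ.filter fun d : Box μ => d.row = j ∧ p d.col).card =
      ((Finset.range (μ.rowLen j)).filter p).card := by
  refine Finset.card_bij (fun d _ => d.col) ?_ ?_ ?_
  · intro d hd
    obtain ⟨rfl, h⟩ := (Finset.mem_filter.mp hd).2
    exact Finset.mem_filter.mpr ⟨Finset.mem_range.mpr d.col_lt, h⟩
  · intro d hd e he h
    exact ext ((Finset.mem_filter.mp hd).2.1.trans (Finset.mem_filter.mp he).2.1.symm) h
  · intro i hi
    obtain ⟨h1, h2⟩ := Finset.mem_filter.mp hi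
    exact ⟨⟨(j, i), mem_iff.mpr (Finset.mem_range.mp h1)⟩,
      Finset.mem_filter.mpr ⟨Finset.mem_univ _, rfl, h2⟩, rfl⟩

theorem card_right (c : Box μ) (j : ℕ) :
    (Finset.univ.filter fun d : Box μ => d.row = j ∧ c.col < d.col).card =
      μ.rowLen j - (c.col + 1) := by
  rw [card_row (fun i => c.col < i)]
  have : (Finset.range (μ.rowLen j)).filter (fun i => c.col < i) =
      Finset.Ico (c.col + 1) (μ.rowLen j) := by
    ext; simp; omega
  rw [this, Nat.card_Ico]

theorem card_left (c : Box μ) {j : ℕ} (hj : j ≤ c.row) :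
    (Finset.univ.filter fun d : Box μ => d.row = j ∧ d.col < c.col).card = c.col := by
  rw [card_row (fun i => i < c.col)]
  have h := μ.rowLen_anti _ _ hj
  have h' := c.col_lt
  have : (Finset.range (μ.rowLen j)).filter (fun i => i < c.col) = Finset.range c.col := by
    ext; simp; omega
  rw [this, Finset.card_range]

end Box

section InversionPairs

variable {S : Type*} [LinearOrder S] (neg : S → Prop)

/-- All terms are counted by pairs `(c₁, c₂)` in one row, `c₁` to the left, with `c₃` below `c₁`.
Inversions within a row compare `c₁` and `c₂`. An inversion between consecutive rows, with upper box
`c₂` and lower box `c₃`, is recorded at the box `c₁` above `c₃`. The arm of a descent `c₁` counts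
the boxes `c₂` to its right. Pair by pair the identity is `cCIncreasing_iff`; in the bottom row only
the first kind occurs. -/
theorem inv_eq_card_invPairs (σ : Filling μ S) : inv neg σ = (invPairs neg σ).card := by
  have h1 : invSet neg σ =
      (Finset.univ.filter fun p : Box μ × Box μ => p.1.row = p.2.row ∧ p.1.col < p.2.col ∧
        LeNeg neg (σ p.2) (σ p.1)) ∪
      (Finset.univ.filter fun p : Box μ × Box μ => p.1.row = p.2.row + 1 ∧ p.2.col < p.1.col ∧
        LeNeg neg (σ p.2) (σ p.1)) := by
    ext p
    rw [invSet, Finset.mem_union, Finset.mem_filter, Finset.mem_filter, Finset.mem_filter]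
    simp only [Finset.mem_univ, true_and, Box.Attack, Box.Precedes]
    constructor
    · rintro ⟨h1 | h1 | h1, h2, h3⟩
      · exact Or.inl ⟨h1, by omega, h3⟩
      · exact Or.inr ⟨h1.1, h1.2, h3⟩
      · omega
    · rintro (⟨h1, h2, h3⟩ | ⟨h1, h2, h3⟩)
      · exact ⟨Or.inl h1, Or.inr ⟨h1, h2⟩, h3⟩
      · exact ⟨Or.inr (Or.inl ⟨h1, h2⟩), Or.inl (by omega), h3⟩
  have h2 : (Finset.univ.filter fun p : Box μ × Box μ => p.1.row = p.2.row + 1 ∧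
      p.2.col < p.1.col ∧ LeNeg neg (σ p.2) (σ p.1)).card =
      (Finset.univ.filter fun p : Box μ × Box μ => p.1.row = p.2.row ∧ p.1.col < p.2.col ∧
        ∃ c₃ : Box μ, p.1.DirectlyAbove c₃ ∧ LeNeg neg (σ c₃) (σ p.2)).card := by
    refine Finset.card_bij (fun p hp => (⟨(p.2.row + 1, p.2.col), Box.mk_mem (c := p.1)
      (Finset.mem_filter.mp hp).2.1.ge (Finset.mem_filter.mp hp).2.2.1.le⟩, p.1)) ?_ ?_ ?_
    · intro p hp
      obtain ⟨h1, h2, h3⟩ := (Finset.mem_filter.mp hp).2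
      exact Finset.mem_filter.mpr ⟨Finset.mem_univ _, h1.symm, h2, p.2, ⟨rfl, rfl⟩, h3⟩
    · intro p hp p' hp' h
      simp only [Prod.mk.injEq, Subtype.mk.injEq, Nat.add_right_cancel_iff] at h
      exact Prod.ext h.2 (Box.ext h.1.1 h.1.2)
    · rintro ⟨a, b⟩ hp
      obtain ⟨h1, h2, c, ⟨h3, h4⟩, h5⟩ := (Finset.mem_filter.mp hp).2
      refine ⟨(b, c), Finset.mem_filter.mpr ⟨Finset.mem_univ _, ?_, ?_, h5⟩, ?_⟩
      · exact h1.symm.trans h3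
      · exact h4 ▸ h2
      · exact Prod.ext (Box.ext h3.symm h4.symm) rfl
  have h3 : ∑ c ∈ desSet neg σ, (c.arm : ℤ) = ((Finset.univ.filter fun p : Box μ × Box μ =>
      p.1.row = p.2.row ∧ p.1.col < p.2.col ∧
        ∃ c₃ : Box μ, p.1.DirectlyAbove c₃ ∧ LeNeg neg (σ c₃) (σ p.1)).card : ℤ) := by
    rw [Finset.card_filter, ← Finset.univ_product_univ, Finset.sum_product, desSet,
      Finset.sum_filter, Nat.cast_sum]
    refine Finset.sum_congr rfl fun c _ => ?_
    split_ifs with h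
    · rw [Box.arm, ← Box.card_right, Finset.card_filter]
      refine congrArg _ (Finset.sum_congr rfl fun d _ => if_congr ?_ rfl rfl)
      exact ⟨fun ⟨h1, h2⟩ => ⟨h1.symm, h2, h⟩, fun ⟨h1, h2, _⟩ => ⟨h1.symm, h2⟩⟩
    · rw [Finset.sum_eq_zero, Nat.cast_zero]
      exact fun d _ => if_neg fun h' => h h'.2.2
  rw [inv, h1, Finset.card_union_of_disjoint, h3, Nat.cast_add, h2, invPairs]
  · simp only [Finset.card_filter, Nat.cast_sum]
    rw [← Finset.sum_add_distrib, ← Finset.sum_sub_distrib]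
    refine Finset.sum_congr rfl fun p _ => ?_
    by_cases hp : p.1.row = p.2.row ∧ p.1.col < p.2.col
    · obtain ⟨hp1, hp2⟩ := hp
      by_cases h0 : p.1.row = 0
      · have hno : ∀ c₃, ¬ p.1.DirectlyAbove c₃ := fun c₃ h => by
          have := h.1; omega
        have : p.2.row = 0 := hp1 ▸ h0
        simp [hno, hp1, hp2, this]
      · set d : Box μ := ⟨(p.1.row - 1, p.1.col), Box.mk_mem (c := p.1) (by omega) le_rfl⟩ with hd
        have hda : ∀ c₃, p.1.DirectlyAbove c₃ ↔ c₃ = d := by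
          intro c₃
          constructor
          · rintro ⟨h1, h2⟩
            refine Box.ext ?_ h2.symm
            change c₃.row = p.1.row - 1
            omega
          · rintro rfl
            refine ⟨?_, rfl⟩
            change p.1.row = p.1.row - 1 + 1
            omega
        have := cCIncreasing_iff (neg := neg) (σ p.1) (σ p.2) (σ d)
        have h0' : p.2.row ≠ 0 := hp1 ▸ h0
        simp only [hda, hp1, hp2, h0', true_and, false_and, false_or, exists_eq_left,
          Nat.cast_ite, Nat.cast_one, Nat.cast_zero]
        exact this.symm
    · have e : ∀ X : Prop, ¬ (p.1.row = p.2.row ∧ p.1.col < p.2.col ∧ X) :=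
        fun X h => hp ⟨h.1, h.2.1⟩
      simp only [e, if_false]
      simp
  · rw [Finset.disjoint_left]
    intro p hp hp'
    have := (Finset.mem_filter.mp hp).2.1
    have := (Finset.mem_filter.mp hp').2.1
    omega

end InversionPairs

/-! ### Haglund's formula as a window weight -/

section HaglundWeight

/-- The position of a box in the reading order; the difference of the positions of two boxes one
above the other is `μ.rowLen 0 + 1`. -/
def readingPos (c : Box μ) : ℤ := c.col - c.row * (μ.rowLen 0 + 1)

/-- The spacing `μ.rowLen 0 + 1` of the rows exceeds every difference of columns. Hence the boxes
inside the window after `u` are those to its right in its row and those strictly to its left in the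
row below, and the box at the end of the window is directly below `u`. -/
theorem readingPos_sub (u v : Box μ) :
    (0 < readingPos v - readingPos u ∧ readingPos v - readingPos u < μ.rowLen 0 + 1 ↔
      u.Attack v ∧ u.Precedes v) ∧
    (readingPos v - readingPos u = μ.rowLen 0 + 1 ↔ u.DirectlyAbove v) ∧
    (readingPos v = readingPos u → u = v) := by
  have hu : u.col < μ.rowLen 0 := u.col_lt.trans_le (μ.rowLen_anti _ _ (Nat.zero_le _))
  have hv : v.col < μ.rowLen 0 := v.col_lt.trans_le (μ.rowLen_anti _ _ (Nat.zero_le _))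
  set N : ℤ := μ.rowLen 0 + 1 with hN
  have hu' : (u.col : ℤ) < N - 1 := by rw [hN]; omega
  have hv' : (v.col : ℤ) < N - 1 := by rw [hN]; omega
  have hu0 : (0 : ℤ) ≤ u.col := by positivity
  have hv0 : (0 : ℤ) ≤ v.col := by positivity
  have hext : u.row = v.row → u.col = v.col → u = v := Box.ext
  have key : readingPos v - readingPos u = ((u.row : ℤ) - v.row) * N + (v.col - u.col) := by
    unfold readingPos; ring
  have key' : readingPos v = readingPos u ↔ readingPos v - readingPos u = 0 := by
    rw [sub_eq_zero]
  rw [key', key]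
  unfold Box.Attack Box.Precedes Box.DirectlyAbove
  rcases lt_trichotomy u.row v.row with h | h | h
  · have : ((u.row : ℤ) - v.row) * N ≤ (-1) * N :=
      mul_le_mul_of_nonneg_right (by omega) (by omega)
    refine ⟨⟨?_, ?_⟩, ⟨?_, ?_⟩, ?_⟩ <;> intros <;> omega
  · rw [h, sub_self, zero_mul, zero_add]
    refine ⟨⟨?_, ?_⟩, ⟨?_, ?_⟩, ?_⟩ <;> intros <;> first | omega | exact hext h (by omega)
  · rcases Nat.lt_or_ge (v.row + 1) u.row with h' | h'
    · have : 2 * N ≤ ((u.row : ℤ) - v.row) * N :=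
        mul_le_mul_of_nonneg_right (by omega) (by omega)
      refine ⟨⟨?_, ?_⟩, ⟨?_, ?_⟩, ?_⟩ <;> intros <;> omega
    · have : (u.row : ℤ) - v.row = 1 := by omega
      rw [this, one_mul]
      refine ⟨⟨?_, ?_⟩, ⟨?_, ?_⟩, ?_⟩ <;> intros <;> omega

theorem readingPos_injective : Function.Injective (readingPos : Box μ → ℤ) :=
  fun u v h => ((readingPos_sub v u).2.2 h).symm

/-- The weight of a pair of boxes, such that the weight of a filling in Haglund's formula is the
product of the weights of the pairs `(u, v)` with `σ(v) ≤₋ σ(u)`. -/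
def haglundWeight (u v : Box μ) : FieldQT :=
  windowWeight readingPos ((μ.rowLen 0 : ℕ) + 1) qq
    (fun u => (qq ^ u.arm)⁻¹ * tt ^ (u.leg + 1)) u v

theorem haglundWeight_eq (u v : Box μ) : haglundWeight u v =
    (if u.Attack v ∧ u.Precedes v then qq else 1) *
      if u.DirectlyAbove v then (qq ^ u.arm)⁻¹ * tt ^ (u.leg + 1) else 1 := by
  have h := readingPos_sub u v
  unfold haglundWeight windowWeight
  rw [if_congr h.1 rfl rfl, if_congr h.2.1 rfl rfl]
  by_cases h1 : u.Attack v ∧ u.Precedes v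
  · have h2 : ¬ u.DirectlyAbove v := fun h2 => by
      have h3 := h.1.mpr h1
      have h4 := h.2.1.mpr h2
      omega
    rw [if_pos h1, if_pos h1, if_neg h2, mul_one]
  · rw [if_neg h1, if_neg h1, one_mul]

variable {S : Type*} [LinearOrder S]

theorem inversionWeight_haglundWeight (neg : S → Prop) (σ : Filling μ S) :
    inversionWeight neg haglundWeight σ = qq ^ (invPairs neg σ).card * tt ^ maj neg σ := by
  have h1 : inversionWeight neg haglundWeight σ =
      (∏ u : Box μ, ∏ v : Box μ, if u.Attack v ∧ u.Precedes v ∧ LeNeg neg (σ v) (σ u) then qq else 1) *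
      ∏ u : Box μ, ∏ v : Box μ, if u.DirectlyAbove v ∧ LeNeg neg (σ v) (σ u) then
        (qq ^ u.arm)⁻¹ * tt ^ (u.leg + 1) else 1 := by
    simp only [inversionWeight, ← Finset.prod_mul_distrib]
    refine Finset.prod_congr rfl fun u _ => Finset.prod_congr rfl fun v _ => ?_
    rw [haglundWeight_eq]
    by_cases h : LeNeg neg (σ v) (σ u) <;> simp [h]
  have h2 : (∏ u : Box μ, ∏ v : Box μ,
      if u.Attack v ∧ u.Precedes v ∧ LeNeg neg (σ v) (σ u) then qq else 1) =
      qq ^ (invSet neg σ).card := by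
    rw [← Finset.prod_product', Finset.univ_product_univ, Finset.prod_ite, Finset.prod_const_one,
      mul_one, Finset.prod_const]
    rfl
  have h3 : (∏ u : Box μ, ∏ v : Box μ, if u.DirectlyAbove v ∧ LeNeg neg (σ v) (σ u) then
      (qq ^ u.arm)⁻¹ * tt ^ (u.leg + 1) else 1) =
      ∏ u ∈ desSet neg σ, ((qq ^ u.arm)⁻¹ * tt ^ (u.leg + 1)) := by
    rw [desSet, Finset.prod_filter]
    refine Finset.prod_congr rfl fun u _ => ?_
    split_ifs with h
    · obtain ⟨d, h1, h2⟩ := h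
      rw [Finset.prod_eq_single d, if_pos ⟨h1, h2⟩]
      · intro e _ hed
        refine if_neg fun h => hed ?_
        exact Box.ext (by have := h.1.1; have := h1.1; omega) (h.1.2.symm.trans h1.2)
      · exact fun h => absurd (Finset.mem_univ _) h
    · exact Finset.prod_eq_one fun v _ => if_neg fun h' => h ⟨v, h'⟩
  have h4 := inv_eq_card_invPairs neg σ
  have h5 : (invSet neg σ).card = (invPairs neg σ).card + ∑ c ∈ desSet neg σ, c.arm := by
    rw [inv] at h4
    have : ((∑ c ∈ desSet neg σ, c.arm : ℕ) : ℤ) = ∑ c ∈ desSet neg σ, (c.arm : ℤ) :=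
      Nat.cast_sum _ _
    omega
  rw [h1, h2, h3, Finset.prod_mul_distrib, Finset.prod_inv_distrib, Finset.prod_pow_eq_pow_sum,
    Finset.prod_pow_eq_pow_sum, h5, pow_add, maj]
  have := pow_ne_zero (∑ c ∈ desSet neg σ, c.arm) qq_ne_zero
  field_simp

theorem macdonaldH_eq (μ : YoungDiagram) : macdonaldH μ = fillingSeries id Set.univ
    fun σ : Filling μ ℕ+ => inversionWeight (fun _ => False) haglundWeight σ := by
  unfold macdonaldH
  congr 1
  funext σ
  rw [inversionWeight_haglundWeight, inv_eq_card_invPairs, zpow_natCast]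

theorem hasPowerSumExpansion_macdonaldH (μ : YoungDiagram) :
    HasPowerSumExpansion (macdonaldH μ) := by
  rw [macdonaldH_eq]
  refine hasPowerSumExpansion_inversionWeight fun A a b => ?_
  simp only [haglundWeight, map_windowWeight]
  exact twoLetterSum_windowWeight_comm readingPos_injective _ _ _ _ _ _

/-- The weights of the pairs containing a box `u` that does not lie in the bottom row. -/
theorem tt_mul_prod_haglundWeight {u : Box μ} (hu : 0 < u.row) :
    tt * ∏ v, haglundWeight v u = ∏ v, haglundWeight u v := by
  have hq := qq_ne_zero
  have hpow : ∀ (p : Box μ → Prop) [DecidablePred p], (∏ v, if p v then qq else 1) =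
      qq ^ (Finset.univ.filter p).card := by
    intro p _
    rw [Finset.prod_ite, Finset.prod_const_one, mul_one, Finset.prod_const]
  -- The boxes to the left of `u` in its row, and those strictly to its right in the row above.
  have hbefore : (Finset.univ.filter fun v : Box μ => v.Attack u ∧ v.Precedes u).card =
      u.col + (μ.rowLen (u.row + 1) - (u.col + 1)) := by
    rw [← Box.card_right, ← congrArg (· + _) (Box.card_left u le_rfl),
      ← Finset.card_union_of_disjoint]
    · congr 1
      ext v
      rw [Finset.mem_union, Finset.mem_filter, Finset.mem_filter, Finset.mem_filter]
      simp only [Finset.mem_univ, true_and, Box.Attack, Box.Precedes]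
      omega
    · rw [Finset.disjoint_left]
      intro v hv hv'
      have := (Finset.mem_filter.mp hv).2
      have := (Finset.mem_filter.mp hv').2
      omega
  -- The boxes to the right of `u` in its row, and those strictly to its left in the row below,
  -- which is where `0 < u.row` enters.
  have hafter : (Finset.univ.filter fun v => u.Attack v ∧ u.Precedes v).card =
      u.arm + u.col := by
    rw [Box.arm, ← Box.card_right,
      ← congrArg (_ + ·) (Box.card_left u (show u.row - 1 ≤ u.row by omega)),
      ← Finset.card_union_of_disjoint]
    · congr 1
      ext v
      rw [Finset.mem_union, Finset.mem_filter, Finset.mem_filter, Finset.mem_filter]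
      simp only [Finset.mem_univ, true_and, Box.Attack, Box.Precedes]
      omega
    · rw [Finset.disjoint_left]
      intro v hv hv'
      have := (Finset.mem_filter.mp hv).2
      have := (Finset.mem_filter.mp hv').2
      omega
  have hbelow : (∏ v, if u.DirectlyAbove v then (qq ^ u.arm)⁻¹ * tt ^ (u.leg + 1) else 1) =
      (qq ^ u.arm)⁻¹ * tt ^ (u.leg + 1) := by
    rw [Finset.prod_eq_single ⟨(u.row - 1, u.col), Box.mk_mem (c := u) (by omega) le_rfl⟩]
    · refine if_pos ⟨?_, rfl⟩
      change u.row = u.row - 1 + 1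
      omega
    · intro v _ hv
      refine if_neg fun h => hv (Box.ext ?_ h.2.symm)
      change v.row = u.row - 1
      have := h.1
      omega
    · exact fun h => absurd (Finset.mem_univ _) h
  have habove : (∏ v : Box μ, if v.DirectlyAbove u then (qq ^ v.arm)⁻¹ * tt ^ (v.leg + 1) else 1) =
      (qq ^ (μ.rowLen (u.row + 1) - (u.col + 1)))⁻¹ * tt ^ u.leg := by
    by_cases hm : (u.row + 1, u.col) ∈ μ.cells
    · rw [Finset.prod_eq_single ⟨(u.row + 1, u.col), hm⟩]
      · rw [if_pos ⟨rfl, rfl⟩]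
        congr 2
        change μ.colLen u.col - (u.row + 1 + 1) + 1 = μ.colLen u.col - (u.row + 1)
        have := Box.mem_iff'.mp hm
        omega
      · intro v _ hv
        exact if_neg fun h => hv (Box.ext h.1 h.2)
      · exact fun h => absurd (Finset.mem_univ _) h
    -- Without a box above `u` both exponents are `0`, that of `q` by truncated subtraction.
    · have h1 := mt Box.mem_iff.mpr hm
      have h2 := mt Box.mem_iff'.mpr hm
      have h3 : u.leg = 0 := by
        unfold Box.leg; omega
      rw [Finset.prod_eq_one, h3, Nat.sub_eq_zero_of_le (by omega)]
      · simp
      · intro v _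
        refine if_neg fun h => hm ?_
        have : v.1 = (u.row + 1, u.col) := Prod.ext h.1 h.2
        exact this ▸ v.2
  -- On either side the arm cancels and the power of `q` is the number of columns to the left of
  -- `u`; the powers of `t` are `t ^ u.leg` and `t ^ (u.leg + 1)`.
  simp only [haglundWeight_eq, Finset.prod_mul_distrib]
  rw [hpow, hpow, hbefore, hafter, hbelow, habove, pow_add, pow_add]
  have h1 := pow_ne_zero u.arm hq
  have h2 := pow_ne_zero (μ.rowLen (u.row + 1) - (u.col + 1)) hq
  field_simp
  exact (pow_succ' _ _).symm

end HaglundWeight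

/-! ### Cancellation of the incompatible super fillings -/

section Compatibility

/-- The weight of a filling, split according to whether the pairs contain the box `u`. -/
theorem inversionWeight_eq_mul {ι S R : Type*} [Fintype ι] [DecidableEq ι] [LinearOrder S] [CommRing R]
    (neg : S → Prop) {c : ι → ι → R} {u : ι} (hu : c u u = 1) (σ : ι → S) :
    inversionWeight neg c σ =
      (∏ a ∈ Finset.univ.erase u, ∏ b ∈ Finset.univ.erase u,
        if LeNeg neg (σ b) (σ a) then c a b else 1) *
      ((∏ b, if LeNeg neg (σ b) (σ u) then c u b else 1) *
        ∏ a, if LeNeg neg (σ u) (σ a) then c a u else 1) := by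
  have h1 : ∀ a, (∏ b, if LeNeg neg (σ b) (σ a) then c a b else 1) =
      (if LeNeg neg (σ u) (σ a) then c a u else 1) *
        ∏ b ∈ Finset.univ.erase u, if LeNeg neg (σ b) (σ a) then c a b else 1 := fun a =>
    (Finset.mul_prod_erase _ _ (Finset.mem_univ u)).symm
  rw [inversionWeight, ← Finset.mul_prod_erase _ _ (Finset.mem_univ u)]
  simp only [h1 _, Finset.prod_mul_distrib]
  rw [← Finset.mul_prod_erase Finset.univ _ (Finset.mem_univ u), hu]
  simp only [ite_self, one_mul]
  ring

namespace SuperLetter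

/-- The letter with the same absolute value and the opposite sign. -/
def flip (a : SuperLetter) : SuperLetter := if a.IsNeg then pos a.abs else bar a.abs

theorem flip_pos (i : ℕ+) : flip (pos i) = bar i := if_neg (not_isNeg_pos i)

theorem flip_bar (i : ℕ+) : flip (bar i) = pos i := if_pos (isNeg_bar i)

theorem abs_flip (a : SuperLetter) : (flip a).abs = a.abs := by
  unfold flip; split_ifs <;> rfl

theorem flip_flip (a : SuperLetter) : flip (flip a) = a := by
  rcases eq_pos_or_eq_bar a with ⟨i, rfl⟩ | ⟨i, rfl⟩
  · rw [flip_pos, flip_bar]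
  · rw [flip_bar, flip_pos]

theorem flip_ne (a : SuperLetter) : flip a ≠ a := by
  rcases eq_pos_or_eq_bar a with ⟨i, rfl⟩ | ⟨i, rfl⟩
  · rw [flip_pos]; exact (pos_ne_bar _ _).symm
  · rw [flip_bar]; exact pos_ne_bar _ _

theorem leNeg_pos_of_abs_lt {i : ℕ+} {a : SuperLetter} (h : i < a.abs) :
    LeNeg IsNeg (pos i) a ∧ ¬ LeNeg IsNeg a (pos i) ∧ LeNeg IsNeg a (bar i) ∧
      ¬ LeNeg IsNeg (bar i) a := by
  have h1 : pos i < a ∧ a < bar i := by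
    rcases eq_pos_or_eq_bar a with ⟨j, rfl⟩ | ⟨j, rfl⟩
    · exact ⟨pos_lt_pos.mpr h, pos_lt_bar _ _⟩
    · exact ⟨pos_lt_bar _ _, bar_lt_bar.mpr h⟩
  exact ⟨Or.inl h1.1, fun h => (h.le.trans_lt h1.1).false, Or.inl h1.2,
    fun h => (h.le.trans_lt h1.2).false⟩

theorem leNeg_pos_of_abs_eq {a : SuperLetter} :
    ¬ LeNeg IsNeg a (pos a.abs) ∧ LeNeg IsNeg a (bar a.abs) := by
  rcases eq_pos_or_eq_bar a with ⟨j, rfl⟩ | ⟨j, rfl⟩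
  · refine ⟨?_, Or.inl (pos_lt_bar _ _)⟩
    rintro (h | h)
    exacts [h.false, not_isNeg_pos _ h.2]
  · refine ⟨?_, Or.inr ⟨rfl, isNeg_bar _⟩⟩
    exact fun h => ((pos_lt_bar _ _).trans_le h.le).false

end SuperLetter

theorem haglundWeight_self (u : Box μ) : haglundWeight u u = 1 := by
  rw [haglundWeight_eq, if_neg, if_neg, mul_one]
  · exact fun h => by have := h.1; omega
  · rintro ⟨-, h⟩
    unfold Box.Precedes at h
    omega

theorem haglundWeight_eq_one_of_readingPos_le {u v : Box μ} (h : readingPos v ≤ readingPos u) :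
    haglundWeight u v = 1 := by
  unfold haglundWeight windowWeight
  rw [if_neg (by omega), if_neg (by omega)]

theorem haglundWeight_eq_one_of_row {u v : Box μ}
    (h : v.row + 1 < u.row ∨ u.row + 1 < v.row) : haglundWeight u v = 1 := by
  rw [haglundWeight_eq, if_neg, if_neg, mul_one]
  · exact fun h => by have := h.1; omega
  · rintro ⟨h, -⟩
    unfold Box.Attack at h
    omega

/-- The box `u` is the first one in the reading order that carries the letter `k` or `k̄`, where `k`
is the least absolute value of an entry smaller than the number of its row. -/
def IsPivot (σ : Filling μ SuperLetter) (u : Box μ) : Prop :=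
  ((σ u).abs : ℕ) < u.row + 1 ∧
    (∀ v : Box μ, ((σ v).abs : ℕ) < v.row + 1 → (σ u).abs ≤ (σ v).abs) ∧
    ∀ v : Box μ, (σ v).abs = (σ u).abs → readingPos u ≤ readingPos v

theorem exists_isPivot {σ : Filling μ SuperLetter} (h : ¬ IsCompatible σ) : ∃ u, IsPivot σ u := by
  unfold IsCompatible at h
  push Not at h
  obtain ⟨w, hw⟩ := h
  obtain ⟨k, hk, hmin⟩ := Finset.exists_min_image
    (Finset.univ.filter fun v : Box μ => ((σ v).abs : ℕ) < v.row + 1) (fun v => (σ v).abs)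
    ⟨w, by simpa using hw⟩
  obtain ⟨u, hu, humin⟩ := Finset.exists_min_image
    (Finset.univ.filter fun v : Box μ => (σ v).abs = (σ k).abs) readingPos ⟨k, by simp⟩
  have hk := (Finset.mem_filter.mp hk).2
  have hu := (Finset.mem_filter.mp hu).2
  refine ⟨u, ?_, fun v hv => ?_, fun v hv => humin v (by simp [hv, hu])⟩
  -- The first box with this absolute value lies in the row of `k` or higher, so its entry is too
  -- small for its row as well.
  · have h1 : ¬ u.row < k.row := by
      intro h1
      have h2 := humin k (by simp)
      have h3 := Box.col_lt k
      have h4 := Box.col_lt u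
      have h5 := μ.rowLen_anti _ _ (Nat.zero_le k.row)
      have h6 : ((k.row : ℤ) - u.row) * (μ.rowLen 0 + 1) ≥ 1 * (μ.rowLen 0 + 1) :=
        mul_le_mul_of_nonneg_right (by omega) (by positivity)
      unfold readingPos at h2
      rw [sub_mul] at h6
      omega
    rw [hu]; omega
  · rw [hu]; exact hmin v (by simpa using hv)

theorem IsPivot.unique {σ : Filling μ SuperLetter} {u v : Box μ} (hu : IsPivot σ u)
    (hv : IsPivot σ v) : u = v := by
  have h : (σ u).abs = (σ v).abs := le_antisymm (hu.2.1 v hv.1) (hv.2.1 u hu.1)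
  exact readingPos_injective (le_antisymm (hu.2.2 v h.symm) (hv.2.2 u h))

theorem IsPivot.congr {σ τ : Filling μ SuperLetter} (h : ∀ c, (σ c).abs = (τ c).abs) {u : Box μ}
    (hu : IsPivot σ u) : IsPivot τ u := by
  unfold IsPivot at hu ⊢
  simpa only [h] using hu

/-- Reversing the sign of the entry of the pivot from positive to negative multiplies the weight by
`t`. -/
theorem tt_mul_inversionWeight_update {σ : Filling μ SuperLetter} {u : Box μ} (hu : IsPivot σ u) :
    tt * inversionWeight IsNeg haglundWeight (Function.update σ u (pos (σ u).abs)) =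
      inversionWeight IsNeg haglundWeight (Function.update σ u (bar (σ u).abs)) := by
  obtain ⟨h1, h2, h3⟩ := hu
  have hrow : 0 < u.row := by have := (σ u).abs.pos; omega
  -- By minimality a smaller absolute value respects its row, which places its box at least two rows
  -- below `u`, out of reach of the weight.
  have hlow : ∀ v, (σ v).abs < (σ u).abs → haglundWeight u v = 1 ∧ haglundWeight v u = 1 := by
    intro v hv
    have h4 : ¬ ((σ v).abs : ℕ) < v.row + 1 := fun h => (hv.trans_le (h2 v h)).false
    have h5 : ((σ v).abs : ℕ) < (σ u).abs := hv
    have h6 : v.row + 1 < u.row := by omega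
    exact ⟨haglundWeight_eq_one_of_row (Or.inl h6), haglundWeight_eq_one_of_row (Or.inr h6)⟩
  have hoff : ∀ x v, v ≠ u → Function.update σ u x v = σ v := fun x v hv =>
    Function.update_of_ne hv _ _
  have hcomm : ∀ x : SuperLetter, (∏ a ∈ Finset.univ.erase u, ∏ b ∈ Finset.univ.erase u,
      if LeNeg IsNeg (Function.update σ u x b) (Function.update σ u x a) then
        haglundWeight a b else 1) = ∏ a ∈ Finset.univ.erase u, ∏ b ∈ Finset.univ.erase u,
      if LeNeg IsNeg (σ b) (σ a) then haglundWeight a b else 1 := by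
    intro x
    refine Finset.prod_congr rfl fun a ha => Finset.prod_congr rfl fun b hb => ?_
    rw [hoff _ _ (Finset.ne_of_mem_erase ha), hoff _ _ (Finset.ne_of_mem_erase hb)]
  rw [inversionWeight_eq_mul IsNeg (haglundWeight_self u),
    inversionWeight_eq_mul IsNeg (haglundWeight_self u), hcomm, hcomm, mul_left_comm]
  congr 1
  simp only [Function.update_self]
  -- With the positive letter, `u` is below every entry of larger absolute value, so exactly the
  -- weights of the pairs `(a, u)` count; with the barred letter it is above them, and exactly the
  -- weights of the pairs `(u, b)` count. Entries of equal absolute value never dominate the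
  -- positive letter and are always dominated by the barred one; they fit both patterns because
  -- their boxes come after `u`, so that pairs ending at `u` have weight `1`.
  have e1 : (∏ b, if LeNeg IsNeg (Function.update σ u (pos (σ u).abs) b) (pos (σ u).abs) then
      haglundWeight u b else 1) = 1 := by
    refine Finset.prod_eq_one fun b _ => ?_
    by_cases hb : b = u
    · rw [hb, haglundWeight_self, ite_self]
    rw [hoff _ _ hb]
    rcases lt_trichotomy (σ b).abs (σ u).abs with h | h | h
    · rw [(hlow b h).1, ite_self]
    · rw [if_neg]; rw [← h]; exact leNeg_pos_of_abs_eq.1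
    · rw [if_neg (leNeg_pos_of_abs_lt h).2.1]
  have e2 : (∏ a, if LeNeg IsNeg (pos (σ u).abs) (Function.update σ u (pos (σ u).abs) a) then
      haglundWeight a u else 1) = ∏ a, haglundWeight a u := by
    refine Finset.prod_congr rfl fun b _ => ?_
    by_cases hb : b = u
    · rw [hb, haglundWeight_self, ite_self]
    rw [hoff _ _ hb]
    rcases lt_trichotomy (σ b).abs (σ u).abs with h | h | h
    · rw [(hlow b h).2, ite_self]
    · rw [haglundWeight_eq_one_of_readingPos_le (h3 b h), ite_self]
    · rw [if_pos (leNeg_pos_of_abs_lt h).1]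
  have e3 : (∏ b, if LeNeg IsNeg (Function.update σ u (bar (σ u).abs) b) (bar (σ u).abs) then
      haglundWeight u b else 1) = ∏ b, haglundWeight u b := by
    refine Finset.prod_congr rfl fun b _ => ?_
    by_cases hb : b = u
    · rw [hb, haglundWeight_self, ite_self]
    rw [hoff _ _ hb]
    rcases lt_trichotomy (σ b).abs (σ u).abs with h | h | h
    · rw [(hlow b h).1, ite_self]
    · rw [if_pos]; rw [← h]; exact leNeg_pos_of_abs_eq.2
    · rw [if_pos (leNeg_pos_of_abs_lt h).2.2.1]
  have e4 : (∏ a, if LeNeg IsNeg (bar (σ u).abs) (Function.update σ u (bar (σ u).abs) a) then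
      haglundWeight a u else 1) = 1 := by
    refine Finset.prod_eq_one fun b _ => ?_
    by_cases hb : b = u
    · rw [hb, haglundWeight_self, ite_self]
    rw [hoff _ _ hb]
    rcases lt_trichotomy (σ b).abs (σ u).abs with h | h | h
    · rw [(hlow b h).2, ite_self]
    · rw [haglundWeight_eq_one_of_readingPos_le (h3 b h), ite_self]
    · rw [if_neg (leNeg_pos_of_abs_lt h).2.2.2]
  rw [e1, e2, e3, e4, one_mul, mul_one, tt_mul_prod_haglundWeight hrow]

/-- The weight of a super filling `σ` in the plethystic substitution. -/
def signedWeight (σ : Filling μ SuperLetter) : FieldQT :=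
  qq ^ (invPairs IsNeg σ).card * tt ^ maj IsNeg σ * ((-1) ^ numNeg σ * tt ^ numPos σ)

theorem neg_one_pow_numNeg_mul (σ : Filling μ SuperLetter) : (-1) ^ numNeg σ * tt ^ numPos σ =
    ∏ c, if (σ c).IsNeg then (-1 : FieldQT) else tt := by
  rw [Finset.prod_ite, Finset.prod_const, Finset.prod_const]
  rfl

/-- The positive letter brings the factor `t` and the barred one `-1`, while the inversion weight
with the barred letter is `t` times the other. -/
theorem signedWeight_update_add {σ : Filling μ SuperLetter} {u : Box μ} (hu : IsPivot σ u) :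
    signedWeight (Function.update σ u (pos (σ u).abs)) +
      signedWeight (Function.update σ u (bar (σ u).abs)) = 0 := by
  have h : ∀ x : SuperLetter, (∏ c, if (Function.update σ u x c).IsNeg then (-1 : FieldQT) else tt) =
      (if x.IsNeg then -1 else tt) *
        ∏ c ∈ Finset.univ.erase u, if (σ c).IsNeg then (-1 : FieldQT) else tt := by
    intro x
    rw [← Finset.mul_prod_erase _ _ (Finset.mem_univ u), Function.update_self]
    congr 1
    refine Finset.prod_congr rfl fun c hc => ?_
    rw [Function.update_of_ne (Finset.ne_of_mem_erase hc)]
  unfold signedWeight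
  rw [← inversionWeight_haglundWeight, ← inversionWeight_haglundWeight, neg_one_pow_numNeg_mul,
    neg_one_pow_numNeg_mul, ← tt_mul_inversionWeight_update hu, h, h, if_neg (not_isNeg_pos _),
    if_pos (isNeg_bar _)]
  ring

/-- The plethystic substitution `X(t - 1)` in the Macdonald polynomial, in finitely many variables:
only the compatible super fillings contribute. -/
theorem killCompl_aeval_macdonaldH {P : MvPolynomial ℕ+ FieldQT}
    (hP : IsPowerSumExpansion (macdonaldH μ) P) (A : Finset ℕ+) :
    killCompl A (MvPolynomial.aeval (fun k : ℕ+ => powerSumAt k alphabetXtSubOne) P) =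
      ∑ σ ∈ Fintype.piFinset fun c : Box μ =>
          (superAlphabet A A).filter fun a => c.row + 1 ≤ (a.abs : ℕ),
        MvPowerSeries.C (signedWeight σ) * ∏ c, MvPowerSeries.X (σ c).abs := by
  have hT : ∀ a, a ∈ superAlphabet A A ↔ a.abs ∈ A := by
    intro a
    rcases eq_pos_or_eq_bar a with ⟨i, rfl⟩ | ⟨i, rfl⟩
    · rw [pos_mem_superAlphabet, SuperLetter.abs_pos]
    · rw [bar_mem_superAlphabet, abs_bar]
  rw [macdonaldH_eq] at hP
  have e := aeval_powerSumAt_eq_fillingSeries readingPos_injective hP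
  rw [e, killCompl_fillingSeries _ _ _ _ _ hT]
  have hw : ∀ σ : Filling μ SuperLetter, inversionWeight IsNeg (windowWeight readingPos
      ((μ.rowLen 0 : ℕ) + 1) qq (fun u => (qq ^ u.arm)⁻¹ * tt ^ (u.leg + 1))) σ *
      ((-1) ^ numNeg σ * tt ^ numPos σ) = signedWeight σ := by
    intro σ
    rw [signedWeight, ← inversionWeight_haglundWeight]
    rfl
  simp only [hw]
  have hsub : (Fintype.piFinset fun c : Box μ =>
      (superAlphabet A A).filter fun a => c.row + 1 ≤ (a.abs : ℕ)) ⊆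
      (Fintype.piFinset fun _ : Box μ => superAlphabet A A).filter fun σ => σ ∈ Set.univ := by
    intro σ hσ
    rw [Finset.mem_filter]
    refine ⟨?_, trivial⟩
    simp only [Fintype.mem_piFinset, Finset.mem_filter] at hσ ⊢
    exact fun c => (hσ c).1
  have hmem : ∀ σ : Filling μ SuperLetter,
      σ ∈ ((Fintype.piFinset fun _ : Box μ => superAlphabet A A).filter fun σ => σ ∈ Set.univ) \
        (Fintype.piFinset fun c : Box μ =>
          (superAlphabet A A).filter fun a => c.row + 1 ≤ (a.abs : ℕ)) ↔
      (∀ c, (σ c).abs ∈ A) ∧ ¬ IsCompatible σ := by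
    intro σ
    rw [Finset.mem_sdiff, Finset.mem_filter]
    simp only [Fintype.mem_piFinset, Finset.mem_filter, hT, Set.mem_univ, and_true]
    exact and_congr_right fun h => not_congr ⟨fun h' c => (h' c).2, fun h' c => ⟨h c, h' c⟩⟩
  refine Eq.trans ?_ ((Finset.sum_sdiff hsub).symm.trans ((congrArg (· + _) ?_).trans (zero_add _)))
  · congr!
  have habs : ∀ (σ : Filling μ SuperLetter) (u c : Box μ),
      (Function.update σ u (flip (σ u)) c).abs = (σ c).abs := by
    intro σ u c
    by_cases hc : c = u
    · rw [hc, Function.update_self, abs_flip]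
    · rw [Function.update_of_ne hc]
  -- Choosing pivots by a total function requires a box as default value; without boxes every
  -- filling is compatible.
  rcases isEmpty_or_nonempty (Box μ) with hemp | hne
  · exact Finset.sum_eq_zero fun σ hσ => absurd (fun c => hemp.elim c) ((hmem σ).mp hσ).2
  choose! p hp using fun σ : Filling μ SuperLetter => exists_isPivot (σ := σ)
  have hcomp : ∀ (σ : Filling μ SuperLetter) (u : Box μ),
      ¬ IsCompatible σ → ¬ IsCompatible (Function.update σ u (flip (σ u))) := by
    intro σ u h h'
    exact h fun c => (habs σ u c) ▸ h' c
  refine Finset.sum_involution (fun σ _ => Function.update σ (p σ) (flip (σ (p σ)))) ?_ ?_ ?_ ?_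
  · intro σ hσ
    have hpiv := hp σ ((hmem σ).mp hσ).2
    simp only [habs]
    rw [← add_mul, ← map_add]
    have := signedWeight_update_add hpiv
    rcases eq_pos_or_eq_bar (σ (p σ)) with ⟨i, hi⟩ | ⟨i, hi⟩
    · rw [hi, SuperLetter.abs_pos] at this
      rw [hi, flip_pos]
      nth_rw 1 [← hi] at this
      rw [Function.update_eq_self] at this
      rw [this, map_zero, zero_mul]
    · rw [hi, abs_bar] at this
      rw [hi, flip_bar, add_comm]
      nth_rw 1 [← hi] at this
      rw [Function.update_eq_self] at this
      rw [this, map_zero, zero_mul]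
  · intro σ _ _ h
    have := congrFun h (p σ)
    rw [Function.update_self] at this
    exact flip_ne _ this
  · intro σ hσ
    rw [hmem] at hσ ⊢
    exact ⟨fun c => by rw [habs]; exact hσ.1 c, hcomp _ _ hσ.2⟩
  · intro σ hσ
    have h1 := ((hmem σ).mp hσ).2
    -- Pivots depend on absolute values only, so flipping the sign keeps the pivot and the map is an
    -- involution.
    have h2 : p (Function.update σ (p σ) (flip (σ (p σ)))) = p σ :=
      (hp _ (hcomp σ (p σ) h1)).unique ((hp σ h1).congr fun c => (habs σ _ c).symm)
    simp only [h2, Function.update_self, SuperLetter.flip_flip, Function.update_idem, Function.update_eq_self]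

end Compatibility

/-! ### Ranks in a finite ordered set -/

section Rank

variable {α : Type*} [LinearOrder α]

/-- The number of elements of `F` below `x`. -/
def rank (F : Finset α) (x : α) : ℕ := (F.filter (· < x)).card

theorem rank_lt_rank {F : Finset α} {x y : α} (hx : x ∈ F) : rank F x < rank F y ↔ x < y := by
  constructor
  · intro h
    by_contra! hxy
    refine absurd h (not_lt.mpr (Finset.card_le_card fun z hz => ?_))
    rw [Finset.mem_filter] at hz ⊢
    exact ⟨hz.1, hz.2.trans_le hxy⟩
  · intro h
    refine Finset.card_lt_card ⟨fun z hz => ?_, fun hsub => ?_⟩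
    · rw [Finset.mem_filter] at hz ⊢
      exact ⟨hz.1, hz.2.trans h⟩
    · exact ((Finset.mem_filter.mp (hsub (Finset.mem_filter.mpr ⟨hx, h⟩))).2).false

theorem rank_inj {F : Finset α} {x y : α} (hx : x ∈ F) (hy : y ∈ F) :
    rank F x = rank F y ↔ x = y := by
  refine ⟨fun h => ?_, fun h => h ▸ rfl⟩
  rcases lt_trichotomy x y with h' | h' | h'
  · exact absurd h ((rank_lt_rank hx).mpr h').ne
  · exact h'
  · exact absurd h ((rank_lt_rank hy).mpr h').ne'

theorem rank_orderEmbOfFin (F : Finset α) (i : Fin F.card) :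
    rank F (F.orderEmbOfFin rfl i) = i := by
  have h : F.filter (· < F.orderEmbOfFin rfl i) =
      (Finset.univ.filter (· < i)).map (F.orderEmbOfFin rfl).toEmbedding := by
    ext x
    simp only [Finset.mem_filter, Finset.mem_map, Finset.mem_univ, true_and]
    constructor
    · rintro ⟨h1, h2⟩
      rw [← Finset.mem_coe, ← Finset.range_orderEmbOfFin F rfl] at h1
      obtain ⟨k, rfl⟩ := h1
      exact ⟨k, (F.orderEmbOfFin rfl).lt_iff_lt.mp h2, rfl⟩
    · rintro ⟨k, h1, rfl⟩
      exact ⟨Finset.orderEmbOfFin_mem _ _ _, (F.orderEmbOfFin rfl).lt_iff_lt.mpr h1⟩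
  have h' : Finset.univ.filter (· < i) = Finset.Iio i := by
    ext k
    rw [Finset.mem_filter, Finset.mem_Iio]
    exact and_iff_right (Finset.mem_univ _)
  rw [rank, h, Finset.card_map, h', Fin.card_Iio]

theorem exists_rank_eq {F : Finset α} {i : ℕ} (hi : i < F.card) : ∃ x ∈ F, rank F x = i :=
  ⟨_, Finset.orderEmbOfFin_mem F rfl ⟨i, hi⟩, rank_orderEmbOfFin F ⟨i, hi⟩⟩

/-- An initial segment of `F` consists of the elements of rank less than its cardinality. -/
theorem rank_lt_card_filter {F : Finset α} {p : α → Prop} [DecidablePred p]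
    (hp : ∀ x y, x ≤ y → p y → p x) {x : α} (hx : x ∈ F) : rank F x < (F.filter p).card ↔ p x := by
  constructor
  · intro h
    by_contra hpx
    refine absurd h (not_lt.mpr (Finset.card_le_card fun z hz => ?_))
    rw [Finset.mem_filter] at hz ⊢
    exact ⟨hz.1, lt_of_not_ge fun hxz => hpx (hp _ _ hxz hz.2)⟩
  · intro h
    refine Finset.card_lt_card ⟨fun z hz => ?_, fun hsub => ?_⟩
    · rw [Finset.mem_filter] at hz ⊢
      exact ⟨hz.1, hp _ _ hz.2.le h⟩
    · exact ((Finset.mem_filter.mp (hsub (Finset.mem_filter.mpr ⟨hx, h⟩))).2).false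

end Rank

/-! ### The diagram of `λ^B` inside that of `λ^{[r]}` -/

section Columns

variable {r : ℕ} (L : Fin r → YoungDiagram)

/-- The length of a column. -/
def columnLen (x : ℕᵒᵈ ×ₗ (Fin r ×ₗ ℕ)) : ℕ := OrderDual.ofDual (ofLex x).1

/-- The colour of a column. -/
def columnColor (x : ℕᵒᵈ ×ₗ (Fin r ×ₗ ℕ)) : Fin r := (ofLex (ofLex x).2).1

/-- The columns with colours in `B`. -/
def columnsOn (B : Finset (Fin r)) : Finset (ℕᵒᵈ ×ₗ (Fin r ×ₗ ℕ)) :=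
  (columns L).filter fun x => columnColor x ∈ B

theorem columnLen_anti {x y : ℕᵒᵈ ×ₗ (Fin r ×ₗ ℕ)} (h : x ≤ y) : columnLen y ≤ columnLen x := by
  have := Prod.Lex.monotone_fst x y h
  exact this

theorem columnsOn_univ : columnsOn L Finset.univ = columns L :=
  Finset.filter_true_of_mem fun _ _ => Finset.mem_univ _

/-- A column is longer than `j` exactly when it meets row `j`, so both sides count the boxes of that
row of `λ^B`. -/
theorem card_columnsOn_filter (B : Finset (Fin r)) (j : ℕ) :
    ((columnsOn L B).filter fun x => j < columnLen x).card = ∑ b ∈ B, (L b).rowLen j := by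
  have h : (columnsOn L B).filter (fun x => j < columnLen x) =
      (B.sigma fun b => Finset.range ((L b).rowLen j)).image fun x =>
        toLex (OrderDual.toDual ((L x.1).colLen x.2), toLex (x.1, x.2)) := by
    ext x
    simp only [columnsOn, columns, Finset.mem_filter, Finset.mem_image, Finset.mem_sigma,
      Finset.mem_univ, true_and, Finset.mem_range]
    constructor
    · rintro ⟨⟨⟨⟨b, k⟩, h1, rfl⟩, h2⟩, h3⟩
      exact ⟨⟨b, k⟩, ⟨h2, Box.mem_iff.mp (Box.mem_iff'.mpr h3)⟩, rfl⟩
    · rintro ⟨⟨b, k⟩, ⟨h1, h2⟩, rfl⟩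
      exact ⟨⟨⟨⟨b, k⟩, h2.trans_le ((L b).rowLen_anti _ _ (Nat.zero_le _)), rfl⟩, h1⟩,
        Box.mem_iff'.mp (Box.mem_iff.mpr h2)⟩
  rw [h, Finset.card_image_of_injective]
  · simp
  · rintro ⟨b, k⟩ ⟨b', k'⟩ h
    simp only [EmbeddingLike.apply_eq_iff_eq, Prod.mk.injEq] at h
    obtain ⟨-, rfl, rfl⟩ := h
    rfl

variable {L}

/-- The boxes of `λ^B` in terms of the columns of the diagrams `λ^b`. -/
theorem mem_sumDiagram_rank {B : Finset (Fin r)} {x : ℕᵒᵈ ×ₗ (Fin r ×ₗ ℕ)}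
    (hx : x ∈ columnsOn L B) (j : ℕ) :
    (j, rank (columnsOn L B) x) ∈ (sumDiagram L B).cells ↔ j < columnLen x := by
  rw [YoungDiagram.mem_cells, mem_sumDiagram, ← card_columnsOn_filter]
  exact rank_lt_card_filter (p := fun x => j < columnLen x) (fun _ _ h h' => lt_of_lt_of_le h' (columnLen_anti h)) hx

theorem colLen_rank {B : Finset (Fin r)} {x : ℕᵒᵈ ×ₗ (Fin r ×ₗ ℕ)} (hx : x ∈ columnsOn L B) :
    (sumDiagram L B).colLen (rank (columnsOn L B) x) = columnLen x :=
  eq_of_forall_lt_iff fun j => by rw [← Box.mem_iff', mem_sumDiagram_rank hx]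

theorem exists_rank_eq_col {B : Finset (Fin r)} (c : Box (sumDiagram L B)) :
    ∃ x ∈ columnsOn L B, rank (columnsOn L B) x = c.col := by
  refine exists_rank_eq ?_
  have h := c.2
  rw [YoungDiagram.mem_cells, mem_sumDiagram L B c.1.1 c.1.2, ← card_columnsOn_filter] at h
  exact h.trans_le (Finset.card_filter_le _ _)

/-- The column of a box of `λ^{[r]}`. -/
def boxColumn (c : Box (sumDiagram L Finset.univ)) : ℕᵒᵈ ×ₗ (Fin r ×ₗ ℕ) :=
  (columns L).orderEmbOfFin rfl ⟨c.col, col_lt_card_columns L c⟩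

theorem boxColumn_mem (c : Box (sumDiagram L Finset.univ)) : boxColumn c ∈ columns L :=
  Finset.orderEmbOfFin_mem _ _ _

theorem rank_boxColumn (c : Box (sumDiagram L Finset.univ)) :
    rank (columns L) (boxColumn c) = c.col := rank_orderEmbOfFin _ _

theorem columnColor_boxColumn (c : Box (sumDiagram L Finset.univ)) :
    columnColor (boxColumn c) = color L c := rfl

theorem boxColumn_lt {c d : Box (sumDiagram L Finset.univ)} :
    boxColumn c < boxColumn d ↔ c.col < d.col := by
  rw [← rank_boxColumn, ← rank_boxColumn, rank_lt_rank (boxColumn_mem c)]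

theorem boxColumn_inj {c d : Box (sumDiagram L Finset.univ)} :
    boxColumn c = boxColumn d ↔ c.col = d.col := by
  rw [← rank_boxColumn, ← rank_boxColumn, rank_inj (boxColumn_mem c) (boxColumn_mem d)]

theorem colLen_col (c : Box (sumDiagram L Finset.univ)) :
    (sumDiagram L Finset.univ).colLen c.col = columnLen (boxColumn c) := by
  have h := colLen_rank (L := L) (B := Finset.univ) (x := boxColumn c)
    ((columnsOn_univ L).symm ▸ boxColumn_mem c)
  rwa [columnsOn_univ, rank_boxColumn] at h

variable (L) in
/-- The boxes of `λ^{[r]}` with colours in `B`. -/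
abbrev ColoredBox (B : Finset (Fin r)) := {c : Box (sumDiagram L Finset.univ) // color L c ∈ B}

theorem boxColumn_mem_columnsOn {B : Finset (Fin r)} (c : ColoredBox L B) :
    boxColumn c.1 ∈ columnsOn L B := Finset.mem_filter.mpr ⟨boxColumn_mem _, c.2⟩

/-- The boxes of `λ^{[r]}` with colours in `B` form a copy of `λ^B`. -/
def coloredBoxMap {B : Finset (Fin r)} (c : ColoredBox L B) : Box (sumDiagram L B) :=
  ⟨(c.1.row, rank (columnsOn L B) (boxColumn c.1)),
    (mem_sumDiagram_rank (boxColumn_mem_columnsOn c) _).mpr (colLen_col c.1 ▸ c.1.row_lt)⟩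

variable {B : Finset (Fin r)}

theorem row_coloredBoxMap (c : ColoredBox L B) : (coloredBoxMap c).row = c.1.row := rfl

theorem col_coloredBoxMap_lt {c d : ColoredBox L B} :
    (coloredBoxMap c).col < (coloredBoxMap d).col ↔ c.1.col < d.1.col :=
  (rank_lt_rank (boxColumn_mem_columnsOn c)).trans boxColumn_lt

theorem col_coloredBoxMap_inj {c d : ColoredBox L B} :
    (coloredBoxMap c).col = (coloredBoxMap d).col ↔ c.1.col = d.1.col :=
  (rank_inj (boxColumn_mem_columnsOn c) (boxColumn_mem_columnsOn d)).trans boxColumn_inj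

/-- Columns keep their lengths, hence boxes their legs. Arms may change on passing from `λ^{[r]}` to
`λ^B`, which is why `inv` is replaced by the number of inversion pairs. -/
theorem leg_coloredBoxMap (c : ColoredBox L B) : (coloredBoxMap c).leg = c.1.leg := by
  unfold Box.leg
  rw [colLen_col c.1]
  congr 1
  exact colLen_rank (boxColumn_mem_columnsOn c)

theorem coloredBoxMap_bijective : Function.Bijective (coloredBoxMap : ColoredBox L B → _) := by
  constructor
  · intro c d h
    refine Subtype.ext (Box.ext ?_ (col_coloredBoxMap_inj.mp (congrArg Box.col h)))
    rw [← row_coloredBoxMap, h, row_coloredBoxMap]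
  · intro c
    obtain ⟨x, hx, hxc⟩ := exists_rank_eq_col c
    have hx' := (Finset.mem_filter.mp hx).1
    have hlen : c.row < columnLen x := by
      rw [← mem_sumDiagram_rank hx, hxc]
      exact c.2
    have hmem : (c.row, rank (columns L) x) ∈ (sumDiagram L Finset.univ).cells := by
      have := mem_sumDiagram_rank (L := L) (B := Finset.univ) (x := x)
        ((columnsOn_univ L).symm ▸ hx') c.row
      rw [columnsOn_univ] at this
      exact this.mpr hlen
    have hcol : boxColumn (⟨(c.row, rank (columns L) x), hmem⟩ : Box (sumDiagram L Finset.univ)) = x := by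
      rw [← rank_inj (boxColumn_mem _) hx', rank_boxColumn]
      rfl
    refine ⟨⟨⟨(c.row, rank (columns L) x), hmem⟩, ?_⟩, Box.ext rfl ?_⟩
    · rw [← columnColor_boxColumn, hcol]
      exact (Finset.mem_filter.mp hx).2
    · rw [← hxc]
      exact congrArg (rank (columnsOn L B)) hcol

variable (L B) in
/-- The boxes of `λ^B` are the boxes of `λ^{[r]}` with colours in `B`. -/
def coloredBoxEquiv : ColoredBox L B ≃ Box (sumDiagram L B) :=
  Equiv.ofBijective _ coloredBoxMap_bijective

theorem directlyAbove_coloredBoxEquiv {c d : ColoredBox L B} :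
    (coloredBoxEquiv L B c).DirectlyAbove (coloredBoxEquiv L B d) ↔ c.1.DirectlyAbove d.1 :=
  and_congr Iff.rfl col_coloredBoxMap_inj

theorem color_eq_of_directlyAbove {c d : Box (sumDiagram L Finset.univ)} (h : c.DirectlyAbove d) :
    color L c = color L d := by
  rw [← columnColor_boxColumn, ← columnColor_boxColumn, boxColumn_inj.mpr h.2]

/-- The box below lies in the same column and so has the same colour: restricting to `B` never loses
it. -/
theorem exists_directlyAbove_coloredBoxEquiv {p : Box (sumDiagram L B) → Prop} {c : ColoredBox L B} :
    (∃ d, (coloredBoxEquiv L B c).DirectlyAbove d ∧ p d) ↔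
      ∃ d, ∃ h : c.1.DirectlyAbove d,
        p (coloredBoxEquiv L B ⟨d, color_eq_of_directlyAbove h ▸ c.2⟩) := by
  constructor
  · rintro ⟨d, h1, h2⟩
    obtain ⟨d, rfl⟩ := (coloredBoxEquiv L B).surjective d
    exact ⟨d.1, directlyAbove_coloredBoxEquiv.mp h1, h2⟩
  · rintro ⟨d, h1, h2⟩
    exact ⟨_, directlyAbove_coloredBoxEquiv.mpr h1, h2⟩

end Columns

/-! ### Restriction of fillings to a set of colours -/

section Restriction

variable {r : ℕ} {L : Fin r → YoungDiagram} (B : Finset (Fin r))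

/-- The filling of `λ^B` that corresponds to a filling of the boxes with colours in `B`. -/
def fillingOn {S : Type*} (τ : ColoredBox L B → S) : Filling (sumDiagram L B) S :=
  fun c => τ ((coloredBoxEquiv L B).symm c)

theorem fillingOn_apply {S : Type*} (τ : ColoredBox L B → S) (c : ColoredBox L B) :
    fillingOn B τ (coloredBoxEquiv L B c) = τ c := by
  rw [fillingOn, Equiv.symm_apply_apply]

variable {S : Type*} [LinearOrder S] (neg : S → Prop) (σ : Filling (sumDiagram L Finset.univ) S)

theorem mem_desSet_fillingOn (c : ColoredBox L B) :
    coloredBoxEquiv L B c ∈ desSet neg (fillingOn B fun c => σ c.1) ↔ c.1 ∈ desSet neg σ := by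
  simp only [desSet, Finset.mem_filter, Finset.mem_univ, true_and,
    exists_directlyAbove_coloredBoxEquiv, fillingOn_apply]
  simp only [exists_prop]

/-- An inversion pair is determined by rows, the order of columns and the box below its first box,
all of which the restriction preserves. -/
theorem mem_invPairs_fillingOn (c d : ColoredBox L B) :
    (coloredBoxEquiv L B c, coloredBoxEquiv L B d) ∈ invPairs neg (fillingOn B fun c => σ c.1) ↔
      (c.1, d.1) ∈ invPairs neg σ := by
  simp only [invPairs, Finset.mem_filter, Finset.mem_univ, true_and,
    exists_directlyAbove_coloredBoxEquiv, fillingOn_apply]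
  simp only [exists_prop]
  exact and_congr Iff.rfl (and_congr col_coloredBoxMap_lt Iff.rfl)

theorem card_invPairs_fillingOn : (invPairs neg (fillingOn B fun c => σ c.1)).card =
    ((invPairs neg σ).filter fun p => color L p.1 ∈ B ∧ color L p.2 ∈ B).card := by
  symm
  refine Finset.card_bij (fun p hp => (coloredBoxEquiv L B ⟨p.1, (Finset.mem_filter.mp hp).2.1⟩,
    coloredBoxEquiv L B ⟨p.2, (Finset.mem_filter.mp hp).2.2⟩)) ?_ ?_ ?_
  · intro p hp
    exact (mem_invPairs_fillingOn B neg σ _ _).mpr (Finset.mem_filter.mp hp).1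
  · intro p hp p' hp' h
    simp only [Prod.mk.injEq, EmbeddingLike.apply_eq_iff_eq, Subtype.mk.injEq] at h
    exact Prod.ext h.1 h.2
  · rintro ⟨c, d⟩ h
    obtain ⟨c, rfl⟩ := (coloredBoxEquiv L B).surjective c
    obtain ⟨d, rfl⟩ := (coloredBoxEquiv L B).surjective d
    exact ⟨(c.1, d.1), Finset.mem_filter.mpr ⟨(mem_invPairs_fillingOn B neg σ _ _).mp h, c.2, d.2⟩,
      rfl⟩

end Restriction

section SignedWeight

variable {r : ℕ} {L : Fin r → YoungDiagram}

theorem sum_card_filter_eq {α β : Type*} (s : Finset α) (f : α → β) (t : Finset β)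
    [∀ b, DecidablePred fun a => f a = b] [DecidablePred fun a => f a ∈ t] :
    ∑ b ∈ t, (s.filter fun a => f a = b).card = (s.filter fun a => f a ∈ t).card := by
  simp only [Finset.card_filter]
  rw [Finset.sum_comm]
  refine Finset.sum_congr rfl fun a _ => ?_
  split_ifs with h
  · rw [Finset.sum_eq_single (f a) (fun b _ hb => if_neg hb.symm) (fun h' => absurd h h'), if_pos rfl]
  · exact Finset.sum_eq_zero fun b hb => if_neg fun h' : f a = b => h (h' ▸ hb)

/-- The number of edges of `G^σ` with both ends in `B` is the number of inversion pairs with colours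
in `B`. -/
theorem edgesIn_fillingGraph (σ : Filling (sumDiagram L Finset.univ) SuperLetter)
    (B : Finset (Fin r)) : (fillingGraph L σ).edgesIn B =
      ((invPairs IsNeg σ).filter fun p => color L p.1 ∈ B ∧ color L p.2 ∈ B).card := by
  refine (sum_card_filter_eq (invPairs IsNeg σ) (fun p => s(color L p.1, color L p.2)) B.sym2).trans ?_
  refine congrArg _ (Finset.filter_congr fun p _ => ?_)
  exact Finset.mk_mem_sym2_iff

/-- The contribution of a box to the weight of a super filling. -/
def boxFactor {μ : YoungDiagram} (σ : Filling μ SuperLetter) (c : Box μ) : FieldQT :=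
  (if c ∈ desSet IsNeg σ then tt ^ (c.leg + 1) else 1) * if (σ c).IsNeg then -1 else tt

theorem prod_boxFactor {μ : YoungDiagram} (σ : Filling μ SuperLetter) :
    ∏ c, boxFactor σ c = tt ^ maj IsNeg σ * ((-1) ^ numNeg σ * tt ^ numPos σ) := by
  simp only [boxFactor]
  rw [Finset.prod_mul_distrib, neg_one_pow_numNeg_mul, maj, ← Finset.prod_pow_eq_pow_sum]
  congr 1
  rw [← Finset.prod_filter]
  congr 1
  ext c
  simp

theorem signedWeight_eq {μ : YoungDiagram} (σ : Filling μ SuperLetter) :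
    signedWeight σ = qq ^ (invPairs IsNeg σ).card * ∏ c, boxFactor σ c := by
  rw [prod_boxFactor, signedWeight, mul_assoc]

/-- This isolates what the cumulant acts on: the box factors are multiplicative over disjoint sets
of colours, and only the power of `q` couples different colours. -/
theorem signedWeight_fillingOn (B : Finset (Fin r))
    (σ : Filling (sumDiagram L Finset.univ) SuperLetter) :
    signedWeight (fillingOn B fun c => σ c.1) =
      qq ^ (fillingGraph L σ).edgesIn B * ∏ c : ColoredBox L B, boxFactor σ c.1 := by
  rw [signedWeight_eq, card_invPairs_fillingOn, edgesIn_fillingGraph,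
    ← Equiv.prod_comp (coloredBoxEquiv L B)]
  congr 1
  refine Finset.prod_congr rfl fun c _ => ?_
  rw [boxFactor, boxFactor, fillingOn_apply, if_congr (mem_desSet_fillingOn B IsNeg σ c) rfl rfl]
  congr 3
  exact congrArg (· + 1) (leg_coloredBoxMap c)

end SignedWeight

/-! ### Cumulants of sums over maps on colour classes -/

section Products

theorem cumulant_map {J A A' : Type*} [Fintype J] [CommRing A] [CommRing A'] (f : A →+* A')
    (u : Finset J → A) : f (cumulant u) = cumulant fun B => f (u B) := by
  simp only [cumulant, map_sum, map_mul, map_prod, map_pow, map_neg, map_one, map_natCast]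

/-- A product over the blocks of a set partition of sums over the maps on the fibres of a colouring
is a sum over all the maps. -/
theorem prod_parts_sum_piFinset {J ι S R : Type*} [Fintype J] [Fintype ι]
    [DecidableEq ι] [CommRing R] (col : ι → J) [∀ B : Finset J, Fintype {c // col c ∈ B}] (T : ι → Finset S) (π : Finpartition (Finset.univ : Finset J))
    (f : ∀ B : Finset J, ({c // col c ∈ B} → S) → R) :
    ∏ B ∈ π.parts, ∑ τ ∈ Fintype.piFinset (fun c : {c // col c ∈ B} => T c.1), f B τ =
      ∑ σ ∈ Fintype.piFinset T, ∏ B ∈ π.parts, f B fun c => σ c.1 := by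
  rw [← Finset.prod_coe_sort, Finset.prod_univ_sum]
  refine (Finset.sum_bij (fun σ _ => fun (B : π.parts) (c : {c // col c ∈ B.1}) => σ c.1)
    ?_ ?_ ?_ ?_).symm
  · intro σ hσ
    simp only [Fintype.mem_piFinset] at hσ ⊢
    exact fun B c => hσ c.1
  · intro σ _ σ' _ h
    funext c
    obtain ⟨B, hB, hc⟩ := π.exists_mem (Finset.mem_univ (col c))
    exact congrFun (congrFun h ⟨B, hB⟩) ⟨c, hc⟩
  · intro τ hτ
    -- Maps given block by block are glued by reading each value in the block that contains its
    -- colour.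
    have hpart : ∀ c, π.part (col c) ∈ π.parts ∧ col c ∈ π.part (col c) := fun c =>
      ⟨π.part_mem.mpr (Finset.mem_univ _), π.mem_part (Finset.mem_univ _)⟩
    refine ⟨fun c => τ ⟨π.part (col c), (hpart c).1⟩ ⟨c, (hpart c).2⟩, ?_, ?_⟩
    · simp only [Fintype.mem_piFinset] at hτ ⊢
      exact fun c => hτ ⟨_, (hpart c).1⟩ ⟨c, (hpart c).2⟩
    · funext B c
      obtain ⟨B, hB⟩ := B
      obtain ⟨c, hc⟩ := c
      obtain rfl : π.part (col c) = B := π.part_eq_of_mem hB hc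
      rfl
  · intro σ _
    exact (Finset.prod_coe_sort π.parts fun B => f B fun c => σ c.1).symm

theorem prod_parts_prod_subtype {J ι R : Type*} [Fintype J] [Fintype ι] [CommRing R]
    (col : ι → J) [∀ B : Finset J, Fintype {c // col c ∈ B}] (π : Finpartition (Finset.univ : Finset J)) (g : ι → R) :
    ∏ B ∈ π.parts, ∏ c : {c // col c ∈ B}, g c.1 = ∏ c, g c := by
  have h : ∀ B : Finset J, ∏ c : {c // col c ∈ B}, g c.1 =
      ∏ c ∈ Finset.univ.filter fun c => col c ∈ B, g c := fun B =>
    (Finset.prod_subtype _ (by simp) g).symm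
  simp only [h]
  rw [← Finset.prod_biUnion]
  · refine Finset.prod_congr ?_ fun _ _ => rfl
    ext c
    simp only [Finset.mem_biUnion, Finset.mem_filter, Finset.mem_univ, true_and, iff_true]
    exact π.exists_mem (Finset.mem_univ (col c))
  · intro B hB B' hB' hne
    rw [Function.onFun, Finset.disjoint_left]
    intro c hc hc'
    exact hne (π.eq_of_mem_parts hB hB' (Finset.mem_filter.mp hc).2 (Finset.mem_filter.mp hc').2)

/-- The cumulant of sums over the maps on the fibres of a colouring. -/
theorem cumulant_sum_piFinset {J ι S R : Type*} [Fintype J] [Fintype ι] [DecidableEq ι]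
    [CommRing R] (col : ι → J) [∀ B : Finset J, Fintype {c // col c ∈ B}] (T : ι → Finset S)
    (f : ∀ B : Finset J, ({c // col c ∈ B} → S) → R) :
    (cumulant fun B => ∑ τ ∈ Fintype.piFinset (fun c : {c // col c ∈ B} => T c.1), f B τ) =
      ∑ σ ∈ Fintype.piFinset T, cumulant fun B => f B fun c => σ c.1 := by
  simp only [cumulant, prod_parts_sum_piFinset col T, Finset.mul_sum]
  exact Finset.sum_comm

theorem cumulant_mul_prod_subtype {J ι R : Type*} [Fintype J] [Fintype ι] [CommRing R]
    (col : ι → J) [∀ B : Finset J, Fintype {c // col c ∈ B}] (u : Finset J → R) (g : ι → R) :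
    (cumulant fun B => u B * ∏ c : {c // col c ∈ B}, g c.1) = cumulant u * ∏ c, g c := by
  simp only [cumulant, Finset.sum_mul]
  refine Finset.sum_congr rfl fun π _ => ?_
  rw [Finset.prod_mul_distrib, prod_parts_prod_subtype col π g, ← mul_assoc]

end Products

/-! ### Plethysm of the Macdonald cumulant -/

section MacdonaldCumulant

variable {r : ℕ} {L : Fin r → YoungDiagram}

theorem row_coloredBoxEquiv {B : Finset (Fin r)} (c : ColoredBox L B) :
    (coloredBoxEquiv L B c).row = c.1.row := rfl

/-- The plethystic substitution `X(t - 1)` in the Macdonald polynomial of `λ^B`, as a sum over the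
fillings of the boxes with colours in `B`. -/
theorem killCompl_aeval_macdonaldH_sumDiagram {B : Finset (Fin r)} {P : MvPolynomial ℕ+ FieldQT}
    (hP : IsPowerSumExpansion (macdonaldH (sumDiagram L B)) P) (A : Finset ℕ+) :
    killCompl A (MvPolynomial.aeval (fun k : ℕ+ => powerSumAt k alphabetXtSubOne) P) =
      ∑ τ ∈ Fintype.piFinset fun c : ColoredBox L B =>
          (superAlphabet A A).filter fun a => c.1.row + 1 ≤ (a.abs : ℕ),
        MvPowerSeries.C (signedWeight (fillingOn B τ)) * ∏ c, MvPowerSeries.X (τ c).abs := by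
  rw [killCompl_aeval_macdonaldH hP]
  symm
  refine Finset.sum_bij' (fun τ _ => fillingOn B τ) (fun σ _ => fun c => σ (coloredBoxEquiv L B c))
    ?_ ?_ ?_ ?_ ?_
  · intro τ hτ
    simp only [Fintype.mem_piFinset] at hτ ⊢
    intro c
    obtain ⟨c, rfl⟩ := (coloredBoxEquiv L B).surjective c
    rw [fillingOn_apply, row_coloredBoxEquiv]
    exact hτ c
  · intro σ hσ
    simp only [Fintype.mem_piFinset] at hσ ⊢
    intro c
    have := hσ (coloredBoxEquiv L B c)
    rwa [row_coloredBoxEquiv] at this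
  · intro τ _
    funext c
    exact fillingOn_apply B τ c
  · intro σ _
    funext c
    rw [fillingOn, Equiv.apply_symm_apply]
  · intro τ _
    congr 1
    rw [← Equiv.prod_comp (coloredBoxEquiv L B)]
    simp only [fillingOn_apply]

/-- On power-sum expansions the substitution is a ring homomorphism, so it passes through the
cumulant to each Macdonald polynomial. Rows are the same in `λ^B` and `λ^{[r]}`, so compatible
fillings of the blocks glue to compatible fillings `σ` of `λ^{[r]}`. For fixed `σ` the box factors
and indeterminates leave the cumulant, and what remains is the cumulant of `q^(edges of G^σ in B)`.
-/
theorem exists_isPowerSumExpansion_macdonaldCumulant (L : Fin r → YoungDiagram) [NeZero r] :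
    ∃ P, IsPowerSumExpansion (macdonaldCumulant L) P ∧
      MvPolynomial.aeval (fun k : ℕ+ => powerSumAt k alphabetXtSubOne) P =
        fillingSeries SuperLetter.abs
          {σ : Filling (sumDiagram L Finset.univ) SuperLetter | IsCompatible σ}
          fun σ => (fillingGraph L σ).inversionPoly 0 qq * (-1) ^ numNeg σ *
            tt ^ (numPos σ + maj IsNeg σ) := by
  choose P hP using fun B : Finset (Fin r) => hasPowerSumExpansion_macdonaldH (sumDiagram L B)
  refine ⟨MvPolynomial.C (((qq - 1) ^ (r - 1))⁻¹) * cumulant P, ?_, ?_⟩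
  · rw [IsPowerSumExpansion, map_mul, MvPolynomial.aeval_C, MvPowerSeries.algebraMap_apply,
      macdonaldCumulant]
    congr 1
    refine (cumulant_map (MvPolynomial.aeval fun k : ℕ+ => powerSum FieldQT (k : ℕ)).toRingHom
      P).trans ?_
    exact congrArg _ (funext hP)
  · refine ext_killCompl fun A => ?_
    have hT : ∀ a, a ∈ superAlphabet A A ↔ a.abs ∈ A := by
      intro a
      rcases eq_pos_or_eq_bar a with ⟨i, rfl⟩ | ⟨i, rfl⟩
      · rw [pos_mem_superAlphabet, SuperLetter.abs_pos]
      · rw [bar_mem_superAlphabet, abs_bar]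
    have hC : ∀ a, killCompl A (MvPowerSeries.C a : MvPowerSeries ℕ+ FieldQT) = MvPowerSeries.C a :=
      fun a => (killCompl A).commutes a
    set T : Box (sumDiagram L Finset.univ) → Finset SuperLetter := fun c =>
      (superAlphabet A A).filter fun a => c.row + 1 ≤ (a.abs : ℕ) with hTdef
    rw [map_mul, map_mul, MvPolynomial.aeval_C, MvPowerSeries.algebraMap_apply,
      killCompl_fillingSeries _ _ _ _ _ hT]
    have e1 : killCompl A (MvPolynomial.aeval (fun k : ℕ+ => powerSumAt k alphabetXtSubOne)
        (cumulant P)) = cumulant fun B => ∑ τ ∈ Fintype.piFinset fun c : ColoredBox L B => T c.1,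
        MvPowerSeries.C (signedWeight (fillingOn B τ)) * ∏ c, MvPowerSeries.X (τ c).abs := by
      refine (cumulant_map ((killCompl A).toRingHom.comp (MvPolynomial.aeval (R := FieldQT)
        fun k : ℕ+ => powerSumAt k alphabetXtSubOne).toRingHom) P).trans ?_
      exact congrArg _ (funext fun B => killCompl_aeval_macdonaldH_sumDiagram (hP B) A)
    have e2 : ∀ σ : Filling (sumDiagram L Finset.univ) SuperLetter,
        (cumulant fun B => (MvPowerSeries.C (signedWeight (fillingOn B fun c => σ c.1)) *
          ∏ c : ColoredBox L B, MvPowerSeries.X (σ c.1).abs : MvPowerSeries ℕ+ FieldQT)) =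
        MvPowerSeries.C (cumulant fun B => qq ^ (fillingGraph L σ).edgesIn B) *
          ∏ c, (MvPowerSeries.C (boxFactor σ c) * MvPowerSeries.X (σ c).abs) := by
      intro σ
      rw [cumulant_map, ← cumulant_mul_prod_subtype (color L)]
      refine congrArg cumulant (funext fun B => ?_)
      rw [signedWeight_fillingOn, map_mul, mul_assoc, map_prod, Finset.prod_mul_distrib]
    rw [e1, hC, cumulant_sum_piFinset (color L) T fun B τ => (MvPowerSeries.C
      (signedWeight (fillingOn B τ)) * ∏ c, MvPowerSeries.X (τ c).abs :
        MvPowerSeries ℕ+ FieldQT), Finset.mul_sum]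
    -- The normalisation of the Macdonald cumulant cancels exactly the power of `q - 1` produced by
    -- `cumulant_pow_edgesIn`.
    have hq : (qq - 1) ^ (r - 1) ≠ 0 := pow_ne_zero _ (sub_ne_zero.mpr qq_ne_one)
    refine Finset.sum_congr ?_ fun σ _ => ?_
    · ext σ
      rw [@Finset.mem_filter _ _ (_) _ _]
      simp only [Fintype.mem_piFinset, hTdef, Finset.mem_filter]
      exact forall_and
    · rw [e2, cumulant_pow_edgesIn (fillingGraph L σ) qq 0, Fintype.card_fin,
        Finset.prod_mul_distrib, ← map_prod, prod_boxFactor, ← mul_assoc, ← mul_assoc, ← map_mul,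
        ← map_mul, Algebra.algebraMap_self_apply, inv_mul_cancel_left₀ hq, pow_add]
      refine congrArg (fun a => MvPowerSeries.C a * _) ?_
      ring

end MacdonaldCumulant
end MacCumu
end

theorem mainTheorem5 (r : ℕ) [NeZero r] (L : Fin r → YoungDiagram) :
    (∃! P, MacCumu.IsPowerSumExpansion (MacCumu.macdonaldCumulant L) P) ∧
    MacCumu.plethysm (MacCumu.macdonaldCumulant L) MacCumu.alphabetXtSubOne =
      MacCumu.fillingSeries MacCumu.SuperLetter.abs
        {σ : MacCumu.Filling (MacCumu.sumDiagram L Finset.univ) MacCumu.SuperLetter |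
          MacCumu.IsCompatible σ}
        (fun σ =>
          (MacCumu.fillingGraph L σ).inversionPoly 0 MacCumu.qq *
            (-1) ^ MacCumu.numNeg σ *
            MacCumu.tt ^ (MacCumu.numPos σ + MacCumu.maj MacCumu.SuperLetter.IsNeg σ)) := by
  obtain ⟨P, hP, h⟩ := MacCumu.exists_isPowerSumExpansion_macdonaldCumulant L
  exact ⟨⟨P, hP, fun P' hP' => hP'.unique hP⟩, (hP.plethysm_eq _).trans h⟩
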